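/- Fix an o-minimal structure expanding the real field; "definable" means definable in it, with real parameters. For linear subspaces $E,F\subset\mathbb R^n$ put $\delta(E,F)=\sup\{d(u,F): u\in E,\ |u|=1\}$ (and $\delta(0,F)=0$). Let $X,Y\subset\mathbb R^n$ be disjoint connected definable $C^2$ submanifolds with $\dim X=k$ and $\dim Y=k+1$, such that $X\subset\overline{Y}$ and $X\cup Y$ is locally closed in $\mathbb R^n$. Assume that $Y$ is connected near $X$, that is, for every $x\in X$ the set $Y\cap B(x,\varepsilon)$ is connected for all sufficiently small $\varepsilon>0$. Assume that at every point $x\in X$ the pair $(Y,X)$ satisfies (a) Whitney's condition $(a)$: $\delta(T_xX,T_yY)\to 0$ as $y\to x$, $y\in Y$; ($r_{\int}$) in some definable $C^2$ coordinate system of $\mathbb R^n$ around $x$ which identifies $x$ with $0$ and $X$ with a neighbourhood of $0$ in $\mathbb R^k\times 0$, the function $$r(t)=\sup_{y\in Y,\ |\pi(y)|=t}\frac{\delta(\mathbb R^k\times 0,\,T_yY)}{|y-\pi(y)|}\in[0,\infty]$$ (with $Y$ read in the domain of these coordinates, $\pi$ the orthogonal projection onto $\mathbb R^k\times 0$, and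 $\sup\emptyset=0$) satisfies $\int_0^\varepsilon r(t)\,dt<\infty$ for some $\varepsilon>0$. Then $X\cup Y$ is a $C^1$ submanifold with boundary of $\mathbb R^n$, of dimension $k+1$, with boundary $X$. -/

import Mathlib

open Set Filter Topology MeasureTheory
open scoped ENNReal

noncomputable section

/-- The Euclidean space `ℝⁿ`. -/
abbrev Eucl (n : ℕ) : Type := EuclideanSpace ℝ (Fin n)

/-! ### O-minimal structures on the real field

A structure is given by a first-order language `L` interpreted on `ℝ`; definable means definable
by an `L`-formula with arbitrary real parameters. -/

/-- The `L`-structure on `ℝ` is an o-minimal structure expanding the real field: the graphs of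
addition and multiplication are definable (hence so is the order), and every definable subset
of `ℝ` is a finite union of intervals (points, bounded or unbounded intervals). -/
structure IsOMinimal (L : FirstOrder.Language) [L.Structure ℝ] : Prop where
  definable_add : (univ : Set ℝ).Definable L {v : Fin 3 → ℝ | v 0 + v 1 = v 2}
  definable_mul : (univ : Set ℝ).Definable L {v : Fin 3 → ℝ | v 0 * v 1 = v 2}
  finite_union : ∀ s : Set ℝ, (univ : Set ℝ).Definable₁ L s →
    ∃ I : Set (Set ℝ), I.Finite ∧ (∀ J ∈ I, J.OrdConnected) ∧ s = ⋃₀ I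

/-- Definable subsets of `ℝⁿ`. -/
def IsDefinableSet (L : FirstOrder.Language) [L.Structure ℝ] {n : ℕ} (A : Set (Eucl n)) : Prop :=
  (univ : Set ℝ).Definable L {v : Fin n → ℝ | WithLp.toLp 2 v ∈ A}

/-- The local homeomorphism `φ` of `ℝⁿ` is definable, that is, its graph (over its open domain)
is a definable subset of `ℝⁿ × ℝⁿ`. -/
def IsDefinableChart (L : FirstOrder.Language) [L.Structure ℝ] {n : ℕ}
    (φ : OpenPartialHomeomorph (Eucl n) (Eucl n)) : Prop :=
  (univ : Set ℝ).Definable L {v : Fin n ⊕ Fin n → ℝ |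
    WithLp.toLp 2 (fun i => v (Sum.inl i)) ∈ φ.source ∧
      φ (WithLp.toLp 2 (fun i => v (Sum.inl i))) = WithLp.toLp 2 (fun i => v (Sum.inr i))}

/-! ### Submanifolds of `ℝⁿ` -/

/-- The coordinate subspace `ℝᵈ × 0` of `ℝⁿ`. -/
def flat (n d : ℕ) : Submodule ℝ (Eucl n) where
  carrier := {z | ∀ i : Fin n, d ≤ i.val → z i = 0}
  add_mem' := by
    intro a b ha hb i hi
    simp [ha i hi, hb i hi]
  zero_mem' := by
    intro i _
    simp
  smul_mem' := by
    intro c a ha i hi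
    simp [ha i hi]

/-- The closed half-space `{z ∈ ℝᵏ⁺¹ × 0 : z_{k+1} ≥ 0}` of `ℝᵏ⁺¹ × 0 ⊆ ℝⁿ`; the last of the
`k + 1` coordinates has index `k`. -/
def halfFlat (n k : ℕ) : Set (Eucl n) :=
  {z | z ∈ flat n (k + 1) ∧ ∀ i : Fin n, i.val = k → 0 ≤ z i}

/-- `φ` is a `C^p` coordinate system on an open subset of `ℝⁿ`. -/
def IsCpChart (p : ℕ) {n : ℕ} (φ : OpenPartialHomeomorph (Eucl n) (Eucl n)) : Prop :=
  ContDiffOn ℝ p φ φ.source ∧ ContDiffOn ℝ p φ.symm φ.target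

/-- `M` is an (embedded) `C^p` submanifold of `ℝⁿ`, without boundary, of dimension `d`. -/
def IsCpSubmanifold (p d : ℕ) {n : ℕ} (M : Set (Eucl n)) : Prop :=
  d ≤ n ∧ ∀ x ∈ M, ∃ φ : OpenPartialHomeomorph (Eucl n) (Eucl n),
    x ∈ φ.source ∧ IsCpChart p φ ∧ φ.IsImage M (flat n d)

/-- `M` is an (embedded) `C^p` submanifold with boundary of `ℝⁿ`, of dimension `k + 1`, and its
boundary is `B`: near a point of `B` the pair `(M, B)` is, in suitable `C^p` coordinates, the
pair (half-space of `ℝᵏ⁺¹`, `ℝᵏ`), and near the other points of `M` the set `M` is `ℝᵏ⁺¹`. -/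
def IsCpSubmanifoldWithBoundary (p k : ℕ) {n : ℕ} (M B : Set (Eucl n)) : Prop :=
  k + 1 ≤ n ∧ B ⊆ M ∧
  (∀ x ∈ B, ∃ φ : OpenPartialHomeomorph (Eucl n) (Eucl n),
    x ∈ φ.source ∧ IsCpChart p φ ∧ φ.IsImage M (halfFlat n k) ∧ φ.IsImage B (flat n k)) ∧
  (∀ x ∈ M \ B, ∃ φ : OpenPartialHomeomorph (Eucl n) (Eucl n),
    x ∈ φ.source ∧ IsCpChart p φ ∧ φ.IsImage M (flat n (k + 1)))

/-- The tangent space at `y` of a submanifold `M` of `ℝⁿ`: the vectors that are velocities at `y`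
of curves in `M` (these already form a subspace when `M` is a `C¹` submanifold and `y ∈ M`). -/
def tangentSpaceOf {n : ℕ} (M : Set (Eucl n)) (y : Eucl n) : Submodule ℝ (Eucl n) :=
  Submodule.span ℝ {v | ∃ γ : ℝ → Eucl n, γ 0 = y ∧ (∀ᶠ t in 𝓝 0, γ t ∈ M) ∧ HasDerivAt γ v 0}

/-! ### The regularity conditions -/

/-- `δ(E, F) = sup {d(u, F) : u ∈ E, |u| = 1}`, which is `0` for `E = 0`. -/
def gapDist {n : ℕ} (E F : Submodule ℝ (Eucl n)) : ℝ≥0∞ :=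
  ⨆ (u : Eucl n) (_ : u ∈ E) (_ : ‖u‖ = 1), Metric.infEDist u (F : Set (Eucl n))

/-- Whitney's condition `(a)` for `(Y, X)` at `x ∈ X`. -/
def ConditionA {n : ℕ} (Y X : Set (Eucl n)) (x : Eucl n) : Prop :=
  Tendsto (fun y => gapDist (tangentSpaceOf X x) (tangentSpaceOf Y y)) (𝓝[Y] x) (𝓝 0)

/-- `r(t) = sup {δ(ℝᵏ × 0, T_y Y) / |y - π(y)| : y ∈ Y, |π(y)| = t}`, a value in `[0, ∞]`, where
`π` is the orthogonal projection of `ℝⁿ` onto `ℝᵏ × 0`. -/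
def ratioFun {n : ℕ} (k : ℕ) (Y : Set (Eucl n)) (t : ℝ) : ℝ≥0∞ :=
  ⨆ (y : Eucl n) (_ : y ∈ Y) (_ : ‖(flat n k).starProjection y‖ = t),
    gapDist (flat n k) (tangentSpaceOf Y y) / edist y ((flat n k).starProjection y)

/-- The condition `(r_∫)` for `(Y, X)` at `x ∈ X`, `k = dim X`: in some definable `C²` coordinates
around `x` which identify `x` with `0` and `X` with a neighbourhood of `0` in `ℝᵏ × 0`, the function
`r` of (the image of) `Y` has a finite integral over `[0, ε]` for some `ε > 0`. -/
def ConditionRInt (L : FirstOrder.Language) [L.Structure ℝ] {n : ℕ} (k : ℕ)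
    (Y X : Set (Eucl n)) (x : Eucl n) : Prop :=
  ∃ φ : OpenPartialHomeomorph (Eucl n) (Eucl n),
    x ∈ φ.source ∧ φ x = 0 ∧ IsCpChart 2 φ ∧ IsDefinableChart L φ ∧ φ.IsImage X (flat n k) ∧
    ∃ ε : ℝ, 0 < ε ∧ ∫⁻ t in Icc 0 ε, ratioFun k (φ '' (φ.source ∩ Y)) t < ∞

end

/-!
In coordinates with `X = ℝᵏ × 0`, let `x = π(y)`, let `ρ = |y - π(y)|`, and let `N(y)` be the unit
vector in the direction of `y - π(y)`. This direction is asymptotically tangent to `Y`: along a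
definable curve in `Y` on which it stays away from the tangent spaces, `|x|' r(|x|)` would dominate
a multiple of `ρ' / ρ`, whose integral diverges. Together with condition `(a)` this makes `(x, ρ)`
local coordinates on `Y`, with a proper coordinate map near `X`. Hence `Y` is a covering of a simply
connected box, and it has a single sheet because `Y` is connected near `X`.

The derivative of `N` in the direction of `x` is bounded by a multiple of `r(|x|)`, so that
`N(x, ρ) - N(0, ρ)` tends to `0` with `x`, uniformly in `ρ`, while `N(0, ρ)` converges by
definability. So `N` has a limit `θ`, and the tangent spaces of `Y` converge to the sum of `ℝᵏ × 0`
and `ℝ θ`. As this happens at every point of `X` near the given one, the extension of `y - π(y)` to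
an odd function of `ρ` is `C¹`, and the inverse function theorem provides the boundary chart.
-/

/-! ### Definable predicates and functions -/

section Definability

variable {L : FirstOrder.Language} [L.Structure ℝ] {α β : Type}

/-- A predicate on tuples of reals is definable, with real parameters. -/
def DefPred (L : FirstOrder.Language) [L.Structure ℝ] (P : (α → ℝ) → Prop) : Prop :=
  (univ : Set ℝ).Definable L {v | P v}

/-- A real function of tuples of reals is definable, with real parameters. -/
def DefFn (L : FirstOrder.Language) [L.Structure ℝ] (f : (α → ℝ) → ℝ) : Prop :=
  (univ : Set ℝ).DefinableFun L f

/-- A vector function of tuples of reals is definable. -/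
def DefVec (L : FirstOrder.Language) [L.Structure ℝ] {n : ℕ} (f : (α → ℝ) → Eucl n) : Prop :=
  ∀ i, DefFn L fun v => f v i

/-- A real function of a real variable is definable. -/
def DefReal (L : FirstOrder.Language) [L.Structure ℝ] (f : ℝ → ℝ) : Prop :=
  DefFn L fun v : Fin 1 → ℝ => f (v 0)

namespace DefPred

theorem and {P Q : (α → ℝ) → Prop} (hP : DefPred L P) (hQ : DefPred L Q) :
    DefPred L fun v => P v ∧ Q v := Set.Definable.inter hP hQ

theorem or {P Q : (α → ℝ) → Prop} (hP : DefPred L P) (hQ : DefPred L Q) :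
    DefPred L fun v => P v ∨ Q v := Set.Definable.union hP hQ

theorem not {P : (α → ℝ) → Prop} (hP : DefPred L P) : DefPred L fun v => ¬ P v :=
  Set.Definable.compl hP

theorem imp {P Q : (α → ℝ) → Prop} (hP : DefPred L P) (hQ : DefPred L Q) :
    DefPred L fun v => P v → Q v := by
  simpa only [imp_iff_not_or] using hP.not.or hQ

theorem reindex {P : (α → ℝ) → Prop} (hP : DefPred L P) (σ : α → β) :
    DefPred L fun w : β → ℝ => P fun i => w (σ i) := Set.Definable.preimage_comp σ hP

theorem comp [Finite β] {P : (β → ℝ) → Prop} (hP : DefPred L P) {F : (α → ℝ) → β → ℝ}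
    (hF : ∀ i, DefFn L fun v => F v i) : DefPred L fun v => P (F v) :=
  Set.Definable.preimage_map (F := F) hF hP

theorem exists_vec {n : ℕ} {P : (α → ℝ) → Eucl n → Prop}
    (hP : DefPred L fun w : α ⊕ Fin n → ℝ =>
      P (fun i => w (.inl i)) (WithLp.toLp 2 fun i => w (.inr i))) :
    DefPred L fun v => ∃ y, P v y := by
  unfold DefPred
  convert! Set.Definable.exists_of_finite hP using 1
  ext v
  exact ⟨fun ⟨y, hy⟩ => ⟨y.ofLp, hy⟩, fun ⟨y, hy⟩ => ⟨WithLp.toLp 2 y, hy⟩⟩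

theorem forall_vec {n : ℕ} {P : (α → ℝ) → Eucl n → Prop}
    (hP : DefPred L fun w : α ⊕ Fin n → ℝ =>
      P (fun i => w (.inl i)) (WithLp.toLp 2 fun i => w (.inr i))) :
    DefPred L fun v => ∀ y, P v y := by
  simpa using (exists_vec (P := fun v y => ¬ P v y) hP.not).not

theorem exists_real {P : (α → ℝ) → ℝ → Prop}
    (hP : DefPred L fun w : α ⊕ Fin 1 → ℝ => P (fun i => w (.inl i)) (w (.inr 0))) :
    DefPred L fun v => ∃ x, P v x := by
  unfold DefPred
  convert! Set.Definable.exists_of_finite hP using 1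
  ext v
  exact ⟨fun ⟨y, hy⟩ => ⟨fun _ => y, hy⟩, fun ⟨y, hy⟩ => ⟨y 0, hy⟩⟩

theorem forall_real {P : (α → ℝ) → ℝ → Prop}
    (hP : DefPred L fun w : α ⊕ Fin 1 → ℝ => P (fun i => w (.inl i)) (w (.inr 0))) :
    DefPred L fun v => ∀ x, P v x := by
  simpa using (exists_real (P := fun v y => ¬ P v y) hP.not).not

theorem mem {n : ℕ} {A : Set (Eucl n)} (hA : IsDefinableSet L A) {f : (α → ℝ) → Eucl n}
    (hf : DefVec L f) : DefPred L fun v => f v ∈ A :=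
  DefPred.comp (P := fun w => WithLp.toLp 2 w ∈ A) hA (F := fun v => (f v).ofLp) hf

end DefPred

namespace DefFn

theorem proj (i : α) : DefFn L fun v => v i := Set.DefinableFun.proj L

theorem const (c : ℝ) : DefFn L fun _ : α → ℝ => c := L.definableFun_const α (mem_univ c)

theorem of_graph {f : (α → ℝ) → ℝ}
    (h : DefPred L fun w : α ⊕ Fin 1 → ℝ => f (fun i => w (.inl i)) = w (.inr 0)) : DefFn L f :=
  h.reindex (Sum.elim some (fun _ => none) : α ⊕ Fin 1 → Option α)

theorem comp [Finite β] {f : (β → ℝ) → ℝ} (hf : DefFn L f) {F : (α → ℝ) → β → ℝ}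
    (hF : ∀ i, DefFn L fun v => F v i) : DefFn L fun v => f (F v) :=
  Set.DefinableFun.comp (g := F) hF hf

theorem reindex {f : (α → ℝ) → ℝ} (hf : DefFn L f) (σ : α → β) :
    DefFn L fun w : β → ℝ => f fun i => w (σ i) := by
  apply of_graph
  exact DefPred.reindex (P := fun v : Option α → ℝ => f (fun i => v (some i)) = v none) hf
    fun j => (j.elim (.inr 0) fun i => .inl (σ i) : β ⊕ Fin 1)

end DefFn

theorem DefPred.eq {f g : (α → ℝ) → ℝ} (hf : DefFn L f) (hg : DefFn L g) :
    DefPred L fun v => f v = g v := Set.DefinableFun.ofPred_eq hf hg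

theorem DefVec.toLp {n : ℕ} (σ : Fin n → α) : DefVec L fun v => WithLp.toLp 2 fun i => v (σ i) :=
  fun _ => DefFn.proj _

theorem DefReal.comp {f : ℝ → ℝ} (hf : DefReal L f) {g : (α → ℝ) → ℝ} (hg : DefFn L g) :
    DefFn L fun v => f (g v) :=
  DefFn.comp (f := fun v : Fin 1 → ℝ => f (v 0)) hf (F := fun v _ => g v) fun _ => hg

variable [hL : Fact (IsOMinimal L)]

namespace DefFn

theorem add {f g : (α → ℝ) → ℝ} (hf : DefFn L f) (hg : DefFn L g) :
    DefFn L fun v => f v + g v := by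
  apply of_graph
  refine DefPred.comp (P := fun v : Fin 3 → ℝ => v 0 + v 1 = v 2) hL.out.definable_add
    (F := fun w : α ⊕ Fin 1 → ℝ => ![f fun i => w (.inl i), g fun i => w (.inl i), w (.inr 0)]) ?_
  intro i
  fin_cases i
  exacts [hf.reindex _, hg.reindex _, proj _]

theorem mul {f g : (α → ℝ) → ℝ} (hf : DefFn L f) (hg : DefFn L g) :
    DefFn L fun v => f v * g v := by
  apply of_graph
  refine DefPred.comp (P := fun v : Fin 3 → ℝ => v 0 * v 1 = v 2) hL.out.definable_mul
    (F := fun w : α ⊕ Fin 1 → ℝ => ![f fun i => w (.inl i), g fun i => w (.inl i), w (.inr 0)]) ?_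
  intro i
  fin_cases i
  exacts [hf.reindex _, hg.reindex _, proj _]

theorem neg {f : (α → ℝ) → ℝ} (hf : DefFn L f) : DefFn L fun v => - f v := by
  simpa using (const (-1)).mul hf

theorem sub {f g : (α → ℝ) → ℝ} (hf : DefFn L f) (hg : DefFn L g) :
    DefFn L fun v => f v - g v := by
  simpa [sub_eq_add_neg] using hf.add hg.neg

theorem sum {ι : Type} (s : Finset ι) {f : ι → (α → ℝ) → ℝ} (hf : ∀ i, DefFn L (f i)) :
    DefFn L fun v => ∑ i ∈ s, f i v := by
  classical
  induction s using Finset.induction_on with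
  | empty => simpa using const (L := L) (α := α) 0
  | insert a s ha ih => simpa [Finset.sum_insert ha] using (hf a).add ih

end DefFn

namespace DefPred

theorem le {f g : (α → ℝ) → ℝ} (hf : DefFn L f) (hg : DefFn L g) :
    DefPred L fun v => f v ≤ g v := by
  have hsq : ∀ a b : ℝ, a ≤ b ↔ ∃ z, a + z * z = b := fun a b =>
    ⟨fun h => ⟨√(b - a), by rw [Real.mul_self_sqrt (sub_nonneg.2 h), add_sub_cancel]⟩,
      fun ⟨z, hz⟩ => hz ▸ le_add_of_nonneg_right (mul_self_nonneg z)⟩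
  simp only [hsq]
  exact .exists_real (.eq ((hf.reindex _).add ((DefFn.proj _).mul (DefFn.proj _))) (hg.reindex _))

theorem lt {f g : (α → ℝ) → ℝ} (hf : DefFn L f) (hg : DefFn L g) :
    DefPred L fun v => f v < g v := by
  simpa using (le hg hf).not

end DefPred

namespace DefFn

theorem inv {f : (α → ℝ) → ℝ} (hf : DefFn L f) : DefFn L fun v => (f v)⁻¹ := by
  apply of_graph
  have hf' : DefFn L fun w : α ⊕ Fin 1 → ℝ => f fun i => w (.inl i) := hf.reindex _
  have hgraph : ∀ a b : ℝ, a⁻¹ = b ↔ a * b = 1 ∨ a = 0 ∧ b = 0 := fun a b => by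
    rcases eq_or_ne a 0 with rfl | ha
    · simp [eq_comm]
    · simp only [ha, false_and, or_false]
      exact ⟨fun h => h ▸ mul_inv_cancel₀ ha, inv_eq_of_mul_eq_one_right⟩
  simp only [hgraph]
  exact .or (.eq (hf'.mul (proj _)) (const 1)) (.and (.eq hf' (const 0)) (.eq (proj _) (const 0)))

theorem div {f g : (α → ℝ) → ℝ} (hf : DefFn L f) (hg : DefFn L g) :
    DefFn L fun v => f v / g v := by
  simpa [div_eq_mul_inv] using hf.mul hg.inv

theorem sqrt {f : (α → ℝ) → ℝ} (hf : DefFn L f) : DefFn L fun v => √(f v) := by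
  apply of_graph
  have hf' : DefFn L fun w : α ⊕ Fin 1 → ℝ => f fun i => w (.inl i) := hf.reindex _
  simp only [Real.sqrt_eq_cases]
  exact .or (.and (.eq ((proj _).mul (proj _)) hf') (.le (const 0) (proj _)))
    (.and (.lt hf' (const 0)) (.eq (proj _) (const 0)))

theorem abs {f : (α → ℝ) → ℝ} (hf : DefFn L f) : DefFn L fun v => |f v| := by
  simpa [← Real.sqrt_mul_self_eq_abs] using (hf.mul hf).sqrt

end DefFn

namespace DefVec

theorem inner {n : ℕ} {f g : (α → ℝ) → Eucl n} (hf : DefVec L f) (hg : DefVec L g) :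
    DefFn L fun v => inner ℝ (f v) (g v) := by
  simpa [PiLp.inner_apply] using DefFn.sum Finset.univ fun i => (hg i).mul (hf i)

theorem norm {n : ℕ} {f : (α → ℝ) → Eucl n} (hf : DefVec L f) : DefFn L fun v => ‖f v‖ := by
  simpa [EuclideanSpace.norm_eq, pow_two, ← Real.sqrt_mul_self_eq_abs] using
    (DefFn.sum Finset.univ fun i => (hf i).abs.mul (hf i).abs).sqrt

theorem sub {n : ℕ} {f g : (α → ℝ) → Eucl n} (hf : DefVec L f) (hg : DefVec L g) :
    DefVec L fun v => f v - g v := fun i => (hf i).sub (hg i)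

end DefVec

end Definability

/-! ### Definable functions of one real variable -/

section RealGerms

theorem ordConnected_eventually_mem_or_notMem {α : Type*} [LinearOrder α] [TopologicalSpace α]
    [OrderClosedTopology α] {J : Set α} (hJ : J.OrdConnected) (a : α) :
    (∀ᶠ x in 𝓝[>] a, x ∈ J) ∨ ∀ᶠ x in 𝓝[>] a, x ∉ J := by
  refine or_iff_not_imp_right.2 fun hfreq => ?_
  replace hfreq : ∃ᶠ x in 𝓝[>] a, x ∈ J := hfreq
  obtain ⟨p, hpJ, hap⟩ := (hfreq.and_eventually self_mem_nhdsWithin).exists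
  filter_upwards [Ioo_mem_nhdsGT hap] with x hx
  obtain ⟨q, hqJ, hq⟩ := (hfreq.and_eventually (Ioo_mem_nhdsGT hx.1)).exists
  exact hJ.out hqJ hpJ ⟨hq.2.le, hx.2.le⟩

theorem monotoneOn_Ioo_of_eventually {β : Type*} [Preorder β] {f : ℝ → β} {a b : ℝ}
    (hr : ∀ x ∈ Ioo a b, ∀ᶠ y in 𝓝[>] x, f x ≤ f y)
    (hl : ∀ x ∈ Ioo a b, ∀ᶠ y in 𝓝[<] x, f y ≤ f x) : MonotoneOn f (Ioo a b) := by
  intro u hu v hv huv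
  set S := {t ∈ Icc u v | ∀ s ∈ Icc u t, f u ≤ f s}
  have huS : u ∈ S := ⟨⟨le_rfl, huv⟩, fun s hs => (le_antisymm hs.2 hs.1 ▸ le_rfl)⟩
  have hbdd : BddAbove S := ⟨v, fun t ht => ht.1.2⟩
  set c := sSup S
  have huc : u ≤ c := le_csSup hbdd huS
  have hcv : c ≤ v := csSup_le ⟨u, huS⟩ fun t ht => ht.1.2
  have hc : c ∈ Ioo a b := ⟨hu.1.trans_le huc, hcv.trans_lt hv.2⟩
  have hlt : ∀ s, u ≤ s → s < c → f u ≤ f s := fun s hus hsc => by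
    obtain ⟨t, ht, hst⟩ := exists_lt_of_lt_csSup ⟨u, huS⟩ hsc
    exact ht.2 s ⟨hus, hst.le⟩
  have hfc : f u ≤ f c := by
    rcases huc.eq_or_lt with h | h
    · rw [← h]
    · obtain ⟨y, hy, hyuc⟩ := ((hl c hc).and (Ioo_mem_nhdsLT h)).exists
      exact (hlt y hyuc.1.le hyuc.2).trans hy
  suffices hcv' : c = v from hcv' ▸ hfc
  by_contra hne
  obtain ⟨d, hcd, hd⟩ := mem_nhdsGT_iff_exists_Ioo_subset.1 (hr c hc)
  obtain ⟨e, hce, hed⟩ := exists_between (lt_min (mem_Ioi.1 hcd) (hcv.lt_of_ne hne))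
  have heS : e ∈ S := by
    refine ⟨⟨huc.trans hce.le, (hed.trans_le (min_le_right _ _)).le⟩, fun s hs => ?_⟩
    rcases lt_trichotomy s c with hsc | rfl | hcs
    · exact hlt s hs.1 hsc
    · exact hfc
    · exact hfc.trans (hd ⟨hcs, hs.2.trans_lt (hed.trans_le (min_le_left _ _))⟩)
  exact hce.not_ge (le_csSup hbdd heS)

theorem countable_setOf_localMin_of_strict_left {β : Type*} [Preorder β] (f : ℝ → β) :
    {x | (∀ᶠ y in 𝓝[<] x, f x < f y) ∧ ∀ᶠ y in 𝓝[>] x, f x ≤ f y}.Countable := by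
  set A := {x | (∀ᶠ y in 𝓝[<] x, f x < f y) ∧ ∀ᶠ y in 𝓝[>] x, f x ≤ f y}
  have hrat : ∀ x : A, ∃ p q : ℚ, (p : ℝ) < x ∧ (x : ℝ) < q ∧
      (∀ y ∈ Ioo (p : ℝ) x, f x < f y) ∧ ∀ y ∈ Ioo (x : ℝ) q, f x ≤ f y := by
    rintro ⟨x, hl, hr⟩
    obtain ⟨p', hp', hpx⟩ := mem_nhdsLT_iff_exists_Ioo_subset.1 hl
    obtain ⟨q', hq', hxq⟩ := mem_nhdsGT_iff_exists_Ioo_subset.1 hr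
    obtain ⟨p, hp, hp''⟩ := exists_rat_btwn (mem_Iio.1 hp')
    obtain ⟨q, hq, hq''⟩ := exists_rat_btwn (mem_Ioi.1 hq')
    exact ⟨p, q, hp'', hq, fun y hy => hpx ⟨hp.trans hy.1, hy.2⟩,
      fun y hy => hxq ⟨hy.1, hy.2.trans hq''⟩⟩
  choose p q hp hq hleft hright using hrat
  have hnotlt : ∀ x y : A, p x = p y → q x = q y → ¬ (x : ℝ) < y := fun x y hpxy hqxy hxy =>
    (hleft y x ⟨hpxy ▸ hp x, hxy⟩).not_ge (hright x y ⟨hxy, hqxy ▸ hq y⟩)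
  have hinj : Function.Injective fun x : A => (p x, q x) := fun x y hxy => by
    obtain ⟨hpxy, hqxy⟩ := Prod.mk.inj hxy
    exact Subtype.ext (le_antisymm (not_lt.1 (hnotlt y x hpxy.symm hqxy.symm))
      (not_lt.1 (hnotlt x y hpxy hqxy)))
  exact hinj.countable

theorem not_eventually_nhdsGT_mem_of_countable {A : Set ℝ} (hA : A.Countable) (a : ℝ) :
    ¬ ∀ᶠ x in 𝓝[>] a, x ∈ A := fun h => by
  obtain ⟨b, hab, hb⟩ := mem_nhdsGT_iff_exists_Ioo_subset.1 h
  exact (Cardinal.Real.Ioo_countable_iff.1 (hA.mono hb)).not_gt hab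

theorem exists_mem_Ioo_differentiableAt_of_monotoneOn {f : ℝ → ℝ} {a b : ℝ} (hab : a < b)
    (hf : MonotoneOn f (Ioo a b)) : ∃ x ∈ Ioo a b, DifferentiableAt ℝ f x := by
  by_contra! hnot
  have hnull : volume (Ioo a b) = 0 := by
    refine measure_mono_null (fun x hx => ?_) hf.ae_differentiableWithinAt_of_mem
    exact fun hd => hnot x hx ((hd hx).differentiableAt (Ioo_mem_nhds hx.1 hx.2))
  rw [Real.volume_Ioo, ENNReal.ofReal_eq_zero] at hnull
  linarith

theorem deriv_eq_iff_hasDerivAt_or {f : ℝ → ℝ} {x c : ℝ} :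
    deriv f x = c ↔ HasDerivAt f c x ∨ (¬ ∃ c', HasDerivAt f c' x) ∧ c = 0 := by
  by_cases hd : DifferentiableAt ℝ f x
  · have hex : ∃ c', HasDerivAt f c' x := ⟨_, hd.hasDerivAt⟩
    simp only [hex, not_true_eq_false, false_and, or_false]
    exact ⟨fun h => h ▸ hd.hasDerivAt, HasDerivAt.deriv⟩
  · have hne : ∀ c', ¬ HasDerivAt f c' x := fun c' h => hd h.differentiableAt
    simp [hne, deriv_zero_of_not_differentiableAt hd, eq_comm]

end RealGerms

section OneVariable

variable {L : FirstOrder.Language} [L.Structure ℝ] [hL : Fact (IsOMinimal L)]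

theorem eventually_nhdsGT_or_not {P : ℝ → Prop} (hP : DefPred L fun v : Fin 1 → ℝ => P (v 0))
    (a : ℝ) : (∀ᶠ x in 𝓝[>] a, P x) ∨ ∀ᶠ x in 𝓝[>] a, ¬ P x := by
  obtain ⟨I, hI, hconn, hunion⟩ := hL.out.finite_union {x | P x} hP
  have hP_iff : ∀ x, P x ↔ ∃ J ∈ I, x ∈ J := fun x => by rw [← mem_sUnion, ← hunion, mem_ofPred_eq]
  simp only [hP_iff]
  refine or_iff_not_imp_left.2 fun hnot => ?_
  have hnotMem : ∀ J ∈ I, ∀ᶠ x in 𝓝[>] a, x ∉ J := fun J hJI =>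
    (ordConnected_eventually_mem_or_notMem (hconn J hJI) a).resolve_left fun hJ =>
      hnot (hJ.mono fun x hx => ⟨J, hJI, hx⟩)
  exact ((eventually_all_finite hI).2 hnotMem).mono fun x hx ⟨J, hJI, hxJ⟩ => hx J hJI hxJ

theorem eventually_nhdsLT_or_not {P : ℝ → Prop} (hP : DefPred L fun v : Fin 1 → ℝ => P (v 0))
    (a : ℝ) : (∀ᶠ x in 𝓝[<] a, P x) ∨ ∀ᶠ x in 𝓝[<] a, ¬ P x := by
  have hP' : DefPred L fun v : Fin 1 → ℝ => P (-(v 0)) :=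
    DefPred.comp (P := fun w : Fin 1 → ℝ => P (w 0)) hP (F := fun v _ => -(v 0))
      fun _ => (DefFn.proj _).neg
  exact (eventually_nhdsGT_or_not (P := fun x => P (-x)) hP' (-a)).imp
    (fun h => by simpa using tendsto_neg_nhdsLT.eventually h)
    (fun h => by simpa using tendsto_neg_nhdsLT.eventually h)

namespace DefReal

theorem neg {f : ℝ → ℝ} (hf : DefReal L f) : DefReal L fun x => -f x := DefFn.neg hf

theorem sub {f g : ℝ → ℝ} (hf : DefReal L f) (hg : DefReal L g) : DefReal L fun x => f x - g x :=
  DefFn.sub hf hg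

theorem div {f g : ℝ → ℝ} (hf : DefReal L f) (hg : DefReal L g) : DefReal L fun x => f x / g x :=
  DefFn.div hf hg

theorem defPred_eventually_nhdsGT_le {f : ℝ → ℝ} (hf : DefReal L f) :
    DefPred L fun v : Fin 1 → ℝ => ∀ᶠ y in 𝓝[>] (v 0), f (v 0) ≤ f y := by
  have hdef : DefPred L fun v : Fin 1 → ℝ =>
      ∃ d, v 0 < d ∧ ∀ y, v 0 < y → y < d → f (v 0) ≤ f y :=
    .exists_real (.and (.lt (.proj _) (.proj _)) (.forall_real (.imp (.lt (.proj _) (.proj _))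
      (.imp (.lt (.proj _) (.proj _)) (.le (hf.comp (.proj _)) (hf.comp (.proj _)))))))
  convert! hdef using 3 with v
  rw [Filter.Eventually, mem_nhdsGT_iff_exists_Ioo_subset]
  simp only [subset_def, mem_Ioo, mem_Ioi, and_imp, mem_ofPred_eq]

theorem defPred_eventually_nhdsLT_le {f : ℝ → ℝ} (hf : DefReal L f) :
    DefPred L fun v : Fin 1 → ℝ => ∀ᶠ y in 𝓝[<] (v 0), f y ≤ f (v 0) := by
  have hdef : DefPred L fun v : Fin 1 → ℝ =>
      ∃ d, d < v 0 ∧ ∀ y, d < y → y < v 0 → f y ≤ f (v 0) :=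
    .exists_real (.and (.lt (.proj _) (.proj _)) (.forall_real (.imp (.lt (.proj _) (.proj _))
      (.imp (.lt (.proj _) (.proj _)) (.le (hf.comp (.proj _)) (hf.comp (.proj _)))))))
  convert! hdef using 3 with v
  rw [Filter.Eventually, mem_nhdsLT_iff_exists_Ioo_subset]
  simp only [subset_def, mem_Ioo, mem_Iio, and_imp, mem_ofPred_eq]

theorem exists_monotoneOn_of_eventually {f : ℝ → ℝ} (hf : DefReal L f) {a : ℝ}
    (hr : ∀ᶠ x in 𝓝[>] a, ∀ᶠ y in 𝓝[>] x, f x ≤ f y) :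
    ∃ b > a, MonotoneOn f (Ioo a b) := by
  have hl : ∀ᶠ x in 𝓝[>] a, ∀ᶠ y in 𝓝[<] x, f y ≤ f x := by
    refine (eventually_nhdsGT_or_not (P := fun x => ∀ᶠ y in 𝓝[<] x, f y ≤ f x)
      hf.defPred_eventually_nhdsLT_le a).resolve_right fun hnot => ?_
    refine not_eventually_nhdsGT_mem_of_countable (countable_setOf_localMin_of_strict_left f) a ?_
    filter_upwards [hr, hnot] with x hrx hlx
    have hstrict := (eventually_nhdsLT_or_not (P := fun y => f y ≤ f x)
      (DefPred.le hf (DefFn.const (f x))) x).resolve_left hlx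
    exact ⟨by simpa only [not_le] using hstrict, hrx⟩
  obtain ⟨b, hab, hb⟩ := mem_nhdsGT_iff_exists_Ioo_subset.1 (hr.and hl)
  exact ⟨b, hab, monotoneOn_Ioo_of_eventually (fun x hx => (hb hx).1) fun x hx => (hb hx).2⟩

theorem exists_monotoneOn_or_antitoneOn {f : ℝ → ℝ} (hf : DefReal L f) (a : ℝ) :
    ∃ b > a, MonotoneOn f (Ioo a b) ∨ AntitoneOn f (Ioo a b) := by
  rcases eventually_nhdsGT_or_not (P := fun x => ∀ᶠ y in 𝓝[>] x, f x ≤ f y)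
      hf.defPred_eventually_nhdsGT_le a with hr | hr
  · obtain ⟨b, hab, hb⟩ := hf.exists_monotoneOn_of_eventually hr
    exact ⟨b, hab, .inl hb⟩
  · have hr' : ∀ᶠ x in 𝓝[>] a, ∀ᶠ y in 𝓝[>] x, -f x ≤ -f y := by
      filter_upwards [hr] with x hx
      filter_upwards [(eventually_nhdsGT_or_not (P := fun y => f x ≤ f y)
        (DefPred.le (DefFn.const (f x)) hf) x).resolve_left hx] with y hy
      exact neg_le_neg (not_le.1 hy).le
    obtain ⟨b, hab, hb⟩ := hf.neg.exists_monotoneOn_of_eventually hr'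
    exact ⟨b, hab, .inr fun x hx y hy hxy => neg_le_neg_iff.1 (hb hx hy hxy)⟩

theorem defPred_hasDerivAt {f : ℝ → ℝ} (hf : DefReal L f) {α : Type} {c x : (α → ℝ) → ℝ}
    (hc : DefFn L c) (hx : DefFn L x) : DefPred L fun v => HasDerivAt f (c v) (x v) := by
  have hdef : DefPred L fun v => ∀ ε, 0 < ε → ∃ δ, 0 < δ ∧ ∀ y, |y - x v| < δ →
      |f y - f (x v) - (y - x v) * c v| ≤ ε * |y - x v| := by
    have hx' := hx.reindex fun i => (.inl (.inl (.inl i)) : ((α ⊕ Fin 1) ⊕ Fin 1) ⊕ Fin 1)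
    have hc' := hc.reindex fun i => (.inl (.inl (.inl i)) : ((α ⊕ Fin 1) ⊕ Fin 1) ⊕ Fin 1)
    have hy := DefFn.proj (L := L) (.inr 0 : ((α ⊕ Fin 1) ⊕ Fin 1) ⊕ Fin 1)
    exact .forall_real (.imp (.lt (.const _) (.proj _)) (.exists_real
      (.and (.lt (.const _) (.proj _)) (.forall_real (.imp (.lt (hy.sub hx').abs (.proj _))
        (.le (((hf.comp hy).sub (hf.comp hx')).sub ((hy.sub hx').mul hc')).abs
          (.mul (.proj _) (hy.sub hx').abs)))))))
  convert! hdef using 3 with v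
  rw [hasDerivAt_iff_isLittleO, Asymptotics.isLittleO_iff]
  simp only [Metric.eventually_nhds_iff, Real.dist_eq, Real.norm_eq_abs, smul_eq_mul]

theorem deriv {f : ℝ → ℝ} (hf : DefReal L f) : DefReal L (deriv f) := by
  apply DefFn.of_graph
  simp only [deriv_eq_iff_hasDerivAt_or]
  exact .or (hf.defPred_hasDerivAt (.proj _) (.proj _))
    (.and (.not (.exists_real (hf.defPred_hasDerivAt (.proj _) (.proj _))))
      (.eq (.proj _) (.const _)))

theorem eventually_differentiableAt {f : ℝ → ℝ} (hf : DefReal L f) (a : ℝ) :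
    ∀ᶠ x in 𝓝[>] a, DifferentiableAt ℝ f x := by
  have hiff : ∀ x, DifferentiableAt ℝ f x ↔ ∃ c, HasDerivAt f c x := fun x =>
    ⟨fun h => ⟨_, h.hasDerivAt⟩, fun ⟨_, h⟩ => h.differentiableAt⟩
  simp only [hiff]
  refine (eventually_nhdsGT_or_not (.exists_real (hf.defPred_hasDerivAt (.proj _) (.proj _)))
    a).resolve_right fun hnot => ?_
  simp only [← hiff] at hnot
  obtain ⟨b, hab, hmono⟩ := hf.exists_monotoneOn_or_antitoneOn a
  obtain ⟨d, had, hd⟩ := mem_nhdsGT_iff_exists_Ioo_subset.1 hnot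
  have hlt : a < min b d := lt_min hab had
  have hsub : Ioo a (min b d) ⊆ Ioo a b := Ioo_subset_Ioo_right (min_le_left _ _)
  obtain ⟨x, hx, hdiff⟩ : ∃ x ∈ Ioo a (min b d), DifferentiableAt ℝ f x := by
    rcases hmono with hm | hm
    · exact exists_mem_Ioo_differentiableAt_of_monotoneOn hlt (hm.mono hsub)
    · obtain ⟨x, hx, hdiff⟩ := exists_mem_Ioo_differentiableAt_of_monotoneOn hlt (hm.mono hsub).neg
      exact ⟨x, hx, by simpa using hdiff.neg⟩
  exact hd ⟨hx.1, hx.2.trans_le (min_le_right _ _)⟩ hdiff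

theorem exists_tendsto_ereal {f : ℝ → ℝ} (hf : DefReal L f) (a : ℝ) :
    ∃ l : EReal, Tendsto (fun x => (f x : EReal)) (𝓝[>] a) (𝓝 l) := by
  refine tendsto_of_no_upcrossings (EReal.denseRange_ratCast) ?_
  rintro _ ⟨p, rfl⟩ _ ⟨q, rfl⟩ hpq ⟨h1, h2⟩
  have hp : ∀ x, ((f x : EReal) < ((p : ℝ) : EReal)) ↔ f x < p := fun x => EReal.coe_lt_coe_iff
  have hq : ∀ x, (((q : ℝ) : EReal) < (f x : EReal)) ↔ (q : ℝ) < f x :=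
    fun x => EReal.coe_lt_coe_iff
  have hpq : (p : ℝ) < q := EReal.coe_lt_coe_iff.1 hpq
  simp only [hp] at h1
  simp only [hq] at h2
  rcases eventually_nhdsGT_or_not (P := fun x => f x < p) (.lt hf (.const _)) a with h | h
  · obtain ⟨x, hx, hx'⟩ := (h2.and_eventually h).exists
    linarith
  · exact h1 h

theorem exists_tendsto_of_abs_le {f : ℝ → ℝ} (hf : DefReal L f) {a C : ℝ}
    (hC : ∀ᶠ x in 𝓝[>] a, |f x| ≤ C) : ∃ l : ℝ, Tendsto f (𝓝[>] a) (𝓝 l) := by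
  obtain ⟨l, hl⟩ := hf.exists_tendsto_ereal a
  have h1 : l ≤ (C : EReal) := le_of_tendsto hl
    (hC.mono fun x hx => EReal.coe_le_coe_iff.2 (abs_le.1 hx).2)
  have h2 : ((-C : ℝ) : EReal) ≤ l := ge_of_tendsto hl
    (hC.mono fun x hx => EReal.coe_le_coe_iff.2 (abs_le.1 hx).1)
  induction l using EReal.rec with
  | bot => simp at h2
  | top => simp at h1
  | coe l => exact ⟨l, EReal.tendsto_coe.1 hl⟩

/-- A converse of L'Hôpital's rule: the quotient of the derivatives has a limit by definability. -/
theorem tendsto_deriv_div {f g : ℝ → ℝ} (hf : DefReal L f) (hg : DefReal L g) {a c : ℝ}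
    (hfa : Tendsto f (𝓝[>] a) (𝓝 0)) (hga : Tendsto g (𝓝[>] a) (𝓝 0))
    (hg' : ∀ᶠ x in 𝓝[>] a, _root_.deriv g x ≠ 0)
    (hc : Tendsto (fun x => f x / g x) (𝓝[>] a) (𝓝 c)) :
    Tendsto (fun x => _root_.deriv f x / _root_.deriv g x) (𝓝[>] a) (𝓝 c) := by
  obtain ⟨l, hl⟩ := (hf.deriv.div hg.deriv).exists_tendsto_ereal a
  have hop : ∀ F : Filter ℝ, Tendsto (fun x => _root_.deriv f x / _root_.deriv g x) (𝓝[>] a) F →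
      Tendsto (fun x => f x / g x) (𝓝[>] a) F := fun F hF =>
    deriv.lhopital_zero_nhdsGT (hf.eventually_differentiableAt a) hg' hfa hga hF
  induction l using EReal.rec with
  | bot => exact absurd hc (not_tendsto_nhds_of_tendsto_atBot
      (hop _ (EReal.tendsto_coe_nhds_bot_iff.1 hl)) c)
  | top => exact absurd hc (not_tendsto_nhds_of_tendsto_atTop
      (hop _ (EReal.tendsto_coe_nhds_top_iff.1 hl)) c)
  | coe l =>
    have hl' := EReal.tendsto_coe.1 hl
    rwa [tendsto_nhds_unique hc (hop _ hl')]

theorem eventually_deriv_pos {g : ℝ → ℝ} (hg : DefReal L g) {a : ℝ}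
    (hpos : ∀ᶠ x in 𝓝[>] a, 0 < g x) (hga : Tendsto g (𝓝[>] a) (𝓝 0)) :
    ∀ᶠ x in 𝓝[>] a, 0 < _root_.deriv g x := by
  refine (eventually_nhdsGT_or_not (P := fun x => 0 < _root_.deriv g x)
    (.lt (.const _) hg.deriv) a).resolve_right fun h => ?_
  obtain ⟨b, hb, hb'⟩ := mem_nhdsGT_iff_exists_Ioo_subset.1
    ((h.and hpos).and (hg.eventually_differentiableAt a))
  have hanti : AntitoneOn g (Ioo a b) := by
    refine antitoneOn_of_deriv_nonpos (convex_Ioo a b)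
      (fun x hx => (hb' hx).2.continuousAt.continuousWithinAt)
      (fun x hx => (hb' (interior_subset hx)).2.differentiableWithinAt)
      (fun x hx => not_lt.1 (hb' (interior_subset hx)).1.1)
  obtain ⟨x, hx⟩ := exists_between (show a < b from hb)
  have hle : g x ≤ 0 := ge_of_tendsto hga (by
    filter_upwards [Ioo_mem_nhdsGT hx.1] with y hy
    exact hanti ⟨hy.1, hy.2.trans hx.2⟩ hx hy.2.le)
  exact absurd (hb' hx).1.2 (not_lt.2 hle)

end DefReal
end OneVariable

/-! ### Definable choice and curve selection -/

section RealInfimum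

theorem sInf_eq_iff_isGLB_or {A : Set ℝ} {c : ℝ} :
    sInf A = c ↔ IsGLB A c ∨ (¬ ∃ d, IsGLB A d) ∧ c = 0 := by
  by_cases hex : ∃ d, IsGLB A d
  · obtain ⟨d, hd⟩ := id hex
    simp only [hex, not_true_eq_false, false_and, or_false]
    exact ⟨fun h => h ▸ isGLB_csInf hd.nonempty hd.bddBelow, fun h => h.csInf_eq h.nonempty⟩
  · have hzero : sInf A = 0 := by
      rcases A.eq_empty_or_nonempty with rfl | hne
      · exact Real.sInf_empty
      · exact Real.sInf_of_not_bddBelow fun hb => hex ⟨_, isGLB_csInf hne hb⟩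
    simp [not_exists.1 hex, hzero, eq_comm]

theorem half_add_sInf_mem_of_eventually_nhdsGT_mem {T : Set ℝ} {a : ℝ} (hT : BddAbove T)
    (ha : ∀ᶠ x in 𝓝[>] a, x ∈ T) : (a + sInf {x | a < x ∧ x ∉ T}) / 2 ∈ T := by
  obtain ⟨d, had, hd⟩ := mem_nhdsGT_iff_exists_Ioo_subset.1 ha
  have had : a < d := had
  obtain ⟨C, hC⟩ := hT
  have hne : {x | a < x ∧ x ∉ T}.Nonempty :=
    ⟨max a C + 1, by linarith [le_max_left a C],
      fun h => by linarith [hC h, le_max_right a C]⟩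
  have hle : d ≤ sInf {x | a < x ∧ x ∉ T} :=
    le_csInf hne fun x hx => not_lt.1 fun hxd => hx.2 (hd ⟨hx.1, hxd⟩)
  by_contra hnot
  have := csInf_le (s := {x | a < x ∧ x ∉ T}) ⟨a, fun x hx => hx.1.le⟩ ⟨by linarith, hnot⟩
  linarith

end RealInfimum

section Choice

variable {L : FirstOrder.Language} [L.Structure ℝ] {α : Type}

theorem DefPred.substLast [Finite α] {S : (α → ℝ) → ℝ → Prop}
    (hS : DefPred L fun w : α ⊕ Fin 1 → ℝ => S (fun i => w (.inl i)) (w (.inr 0)))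
    {β : Type} {F : (β → ℝ) → α → ℝ} (hF : ∀ i, DefFn L fun v => F v i)
    {f : (β → ℝ) → ℝ} (hf : DefFn L f) : DefPred L fun v => S (F v) (f v) :=
  DefPred.comp (P := fun w : α ⊕ Fin 1 → ℝ => S (fun i => w (.inl i)) (w (.inr 0))) hS
    (F := fun v => Sum.elim (F v) fun _ => f v) (by rintro (i | _); exacts [hF i, hf])

variable [hL : Fact (IsOMinimal L)]

theorem DefFn.sInf {S : (α → ℝ) → ℝ → Prop}
    (hS : DefPred L fun w : α ⊕ Fin 1 → ℝ => S (fun i => w (.inl i)) (w (.inr 0))) :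
    DefFn L fun v => sInf {x | S v x} := by
  have hglb {β : Type} (σ : α → β) (j : β) :
      DefPred L fun w : β → ℝ => IsGLB {x | S (fun i => w (σ i)) x} (w j) := by
    have hlower (γ : Type) (τ : α → γ) (l : γ) :
        DefPred L fun w : γ → ℝ => ∀ x, S (fun i => w (τ i)) x → w l ≤ x :=
      .forall_real (.imp (hS.reindex
        (Sum.elim (fun i => Sum.inl (τ i)) fun _ => Sum.inr 0 : α ⊕ Fin 1 → γ ⊕ Fin 1))
        (.le (.proj _) (.proj _)))
    exact .and (hlower β σ j) (.forall_real (.imp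
      (hlower _ (fun i => Sum.inl (σ i)) (Sum.inr 0)) (.le (.proj _) (.proj _))))
  apply DefFn.of_graph
  simp only [sInf_eq_iff_isGLB_or]
  exact .or (hglb _ _) (.and (.not (.exists_real (hglb (fun i => Sum.inl (Sum.inl i)) (Sum.inr 0))))
    (.eq (.proj _) (.const _)))

theorem eventually_nhdsGT_mem_of_isGLB {S : ℝ → Prop} (hS : DefPred L fun v : Fin 1 → ℝ => S (v 0))
    {a : ℝ} (hglb : IsGLB {x | S x} a) (ha : ¬ S a) : ∀ᶠ x in 𝓝[>] a, S x := by
  refine (eventually_nhdsGT_or_not hS a).resolve_right fun hnot => ?_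
  obtain ⟨d, had, hd⟩ := mem_nhdsGT_iff_exists_Ioo_subset.1 hnot
  refine not_le.2 had (hglb.2 fun x hx => not_lt.1 fun hxd => ?_)
  have hax : a < x := lt_of_le_of_ne (hglb.1 hx) fun h => ha (h ▸ hx)
  exact hd ⟨hax, hxd⟩ hx

theorem exists_defFn_choice [Finite α] {S : (α → ℝ) → ℝ → Prop}
    (hS : DefPred L fun w : α ⊕ Fin 1 → ℝ => S (fun i => w (.inl i)) (w (.inr 0)))
    (hb : ∀ v, ∃ C, ∀ x, S v x → |x| ≤ C) :
    ∃ e : (α → ℝ) → ℝ, DefFn L e ∧ ∀ v, (∃ x, S v x) → S v (e v) := by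
  classical
  -- The minimum if it is attained; otherwise the midpoint of the first interval of the set.
  set a : (α → ℝ) → ℝ := fun v => sInf {x | S v x}
  set b : (α → ℝ) → ℝ := fun v => sInf {x | a v < x ∧ ¬ S v x}
  have ha : DefFn L a := .sInf hS
  have hb' : DefFn L b := .sInf (S := fun v x => a v < x ∧ ¬ S v x)
    (.and (.lt (ha.reindex _) (.proj _)) hS.not)
  refine ⟨fun v => if S v (a v) then a v else (a v + b v) / 2,
    Set.DefinableFun.ite (hS.substLast .proj ha) ha (DefFn.div (ha.add hb') (.const 2)),
    fun v hne => ?_⟩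
  by_cases hmin : S v (a v)
  · simp only [hmin, if_true]
  simp only [hmin, if_false]
  obtain ⟨C, hC⟩ := hb v
  have hglb : IsGLB {x | S v x} (a v) := isGLB_csInf hne ⟨-C, fun x hx => (abs_le.1 (hC x hx)).1⟩
  exact half_add_sInf_mem_of_eventually_nhdsGT_mem (T := {x | S v x})
    ⟨C, fun x hx => (abs_le.1 (hC x hx)).2⟩
    (eventually_nhdsGT_mem_of_isGLB
      (hS.substLast (F := fun _ => v) (fun _ => .const _) (.proj 0)) hglb hmin)

theorem exists_defMap_choice (n : ℕ) [Finite α] : ∀ {S : (α → ℝ) → (Fin n → ℝ) → Prop},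
    DefPred L (fun w : α ⊕ Fin n → ℝ => S (fun i => w (.inl i)) fun i => w (.inr i)) →
    (∀ v, ∃ C, ∀ y, S v y → ∀ i, |y i| ≤ C) →
    ∃ F : (α → ℝ) → Fin n → ℝ, (∀ i, DefFn L fun v => F v i) ∧
      ∀ v, (∃ y, S v y) → S v (F v) := by
  induction n with
  | zero =>
    intro S _ _
    exact ⟨fun _ => Fin.elim0, fun i => i.elim0, fun v ⟨y, hy⟩ => by
      rwa [Subsingleton.elim y Fin.elim0] at hy⟩
  | succ n ih =>
    intro S hS hb
    have hcons {β : Type} {F : (β → ℝ) → α → ℝ} {g : (β → ℝ) → ℝ} {G : (β → ℝ) → Fin n → ℝ}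
        (hF : ∀ i, DefFn L fun w => F w i) (hg : DefFn L g) (hG : ∀ i, DefFn L fun w => G w i) :
        DefPred L fun w => S (F w) (Fin.cons (g w) (G w)) :=
      DefPred.comp hS (F := fun w => Sum.elim (F w) (Fin.cons (g w) (G w))) <| by
        rintro (i | i)
        · exact hF i
        · exact Fin.cases hg hG i
    obtain ⟨e, he, heS⟩ := exists_defFn_choice
      (S := fun v x => ∃ y : Eucl n, S v (Fin.cons x y.ofLp)) (L := L)
      (.exists_vec (hcons (fun _ => .proj _) (.proj _) fun _ => .proj _))
      fun v => (hb v).imp fun C hC x ⟨y, hy⟩ => by simpa using hC _ hy 0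
    obtain ⟨F, hF, hFS⟩ := ih (S := fun v y => S v (Fin.cons (e v) y))
      (hcons (fun _ => .proj _) (he.reindex _) fun _ => .proj _)
      fun v => (hb v).imp fun C hC y hy i => by simpa using hC _ hy i.succ
    refine ⟨fun v => Fin.cons (e v) (F v), Fin.cases he hF, fun v ⟨y, hy⟩ => hFS v ?_⟩
    obtain ⟨z, hz⟩ := heS v ⟨y 0, WithLp.toLp 2 (Fin.tail y), by
      simpa [Fin.cons_self_tail] using hy⟩
    exact ⟨_, hz⟩

theorem exists_definable_curve {n : ℕ} {B : Set (Eucl n)} (hB : IsDefinableSet L B)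
    (h0 : (0 : Eucl n) ∈ closure B) :
    ∃ γ : ℝ → Eucl n, (∀ i, DefReal L fun s => γ s i) ∧ ∀ s > 0, γ s ∈ B ∧ ‖γ s‖ < s := by
  obtain ⟨F, hF, hFB⟩ := exists_defMap_choice n (L := L) (α := Fin 1)
    (S := fun v y => WithLp.toLp 2 y ∈ B ∧ ‖(WithLp.toLp 2 y : Eucl n)‖ < v 0)
    (.and (.mem hB (.toLp _)) (.lt (DefVec.norm (.toLp _)) (.proj _)))
    fun v => ⟨v 0, fun y hy i => (PiLp.norm_apply_le (WithLp.toLp 2 y : Eucl n) i).trans hy.2.le⟩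
  refine ⟨fun s => WithLp.toLp 2 (F fun _ => s), fun i => ?_, fun s hs => ?_⟩
  · exact DefFn.comp (hF i) (F := fun v : Fin 1 → ℝ => fun _ => v 0) fun _ => .proj _
  · apply hFB fun _ => s
    obtain ⟨y, hy, hys⟩ := Metric.mem_closure_iff.1 h0 s hs
    exact ⟨y.ofLp, hy, by simpa [dist_eq_norm] using hys⟩

end Choice

/-! ### Coordinate subspaces, charts and tangent spaces -/

section NearbySubspaces

variable {E : Type*} [NormedAddCommGroup E] [InnerProductSpace ℝ E] {K T : Submodule ℝ E} {θ : E}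

theorem norm_starProjection_sub_le [T.HasOrthogonalProjection] (w : E) {v : E} (hv : v ∈ T) :
    ‖T.starProjection w - w‖ ≤ ‖v - w‖ := by
  rw [norm_sub_rev, norm_sub_rev v, Submodule.starProjection_minimal]
  exact ciInf_le ⟨0, by rintro _ ⟨x, rfl⟩; exact norm_nonneg _⟩ (⟨v, hv⟩ : T)

theorem norm_le_norm_starProjection_add [K.HasOrthogonalProjection] (hθK : θ ∈ Kᗮ) {e : E}
    (he : e ∈ K) (c : ℝ) (u : E) : ‖e‖ ≤ ‖K.starProjection u‖ + ‖u - (e + c • θ)‖ := by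
  have he_eq : e = K.starProjection u - K.starProjection (u - (e + c • θ)) := by
    rw [map_sub, map_add, map_smul, (Submodule.starProjection_apply_eq_zero_iff K).2 hθK,
      Submodule.starProjection_eq_self_iff.2 he]
    module
  calc ‖e‖ = ‖K.starProjection u - K.starProjection (u - (e + c • θ))‖ := congrArg _ he_eq
    _ ≤ _ := (norm_sub_le _ _).trans
      (add_le_add le_rfl (Submodule.norm_starProjection_apply_le _ _))

theorem abs_le_abs_inner_add (hθ : ‖θ‖ = 1) (hθK : θ ∈ Kᗮ) {e : E} (he : e ∈ K) (c : ℝ) (u : E) :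
    |c| ≤ |inner ℝ θ u| + ‖u - (e + c • θ)‖ := by
  have hc_eq : c = inner ℝ θ u - inner ℝ θ (u - (e + c • θ)) := by
    rw [inner_sub_right, inner_add_right, real_inner_smul_right, real_inner_self_eq_norm_sq, hθ,
      Submodule.inner_left_of_mem_orthogonal he hθK]
    ring
  calc |c| = |inner ℝ θ u - inner ℝ θ (u - (e + c • θ))| := congrArg _ hc_eq
    _ ≤ |inner ℝ θ u| + ‖θ‖ * ‖u - (e + c • θ)‖ :=
      (abs_sub _ _).trans (add_le_add le_rfl (abs_real_inner_le_norm _ _))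
    _ = _ := by rw [hθ, one_mul]

theorem norm_starProjection_add_smul_sub_le [T.HasOrthogonalProjection] {r : ℝ}
    (hK : ∀ e ∈ K, ∃ v ∈ T, ‖v - e‖ ≤ r * ‖e‖) (hT : ∃ v ∈ T, ‖v - θ‖ ≤ r) {e : E} (he : e ∈ K)
    (c : ℝ) : ‖T.starProjection (e + c • θ) - (e + c • θ)‖ ≤ r * (‖e‖ + |c|) := by
  obtain ⟨v, hv, hve⟩ := hK e he
  obtain ⟨w, hw, hwθ⟩ := hT
  calc ‖T.starProjection (e + c • θ) - (e + c • θ)‖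
      ≤ ‖v + c • w - (e + c • θ)‖ :=
        norm_starProjection_sub_le _ (T.add_mem hv (T.smul_mem c hw))
    _ = ‖(v - e) + c • (w - θ)‖ := by congr 1; module
    _ ≤ r * ‖e‖ + |c| * r := (norm_add_le _ _).trans (add_le_add hve (by
        rw [norm_smul, Real.norm_eq_abs]
        exact mul_le_mul_of_nonneg_left hwθ (abs_nonneg _)))
    _ = r * (‖e‖ + |c|) := by ring

theorem norm_starProjection_sub_le_of_mem_sup_span [K.HasOrthogonalProjection]
    [T.HasOrthogonalProjection] {r : ℝ} (hr : 0 ≤ r) (hθ : ‖θ‖ = 1) (hθK : θ ∈ Kᗮ)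
    (hK : ∀ e ∈ K, ∃ v ∈ T, ‖v - e‖ ≤ r * ‖e‖) (hT : ∃ v ∈ T, ‖v - θ‖ ≤ r) {w : E}
    (hw : w ∈ K ⊔ Submodule.span ℝ {θ}) : ‖T.starProjection w - w‖ ≤ 2 * r * ‖w‖ := by
  obtain ⟨e, he, _, hz, rfl⟩ := Submodule.mem_sup.1 hw
  obtain ⟨c, rfl⟩ := Submodule.mem_span_singleton.1 hz
  have hfst : ‖e‖ ≤ ‖e + c • θ‖ := by
    simpa using (norm_le_norm_starProjection_add hθK he c (e + c • θ)).trans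
      (add_le_add_left (K.norm_starProjection_apply_le _) _)
  have hsnd : |c| ≤ ‖e + c • θ‖ := by
    simpa [hθ] using (abs_le_abs_inner_add hθ hθK he c (e + c • θ)).trans
      (add_le_add_left (abs_real_inner_le_norm _ _) _)
  calc ‖T.starProjection (e + c • θ) - (e + c • θ)‖
      ≤ r * (‖e‖ + |c|) := norm_starProjection_add_smul_sub_le hK hT he c
    _ ≤ r * (‖e + c • θ‖ + ‖e + c • θ‖) := by gcongr
    _ = 2 * r * ‖e + c • θ‖ := by ring

variable [FiniteDimensional ℝ K] [FiniteDimensional ℝ T]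

theorem exists_starProjection_add_smul_eq (hθ : ‖θ‖ = 1) (hθK : θ ∈ Kᗮ)
    (hdim : Module.finrank ℝ T = Module.finrank ℝ K + 1) {r : ℝ} (hr : r < 1 / 2)
    (hK : ∀ e ∈ K, ∃ v ∈ T, ‖v - e‖ ≤ r * ‖e‖) (hT : ∃ v ∈ T, ‖v - θ‖ ≤ r) {v : E} (hv : v ∈ T) :
    ∃ e ∈ K, ∃ c : ℝ, T.starProjection (e + c • θ) = v := by
  let f : (K × ℝ) →ₗ[ℝ] T := (T.orthogonalProjectionOnto : E →ₗ[ℝ] T) ∘ₗ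
    (LinearMap.coprod K.subtype (LinearMap.toSpanSingleton ℝ _ θ))
  have hf : ∀ p, (f p : E) = T.starProjection (p.1 + p.2 • θ) := fun _ => rfl
  have hinj : Function.Injective f := by
    rw [← LinearMap.ker_eq_bot, LinearMap.ker_eq_bot']
    intro p hp
    have hclose := norm_starProjection_add_smul_sub_le hK hT p.1.2 p.2
    have hfst := norm_le_norm_starProjection_add hθK p.1.2 p.2 (f p : E)
    have hsnd := abs_le_abs_inner_add hθ hθK p.1.2 p.2 (f p : E)
    rw [← hf, hp] at hclose
    simp only [hp, ZeroMemClass.coe_zero, map_zero, norm_zero, inner_zero_right, abs_zero]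
      at hfst hsnd
    have hfst_nonneg := norm_nonneg (p.1 : E)
    have hsnd_nonneg := abs_nonneg p.2
    have hfst_zero : ‖(p.1 : E)‖ = 0 := by simp only [ZeroMemClass.coe_zero] at hclose; nlinarith
    have hsnd_zero : |p.2| = 0 := by simp only [ZeroMemClass.coe_zero] at hclose; nlinarith
    exact Prod.ext (by simpa using hfst_zero) (by simpa using hsnd_zero)
  obtain ⟨p, hp⟩ :=
    (LinearMap.injective_iff_surjective_of_finrank_eq_finrank (by simp [hdim])).1 hinj ⟨v, hv⟩
  exact ⟨p.1, p.1.2, p.2, by rw [← hf, hp]⟩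

theorem norm_le_four_mul_of_close (hθ : ‖θ‖ = 1) (hθK : θ ∈ Kᗮ)
    (hdim : Module.finrank ℝ T = Module.finrank ℝ K + 1)
    (hK : ∀ e ∈ K, ∃ v ∈ T, ‖v - e‖ ≤ 1 / 8 * ‖e‖) (hT : ∃ v ∈ T, ‖v - θ‖ ≤ 1 / 8) {v : E}
    (hv : v ∈ T) {m : ℝ} (hproj : ‖K.starProjection v‖ ≤ m) (hinner : |inner ℝ θ v| ≤ m) :
    ‖v‖ ≤ 4 * m := by
  obtain ⟨e, he, c, rfl⟩ := exists_starProjection_add_smul_eq hθ hθK hdim (by norm_num) hK hT hv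
  have hclose := norm_starProjection_add_smul_sub_le hK hT he c
  set v := T.starProjection (e + c • θ)
  have hfst := norm_le_norm_starProjection_add hθK he c v
  have hsnd := abs_le_abs_inner_add hθ hθK he c v
  have hnorm : ‖v‖ ≤ ‖e‖ + |c| + ‖v - (e + c • θ)‖ := calc
    ‖v‖ = ‖e + c • θ + (v - (e + c • θ))‖ := by congr 1; abel
    _ ≤ ‖e‖ + ‖c • θ‖ + ‖v - (e + c • θ)‖ :=
      (norm_add_le _ _).trans (add_le_add (norm_add_le _ _) le_rfl)
    _ = _ := by rw [norm_smul, hθ, mul_one, Real.norm_eq_abs]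
  linarith [norm_nonneg e, abs_nonneg c]

end NearbySubspaces

section Tangent

variable {n k d : ℕ}

theorem mem_flat {z : Eucl n} : z ∈ flat n d ↔ ∀ i : Fin n, d ≤ i.val → z i = 0 := Iff.rfl

theorem flat_mono {d e : ℕ} (h : d ≤ e) : flat n d ≤ flat n e :=
  fun _ hz i hi => hz i (h.trans hi)

theorem finrank_flat (h : d ≤ n) : Module.finrank ℝ (flat n d) = d := by
  let e : flat n d ≃ₗ[ℝ] (Fin d → ℝ) :=
    { toFun := fun z i => z.1 (Fin.castLE h i)
      invFun := fun v =>
        ⟨WithLp.toLp 2 fun i : Fin n => if hi : i.val < d then v ⟨i.val, hi⟩ else 0,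
          fun i hi => by simp [not_lt.2 hi]⟩
      map_add' := fun _ _ => rfl
      map_smul' := fun _ _ => rfl
      left_inv := fun z => by
        ext i
        by_cases hi : i.val < d
        · simp [hi]
        · simpa [hi] using (z.2 i (not_lt.1 hi)).symm
      right_inv := fun v => by ext i; simp }
  rw [e.finrank_eq, Module.finrank_fin_fun]

theorem flat_starProjection_apply (y : Eucl n) (i : Fin n) :
    (flat n d).starProjection y i = if i.val < d then y i else 0 := by
  suffices (flat n d).starProjection y =
      WithLp.toLp 2 fun i : Fin n => if i.val < d then y i else 0 by rw [this]
  refine Submodule.eq_starProjection_of_mem_of_inner_eq_zero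
    (mem_flat.2 fun i hi => by simp [not_lt.2 hi]) fun w hw => ?_
  rw [PiLp.inner_apply]
  refine Finset.sum_eq_zero fun i _ => ?_
  by_cases hi : i.val < d
  · simp [hi]
  · simp [hw i (not_lt.1 hi)]

/-- The component of `y` normal to `ℝᵈ × 0`. -/
noncomputable def normalPart (n d : ℕ) : Eucl n →L[ℝ] Eucl n :=
  (flat n d)ᗮ.starProjection

theorem normalPart_apply (y : Eucl n) : normalPart n d y = y - (flat n d).starProjection y :=
  (flat n d).starProjection_orthogonal_val y

theorem starProjection_add_normalPart (y : Eucl n) :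
    (flat n d).starProjection y + normalPart n d y = y := by simp [normalPart_apply]

theorem normalPart_mem_orthogonal (y : Eucl n) : normalPart n d y ∈ (flat n d)ᗮ :=
  Submodule.starProjection_apply_mem _ y

theorem normalPart_eq_zero_iff {y : Eucl n} : normalPart n d y = 0 ↔ y ∈ flat n d := by
  rw [normalPart_apply, sub_eq_zero, eq_comm, Submodule.starProjection_eq_self_iff]

theorem inner_normalPart_left (y v : Eucl n) :
    inner ℝ (normalPart n d y) (normalPart n d v) = inner ℝ (normalPart n d y) v := by
  conv_rhs => rw [← starProjection_add_normalPart (d := d) v, inner_add_right]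
  rw [Submodule.inner_left_of_mem_orthogonal (Submodule.starProjection_apply_mem _ _)
    (normalPart_mem_orthogonal y), zero_add]

theorem norm_normalPart_le (y : Eucl n) : ‖normalPart n d y‖ ≤ ‖y‖ :=
  Submodule.norm_starProjection_apply_le _ _

theorem IsCpChart.mono {p q : ℕ} (h : q ≤ p) {φ : OpenPartialHomeomorph (Eucl n) (Eucl n)}
    (hφ : IsCpChart p φ) : IsCpChart q φ :=
  ⟨hφ.1.of_le (by exact_mod_cast h), hφ.2.of_le (by exact_mod_cast h)⟩

theorem IsCpChart.symm {p : ℕ} {φ : OpenPartialHomeomorph (Eucl n) (Eucl n)}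
    (hφ : IsCpChart p φ) : IsCpChart p φ.symm :=
  ⟨by simpa using hφ.2, by simpa using hφ.1⟩

theorem IsCpChart.trans {p : ℕ} {φ ψ : OpenPartialHomeomorph (Eucl n) (Eucl n)}
    (hφ : IsCpChart p φ) (hψ : IsCpChart p ψ) : IsCpChart p (φ.trans ψ) := by
  constructor
  · rw [OpenPartialHomeomorph.coe_trans]
    exact hψ.1.comp (hφ.1.mono fun x hx => (φ.trans_source ψ ▸ hx).1)
      fun x hx => (φ.trans_source ψ ▸ hx).2
  · rw [OpenPartialHomeomorph.coe_trans_symm]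
    exact hφ.2.comp (hψ.2.mono fun x hx => (φ.trans_target ψ ▸ hx).1)
      fun x hx => (φ.trans_target ψ ▸ hx).2

theorem IsCpChart.contDiffAt {p : ℕ} {φ : OpenPartialHomeomorph (Eucl n) (Eucl n)}
    (hφ : IsCpChart p φ) {x : Eucl n} (hx : x ∈ φ.source) : ContDiffAt ℝ p φ x :=
  hφ.1.contDiffAt (φ.open_source.mem_nhds hx)

theorem IsCpChart.exists_hasStrictFDerivAt_equiv {φ : OpenPartialHomeomorph (Eucl n) (Eucl n)}
    (hφ : IsCpChart 1 φ) {x : Eucl n} (hx : x ∈ φ.source) :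
    ∃ A : Eucl n ≃L[ℝ] Eucl n, HasStrictFDerivAt φ (A : Eucl n →L[ℝ] Eucl n) x ∧
      HasStrictFDerivAt φ.symm (A.symm : Eucl n →L[ℝ] Eucl n) (φ x) := by
  have h1 : HasStrictFDerivAt φ (fderiv ℝ φ x) x := (hφ.contDiffAt hx).hasStrictFDerivAt (by simp)
  have h2 : HasStrictFDerivAt φ.symm (fderiv ℝ φ.symm (φ x)) (φ x) :=
    (hφ.symm.contDiffAt (φ.map_source hx)).hasStrictFDerivAt (by simp)
  have e1 : (fderiv ℝ φ.symm (φ x)).comp (fderiv ℝ φ x) = ContinuousLinearMap.id ℝ _ := by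
    refine HasFDerivAt.unique (h2.hasFDerivAt.comp x h1.hasFDerivAt)
      ((hasFDerivAt_id x).congr_of_eventuallyEq ?_)
    filter_upwards [φ.open_source.mem_nhds hx] with z hz using φ.left_inv hz
  have e2 : (fderiv ℝ φ x).comp (fderiv ℝ φ.symm (φ x)) = ContinuousLinearMap.id ℝ _ := by
    have h1' : HasFDerivAt φ (fderiv ℝ φ x) (φ.symm (φ x)) := by
      rw [φ.left_inv hx]; exact h1.hasFDerivAt
    refine HasFDerivAt.unique (h1'.comp (φ x) h2.hasFDerivAt)
      ((hasFDerivAt_id (φ x)).congr_of_eventuallyEq ?_)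
    filter_upwards [φ.open_target.mem_nhds (φ.map_source hx)] with z hz using φ.right_inv hz
  exact ⟨ContinuousLinearEquiv.equivOfInverse _ _ (fun v => DFunLike.congr_fun e1 v)
    fun v => DFunLike.congr_fun e2 v, h1, h2⟩

theorem map_tangentSpaceOf_le {M M' : Set (Eucl n)} {f : Eucl n → Eucl n} {y : Eucl n}
    {A : Eucl n →L[ℝ] Eucl n} (hf : HasFDerivAt f A y) (hM : ∀ᶠ z in 𝓝[M] y, f z ∈ M') :
    (tangentSpaceOf M y).map (A : Eucl n →ₗ[ℝ] Eucl n) ≤ tangentSpaceOf M' (f y) := by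
  rw [tangentSpaceOf, Submodule.map_span, Submodule.span_le]
  rintro _ ⟨v, ⟨γ, h0, hγM, hγ⟩, rfl⟩
  refine Submodule.subset_span ⟨fun t => f (γ t), congrArg f h0, ?_, ?_⟩
  · have : Tendsto γ (𝓝 0) (𝓝[M] y) :=
      tendsto_nhdsWithin_iff.2 ⟨h0 ▸ hγ.continuousAt.tendsto, hγM⟩
    exact this.eventually hM
  · exact HasFDerivAt.comp_hasDerivAt (0 : ℝ) (by rw [h0]; exact hf) hγ

theorem tangentSpaceOf_submodule (F : Submodule ℝ (Eucl n)) {y : Eucl n} (hy : y ∈ F) :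
    tangentSpaceOf (F : Set (Eucl n)) y = F := by
  apply le_antisymm
  · rw [tangentSpaceOf, Submodule.span_le]
    rintro v ⟨γ, h0, hγM, hγ⟩
    have hc : IsClosed (F : Set (Eucl n)) := F.closed_of_finiteDimensional
    have := hasDerivAt_iff_tendsto_slope.1 hγ
    refine hc.mem_of_tendsto this ?_
    filter_upwards [nhdsWithin_le_nhds hγM] with t ht
    rw [slope_def_module]
    exact F.smul_mem _ (F.sub_mem ht (h0 ▸ hy))
  · intro v hv
    refine Submodule.subset_span ⟨fun t => y + t • v, by simp, ?_, ?_⟩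
    · exact .of_forall fun t => F.add_mem hy (F.smul_mem _ hv)
    · simpa using ((hasDerivAt_id (0 : ℝ)).smul_const v).const_add y

theorem tangentSpaceOf_isImage {φ : OpenPartialHomeomorph (Eucl n) (Eucl n)} {M M' : Set (Eucl n)}
    (hM : φ.IsImage M M') {y : Eucl n} (hy : y ∈ φ.source) {A : Eucl n ≃L[ℝ] Eucl n}
    (hA : HasFDerivAt φ (A : Eucl n →L[ℝ] Eucl n) y)
    (hA' : HasFDerivAt φ.symm (A.symm : Eucl n →L[ℝ] Eucl n) (φ y)) {v : Eucl n} :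
    v ∈ tangentSpaceOf M y ↔ A v ∈ tangentSpaceOf M' (φ y) := by
  constructor
  · intro hv
    refine map_tangentSpaceOf_le hA ?_ ⟨v, hv, rfl⟩
    filter_upwards [self_mem_nhdsWithin, nhdsWithin_le_nhds (φ.open_source.mem_nhds hy)]
      with z hz hz' using (hM hz').2 hz
  · intro hv
    have := map_tangentSpaceOf_le (M' := M) hA' ?_ ⟨_, hv, rfl⟩
    · simpa [φ.left_inv hy] using this
    filter_upwards [self_mem_nhdsWithin,
      nhdsWithin_le_nhds (φ.open_target.mem_nhds (φ.map_source hy))] with z hz hz'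
    exact (hM.symm hz').2 hz

theorem finrank_tangentSpaceOf {M : Set (Eucl n)} (hM : IsCpSubmanifold 1 d M) {y : Eucl n}
    (hy : y ∈ M) : Module.finrank ℝ (tangentSpaceOf M y) = d := by
  obtain ⟨hd, h⟩ := hM
  obtain ⟨ψ, hyψ, hψ, hMψ⟩ := h y hy
  obtain ⟨A, hA, hA'⟩ := hψ.exists_hasStrictFDerivAt_equiv hyψ
  have : tangentSpaceOf M y = (flat n d).map (A.symm.toLinearEquiv : Eucl n →ₗ[ℝ] Eucl n) := by
    ext v
    rw [tangentSpaceOf_isImage hMψ hyψ hA.hasFDerivAt hA'.hasFDerivAt,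
      tangentSpaceOf_submodule _ ((hMψ hyψ).2 hy)]
    constructor
    · intro hv; exact ⟨A v, hv, by simp⟩
    · rintro ⟨w, hw, rfl⟩; simpa using hw
  rw [this, LinearEquiv.finrank_map_eq, finrank_flat hd]

theorem exists_hasDerivAt_of_mem_tangentSpaceOf {M : Set (Eucl n)} (hM : IsCpSubmanifold 1 d M)
    {y v : Eucl n} (hy : y ∈ M) (hv : v ∈ tangentSpaceOf M y) :
    ∃ γ : ℝ → Eucl n, γ 0 = y ∧ (∀ᶠ t in 𝓝 0, γ t ∈ M) ∧ HasDerivAt γ v 0 := by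
  obtain ⟨ψ, hyψ, hψ, hMψ⟩ := hM.2 y hy
  obtain ⟨A, hA, hA'⟩ := hψ.exists_hasStrictFDerivAt_equiv hyψ
  rw [tangentSpaceOf_isImage hMψ hyψ hA.hasFDerivAt hA'.hasFDerivAt,
    tangentSpaceOf_submodule _ ((hMψ hyψ).2 hy)] at hv
  have hline : HasDerivAt (fun t : ℝ => ψ y + t • A v) (A v) 0 := by
    simpa using ((hasDerivAt_id (0 : ℝ)).smul_const (A v)).const_add (ψ y)
  refine ⟨fun t => ψ.symm (ψ y + t • A v), by simp [ψ.left_inv hyψ], ?_, ?_⟩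
  · have htarget : ∀ᶠ t in 𝓝 (0 : ℝ), ψ y + t • A v ∈ ψ.target :=
      hline.continuousAt.eventually_mem (ψ.open_target.mem_nhds (by simpa using ψ.map_source hyψ))
    filter_upwards [htarget] with t ht
    exact (hMψ.symm ht).2 ((flat n d).add_mem ((hMψ hyψ).2 hy) ((flat n d).smul_mem _ hv))
  · have hcomp := HasFDerivAt.comp_hasDerivAt (0 : ℝ) (f := fun t : ℝ => ψ y + t • A v)
      (by simpa using hA'.hasFDerivAt) hline
    rwa [ContinuousLinearEquiv.coe_coe, A.symm_apply_apply] at hcomp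

theorem deriv_mem_tangentSpaceOf {M : Set (Eucl n)} {γ : ℝ → Eucl n} {s : ℝ}
    (hd : DifferentiableAt ℝ γ s) (hγ : ∀ᶠ t in 𝓝 s, γ t ∈ M) :
    deriv γ s ∈ tangentSpaceOf M (γ s) := by
  refine Submodule.subset_span ⟨fun t => γ (s + t), by simp, ?_, ?_⟩
  · have hlim : Tendsto (fun t => s + t) (𝓝 0) (𝓝 s) := by
      simpa using (continuous_const_add s).tendsto (0 : ℝ)
    exact hlim.eventually hγ
  · have hderiv : HasDerivAt γ (deriv γ s) (s + 0) := by simpa using hd.hasDerivAt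
    exact hderiv.comp_const_add s 0

theorem mem_tangentSpaceOf_of_tendsto_secant {M : Set (Eucl n)} (hM : IsCpSubmanifold 1 d M)
    {y u : Eucl n} (hy : y ∈ M) {ι : Type*} {l : Filter ι} [l.NeBot] {z : ι → Eucl n}
    (hz : Tendsto z l (𝓝 y)) (hzM : ∀ᶠ i in l, z i ∈ M)
    (hu : Tendsto (fun i => ‖z i - y‖⁻¹ • (z i - y)) l (𝓝 u)) : u ∈ tangentSpaceOf M y := by
  obtain ⟨ψ, hyψ, hψ, hMψ⟩ := hM.2 y hy
  obtain ⟨A, hA, hA'⟩ := hψ.exists_hasStrictFDerivAt_equiv hyψ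
  rw [tangentSpaceOf_isImage hMψ hyψ hA.hasFDerivAt hA'.hasFDerivAt,
      tangentSpaceOf_submodule _ ((hMψ hyψ).2 hy)]
  have hc : IsClosed (flat n d : Set (Eucl n)) := (flat n d).closed_of_finiteDimensional
  have h1 : Tendsto (fun i => ‖z i - y‖⁻¹ • (ψ (z i) - ψ y - A (z i - y))) l (𝓝 0) := by
    have := (hasFDerivAt_iff_tendsto.1 hA.hasFDerivAt).comp hz
    rw [tendsto_zero_iff_norm_tendsto_zero]
    refine this.congr fun i => ?_
    simp [norm_smul]
  have h2 : Tendsto (fun i => ‖z i - y‖⁻¹ • (ψ (z i) - ψ y)) l (𝓝 (A u)) := by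
    have := h1.add ((A.continuous.tendsto u).comp hu)
    rw [zero_add] at this
    refine this.congr fun i => ?_
    simp [smul_sub]
  refine hc.mem_of_tendsto h2 ?_
  filter_upwards [hzM, hz.eventually (ψ.open_source.mem_nhds hyψ)] with i hi hi'
  exact (flat n d).smul_mem _ ((flat n d).sub_mem ((hMψ hi').2 hi) ((hMψ hyψ).2 hy))

end Tangent

/-! ### Definable curves tending to the origin -/

section Curves

variable {L : FirstOrder.Language} [L.Structure ℝ] [hL : Fact (IsOMinimal L)] {n k : ℕ}

theorem DefReal.norm {g : ℝ → Eucl n} (hg : ∀ i, DefReal L fun s => g s i) :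
    DefReal L fun s => ‖g s‖ :=
  DefVec.norm (f := fun v : Fin 1 → ℝ => g (v 0)) hg

theorem DefReal.eventually_differentiableAt_eucl {g : ℝ → Eucl n}
    (hg : ∀ i, DefReal L fun s => g s i) : ∀ᶠ s in 𝓝[>] (0 : ℝ), DifferentiableAt ℝ g s := by
  have : ∀ᶠ s in 𝓝[>] (0 : ℝ), ∀ i, DifferentiableAt ℝ (fun s => g s i) s :=
    eventually_all.2 fun i => (hg i).eventually_differentiableAt 0
  filter_upwards [this] with s hs
  exact differentiableAt_euclidean.2 hs

theorem deriv_apply_eucl {g : ℝ → Eucl n} {s : ℝ} (hg : DifferentiableAt ℝ g s) (i : Fin n) :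
    (deriv g s) i = deriv (fun s => g s i) s :=
  (((EuclideanSpace.proj i : Eucl n →L[ℝ] ℝ).hasFDerivAt.comp_hasDerivAt s
    hg.hasDerivAt).deriv).symm

theorem eventually_deriv_norm_pos {g : ℝ → Eucl n} (hg : ∀ i, DefReal L fun s => g s i)
    (h0 : Tendsto g (𝓝[>] 0) (𝓝 0)) (hne : ∀ᶠ s in 𝓝[>] (0 : ℝ), g s ≠ 0) :
    ∀ᶠ s in 𝓝[>] (0 : ℝ), 0 < deriv (fun s => ‖g s‖) s :=
  (DefReal.norm hg).eventually_deriv_pos (hne.mono fun s hs => norm_pos_iff.2 hs) (by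
    simpa using h0.norm)

theorem eventually_norm_deriv_sub_le {g : ℝ → Eucl n} (hg : ∀ i, DefReal L fun s => g s i)
    (h0 : Tendsto g (𝓝[>] 0) (𝓝 0)) (hne : ∀ᶠ s in 𝓝[>] (0 : ℝ), g s ≠ 0) {η : ℝ} (hη : 0 < η) :
    ∀ᶠ s in 𝓝[>] (0 : ℝ), ‖deriv g s - (deriv (fun s => ‖g s‖) s / ‖g s‖) • g s‖ ≤
      η * deriv (fun s => ‖g s‖) s := by
  have hpos := eventually_deriv_norm_pos hg h0 hne
  have hρ0 : Tendsto (fun s => ‖g s‖) (𝓝[>] 0) (𝓝 0) := by simpa using h0.norm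
  have hcomp : ∀ i, Tendsto (fun s => deriv (fun s => g s i) s / deriv (fun s => ‖g s‖) s -
      g s i / ‖g s‖) (𝓝[>] 0) (𝓝 0) := by
    intro i
    obtain ⟨c, hc⟩ := ((hg i).div (DefReal.norm hg)).exists_tendsto_of_abs_le (a := 0) (C := 1)
      (.of_forall fun s => by
        rw [abs_div, abs_norm]
        exact div_le_one_of_le₀ (PiLp.norm_apply_le (g s) i) (norm_nonneg _))
    have hi0 : Tendsto (fun s => g s i) (𝓝[>] 0) (𝓝 0) := by
      simpa [Function.comp_def] using
        ((EuclideanSpace.proj i : Eucl n →L[ℝ] ℝ).continuous.tendsto 0).comp h0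
    have := (hg i).tendsto_deriv_div (DefReal.norm hg) hi0 hρ0 (hpos.mono fun s hs => hs.ne') hc
    simpa using this.sub hc
  have hvec : Tendsto (fun s => (WithLp.toLp 2 fun i => deriv (fun s => g s i) s /
      deriv (fun s => ‖g s‖) s - g s i / ‖g s‖ : Eucl n)) (𝓝[>] 0) (𝓝 0) :=
    ((PiLp.continuous_toLp 2 _).tendsto 0).comp (tendsto_pi_nhds.2 hcomp)
  have hev := hvec.norm.eventually (gt_mem_nhds (by simpa using hη))
  filter_upwards [hev, hpos, DefReal.eventually_differentiableAt_eucl hg] with s hs hp hd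
  have : deriv g s - (deriv (fun s => ‖g s‖) s / ‖g s‖) • g s = deriv (fun s => ‖g s‖) s •
      (WithLp.toLp 2 fun i => deriv (fun s => g s i) s / deriv (fun s => ‖g s‖) s -
        g s i / ‖g s‖ : Eucl n) := by
    ext i
    simp only [PiLp.sub_apply, PiLp.smul_apply, smul_eq_mul, deriv_apply_eucl hd]
    field_simp
  rw [this, norm_smul, Real.norm_of_nonneg hp.le, mul_comm]
  exact mul_le_mul_of_nonneg_right hs.le hp.le

end Curves

/-! ### The radial direction is asymptotically tangent -/

section SecantFarSet

variable {L : FirstOrder.Language} [L.Structure ℝ] [hL : Fact (IsOMinimal L)] {n k : ℕ}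

/-- The points of `Y` near which the secants of `Y` stay away from the normal direction. -/
def secantFarSet (k : ℕ) (Y : Set (Eucl n)) (c : ℝ) : Set (Eucl n) :=
  {y | y ∈ Y ∧ ∃ δ : ℝ, 0 < δ ∧ ∀ z, z ∈ Y → ‖z - y‖ < δ →
    |inner ℝ (z - y) (normalPart n k y)| ≤ c * (‖z - y‖ * ‖normalPart n k y‖)}

theorem DefVec.normalPart {α : Type} {f : (α → ℝ) → Eucl n} (hf : DefVec L f) :
    DefVec L fun v => normalPart n k (f v) := by
  intro i
  simp only [normalPart_apply, PiLp.sub_apply, flat_starProjection_apply]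
  refine .sub (hf i) ?_
  split_ifs
  exacts [hf i, .const _]

theorem isDefinableSet_secantFarSet {Y : Set (Eucl n)} (hY : IsDefinableSet L Y) (c : ℝ) :
    IsDefinableSet L (secantFarSet k Y c) := by
  have hdef : DefPred L fun v : Fin n → ℝ => WithLp.toLp 2 v ∈ secantFarSet k Y c := by
    refine .and hY (.exists_real (.and (.lt (.const _) (.proj _)) (.forall_vec
      (.imp (.mem hY (.toLp _)) (.imp (.lt (DefVec.norm (.sub (.toLp _) ?_)) (.proj _))
        (.le (.abs (DefVec.inner (.sub (.toLp _) ?_) (.normalPart ?_)))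
          (.mul (.const _) (.mul (DefVec.norm (.sub (.toLp _) ?_))
            (DefVec.norm (.normalPart ?_)))))))))) <;>
    exact .toLp _
  exact hdef

theorem exists_unit_tangent_of_notMem_secantFarSet {d : ℕ} {Y : Set (Eucl n)}
    (hY : IsCpSubmanifold 1 d Y) {c : ℝ} {y : Eucl n} (hy : y ∈ Y)
    (hyc : y ∉ secantFarSet k Y c) :
    ∃ u ∈ tangentSpaceOf Y y, ‖u‖ = 1 ∧
      c * ‖normalPart n k y‖ ≤ |inner ℝ u (normalPart n k y)| := by
  set h := normalPart n k y
  have hsecant : ∀ m : ℕ, ∃ z ∈ Y, ‖z - y‖ < 1 / ((m : ℝ) + 1) ∧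
      c * (‖z - y‖ * ‖h‖) < |inner ℝ (z - y) h| := by
    intro m
    by_contra! hcon
    exact hyc ⟨hy, 1 / ((m : ℝ) + 1), by positivity, hcon⟩
  choose z hzY hz hzc using hsecant
  have hne : ∀ m, z m - y ≠ 0 := fun m h0 => by simpa [h0] using hzc m
  have hsphere : ∀ m, ‖z m - y‖⁻¹ • (z m - y) ∈ Metric.sphere (0 : Eucl n) 1 := fun m => by
    simp [norm_smul, norm_ne_zero_iff.2 (hne m)]
  obtain ⟨u, hu, σ, hσ, hlim⟩ := (isCompact_sphere (0 : Eucl n) 1).tendsto_subseq hsphere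
  have hzlim : Tendsto z atTop (𝓝 y) := by
    rw [tendsto_iff_norm_sub_tendsto_zero]
    exact squeeze_zero (fun _ => norm_nonneg _) (fun m => (hz m).le)
      tendsto_one_div_add_atTop_nhds_zero_nat
  refine ⟨u, mem_tangentSpaceOf_of_tendsto_secant hY hy (hzlim.comp hσ.tendsto_atTop)
    (.of_forall fun m => hzY _) hlim, by simpa using hu, ?_⟩
  refine ge_of_tendsto ((hlim.inner tendsto_const_nhds).abs) (.of_forall fun m => ?_)
  simp only [Function.comp, real_inner_smul_left, abs_mul, abs_inv, abs_norm]
  rw [inv_mul_eq_div, le_div_iff₀ (norm_pos_iff.2 (hne (σ m)))]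
  linarith [hzc (σ m)]

theorem exists_tangent_near_of_notMem_secantFarSet {d : ℕ} {Y : Set (Eucl n)}
    (hY : IsCpSubmanifold 1 d Y) {c : ℝ} {y : Eucl n} (hy : y ∈ Y) (hc : 0 ≤ c)
    (hyc : y ∉ secantFarSet k Y c) :
    ∃ v ∈ tangentSpaceOf Y y,
      ‖normalPart n k y - v‖ ^ 2 ≤ (1 - c ^ 2) * ‖normalPart n k y‖ ^ 2 := by
  obtain ⟨u, huT, hu, hinner⟩ := exists_unit_tangent_of_notMem_secantFarSet hY hy hyc
  set h := normalPart n k y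
  refine ⟨inner ℝ u h • u, Submodule.smul_mem _ _ huT, ?_⟩
  have hsq : (c * ‖h‖) ^ 2 ≤ (inner ℝ u h) ^ 2 := by
    rw [← sq_abs (inner ℝ u h)]
    exact pow_le_pow_left₀ (by positivity) hinner 2
  rw [norm_sub_sq_real, real_inner_smul_right, real_inner_comm u h, norm_smul, hu, mul_one,
    Real.norm_eq_abs, sq_abs]
  nlinarith

theorem inner_le_of_mem_secantFarSet {d : ℕ} {Y : Set (Eucl n)} (hY : IsCpSubmanifold 1 d Y)
    {c : ℝ} {y : Eucl n} (hyc : y ∈ secantFarSet k Y c) {v : Eucl n}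
    (hv : v ∈ tangentSpaceOf Y y) :
    |inner ℝ v (normalPart n k y)| ≤ c * (‖v‖ * ‖normalPart n k y‖) := by
  obtain ⟨hy, δ, hδ, hsecant⟩ := hyc
  obtain ⟨γ, hγ0, hγY, hγ⟩ := exists_hasDerivAt_of_mem_tangentSpaceOf hY hy hv
  have hnear : ∀ᶠ t in 𝓝 (0 : ℝ), ‖γ t - y‖ < δ := by
    have := hγ.continuousAt.eventually_mem (Metric.ball_mem_nhds (γ 0) hδ)
    simpa [hγ0, dist_eq_norm] using this
  have hslope := hasDerivAt_iff_tendsto_slope.1 hγ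
  refine le_of_tendsto_of_tendsto ((hslope.inner tendsto_const_nhds).abs)
    ((hslope.norm.mul_const _).const_mul c) ?_
  filter_upwards [nhdsWithin_le_nhds hγY, nhdsWithin_le_nhds hnear] with t htY htδ
  rw [slope_def_module, hγ0, real_inner_smul_left, norm_smul, abs_mul, Real.norm_eq_abs]
  calc _ ≤ |(t - 0)⁻¹| * (c * (‖γ t - y‖ * ‖normalPart n k y‖)) :=
        mul_le_mul_of_nonneg_left (hsecant _ htY htδ) (abs_nonneg _)
    _ = _ := by ring

end SecantFarSet

section Projections

variable {E : Type*} [NormedAddCommGroup E] [InnerProductSpace ℝ E] {T : Submodule ℝ E}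
  [T.HasOrthogonalProjection]

theorem infEDist_submodule (u : E) :
    Metric.infEDist u (T : Set E) = ENNReal.ofReal ‖u - T.starProjection u‖ := by
  apply le_antisymm
  · refine (Metric.infEDist_le_edist_of_mem (T.starProjection_apply_mem u)).trans ?_
    rw [edist_dist, dist_eq_norm]
  · refine Metric.le_infEDist.2 fun v hv => ?_
    rw [edist_dist, dist_eq_norm, norm_sub_rev, norm_sub_rev u v]
    exact ENNReal.ofReal_le_ofReal (norm_starProjection_sub_le u hv)

theorem mul_norm_le_norm_sub_of_inner_le {h : E} {c : ℝ}
    (hT : ∀ v ∈ T, |inner ℝ v h| ≤ c * (‖v‖ * ‖h‖)) :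
    (1 - c ^ 2) * ‖h‖ ^ 2 ≤ ‖h - T.starProjection h‖ ^ 2 := by
  set v := T.starProjection h
  have hinner : inner ℝ v h ≤ c * (‖v‖ * ‖h‖) :=
    (le_abs_self _).trans (hT v (T.starProjection_apply_mem h))
  rw [norm_sub_sq_real, real_inner_comm v h]
  nlinarith [sq_nonneg (‖v‖ - c * ‖h‖)]

theorem mul_norm_sub_starProjection_le_of_add_mem {x h' h : E} (hT : x + h' ∈ T) {a : ℝ}
    (ha : 0 ≤ a) : a * ‖h - T.starProjection h‖ ≤
      ‖x - T.starProjection x‖ + ‖h' - a • h‖ := by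
  simp only [← T.starProjection_orthogonal_val]
  have hx : Tᗮ.starProjection x = -Tᗮ.starProjection h' := by
    refine eq_neg_of_add_eq_zero_left ?_
    rw [← map_add, Submodule.starProjection_orthogonal_val,
      Submodule.starProjection_eq_self_iff.2 hT, sub_self]
  calc a * ‖Tᗮ.starProjection h‖ = ‖Tᗮ.starProjection h' - Tᗮ.starProjection (h' - a • h)‖ := by
        rw [← map_sub, sub_sub_cancel, map_smul, norm_smul, Real.norm_of_nonneg ha]
    _ ≤ ‖Tᗮ.starProjection x‖ + ‖h' - a • h‖ := by
        rw [hx, norm_neg]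
        exact (norm_sub_le _ _).trans
          (add_le_add le_rfl (Submodule.norm_starProjection_apply_le _ _))

theorem ofReal_norm_sub_starProjection_le {E T : Submodule ℝ (Eucl n)} {e : Eucl n} (he : e ∈ E) :
    ENNReal.ofReal ‖e - T.starProjection e‖ ≤ ENNReal.ofReal ‖e‖ * gapDist E T := by
  rcases eq_or_ne e 0 with rfl | h0
  · simp
  have hpos : 0 < ‖e‖ := norm_pos_iff.2 h0
  have hgap : Metric.infEDist (‖e‖⁻¹ • e) (T : Set (Eucl n)) ≤ gapDist E T :=
    le_iSup_of_le (‖e‖⁻¹ • e) (le_iSup_of_le (E.smul_mem _ he) (le_iSup_of_le (by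
      simp [norm_smul, hpos.ne']) le_rfl))
  rw [infEDist_submodule, map_smul, ← smul_sub, norm_smul, norm_inv, norm_norm] at hgap
  calc ENNReal.ofReal ‖e - T.starProjection e‖
      = ENNReal.ofReal ‖e‖ * ENNReal.ofReal (‖e‖⁻¹ * ‖e - T.starProjection e‖) := by
        rw [← ENNReal.ofReal_mul hpos.le]; congr 1; field_simp
    _ ≤ _ := by gcongr

end Projections

section Integrals

theorem lintegral_ofReal_logDeriv_eq_top {ρ : ℝ → ℝ} {b : ℝ} (hb : 0 < b)
    (hpos : ∀ s ∈ Ioo 0 b, 0 < ρ s) (hd : ∀ s ∈ Ioo 0 b, DifferentiableAt ℝ ρ s)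
    (hd' : ∀ s ∈ Ioo 0 b, 0 < deriv ρ s) (h0 : Tendsto ρ (𝓝[>] 0) (𝓝 0)) :
    ∫⁻ s in Ioo 0 b, ENNReal.ofReal (deriv ρ s / ρ s) = ∞ := by
  by_contra hcon
  have hev : ∀ᶠ s in 𝓝[>] (0 : ℝ), s ∈ Ioo 0 b := Ioo_mem_nhdsGT hb
  have hder : ∀ s ∈ Ioo 0 b, HasDerivAt (fun s => Real.log (ρ s)) (deriv ρ s / ρ s) s :=
    fun s hs => (hd s hs).hasDerivAt.log (hpos s hs).ne'
  refine not_integrableOn_of_tendsto_norm_atTop_of_deriv_isBigO_filter (𝓝[>] (0 : ℝ))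
    (f := fun s => Real.log (ρ s)) (g := deriv fun s => Real.log (ρ s)) (k := Ioo 0 b)
    (Ioo_mem_nhdsGT hb) (hev.mono fun s hs => (hder s hs).differentiableAt) ?_
    (Asymptotics.isBigO_refl _ _) ⟨(measurable_deriv _).aestronglyMeasurable, ?_⟩
  · simp only [Real.norm_eq_abs]
    refine tendsto_abs_atBot_atTop.comp (Real.tendsto_log_nhdsNE_zero.comp ?_)
    exact tendsto_nhdsWithin_iff.2 ⟨h0, hev.mono fun s hs => (hpos s hs).ne'⟩
  · refine lt_of_le_of_lt (le_of_eq ?_) (lt_top_iff_ne_top.2 hcon)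
    refine setLIntegral_congr_fun measurableSet_Ioo fun s hs => ?_
    rw [(hder s hs).deriv, ← ofReal_norm, Real.norm_of_nonneg (div_pos (hd' s hs) (hpos s hs)).le]

theorem setLIntegral_deriv_mul_comp_lt_top {τ : ℝ → ℝ} {R : ℝ → ℝ≥0∞} {b : ℝ} {S : Set ℝ}
    (hS : ∫⁻ t in S, R t < ∞) (hd : ∀ s ∈ Ioo 0 b, DifferentiableAt ℝ τ s)
    (hpos : ∀ s ∈ Ioo 0 b, 0 < deriv τ s) (hτS : ∀ s ∈ Ioo 0 b, τ s ∈ S) :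
    ∫⁻ s in Ioo 0 b, ENNReal.ofReal (deriv τ s) * R (τ s) < ∞ := by
  have hmono : StrictMonoOn τ (Ioo 0 b) :=
    strictMonoOn_of_deriv_pos (convex_Ioo 0 b)
      (fun s hs => (hd s hs).continuousAt.continuousWithinAt)
      fun s hs => hpos s (interior_subset hs)
  calc ∫⁻ s in Ioo 0 b, ENNReal.ofReal (deriv τ s) * R (τ s)
      = ∫⁻ s in Ioo 0 b, ENNReal.ofReal |deriv τ s| * R (τ s) :=
        setLIntegral_congr_fun measurableSet_Ioo fun s hs => by
          rw [abs_of_pos (hpos s hs)]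
    _ = ∫⁻ t in τ '' Ioo 0 b, R t :=
        (lintegral_image_eq_lintegral_abs_deriv_mul measurableSet_Ioo
          (fun s hs => (hd s hs).hasDerivAt.hasDerivWithinAt) hmono.injOn R).symm
    _ ≤ ∫⁻ t in S, R t := lintegral_mono_set (image_subset_iff.2 hτS)
    _ < ∞ := hS

theorem ofReal_div_le_of_ofReal_mul_le {a b p q ρ : ℝ} {r : ℝ≥0∞} (ha : 0 < a) (hb : 0 ≤ b)
    (hρ : 0 < ρ) (h : ENNReal.ofReal (a * p) ≤ ENNReal.ofReal (b * q) * (r * ENNReal.ofReal ρ)) :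
    ENNReal.ofReal (p / ρ) ≤ ENNReal.ofReal (b / a) * (ENNReal.ofReal q * r) := by
  have hρ' : ENNReal.ofReal (1 / (a * ρ)) * ENNReal.ofReal ρ = ENNReal.ofReal (1 / a) := by
    rw [← ENNReal.ofReal_mul (by positivity)]
    congr 1
    field_simp
  calc ENNReal.ofReal (p / ρ) = ENNReal.ofReal (1 / (a * ρ)) * ENNReal.ofReal (a * p) := by
        rw [← ENNReal.ofReal_mul (by positivity)]
        congr 1
        field_simp
    _ ≤ ENNReal.ofReal (1 / (a * ρ)) * (ENNReal.ofReal (b * q) * (r * ENNReal.ofReal ρ)) := by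
        gcongr
    _ = (ENNReal.ofReal (1 / (a * ρ)) * ENNReal.ofReal ρ) * ENNReal.ofReal (b * q) * r := by ring
    _ = ENNReal.ofReal (b / a) * (ENNReal.ofReal q * r) := by
        rw [hρ', ENNReal.ofReal_mul hb, div_eq_mul_one_div b a, ENNReal.ofReal_mul hb]
        ring

end Integrals

section RadialTangent

variable {L : FirstOrder.Language} [L.Structure ℝ] [hL : Fact (IsOMinimal L)] {n k d : ℕ}
  {Y : Set (Eucl n)} {c η : ℝ} {γ : ℝ → Eucl n}

theorem deriv_clm_apply_comp {A : Eucl n →L[ℝ] Eucl n} {s : ℝ} (hγ : DifferentiableAt ℝ γ s) :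
    deriv (fun s => A (γ s)) s = A (deriv γ s) :=
  (A.hasFDerivAt.comp_hasDerivAt s hγ.hasDerivAt).deriv

theorem eventually_norm_deriv_le_two_mul {x : ℝ → Eucl n} (hx : ∀ i, DefReal L fun s => x s i)
    (h0 : Tendsto x (𝓝[>] 0) (𝓝 0)) (hne : ∀ᶠ s in 𝓝[>] (0 : ℝ), x s ≠ 0) :
    ∀ᶠ s in 𝓝[>] (0 : ℝ), ‖deriv x s‖ ≤ 2 * deriv (fun s => ‖x s‖) s := by
  filter_upwards [eventually_deriv_norm_pos hx h0 hne, hne,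
    eventually_norm_deriv_sub_le hx h0 hne one_pos] with s hpos hs hle
  have hradial : ‖(deriv (fun s => ‖x s‖) s / ‖x s‖) • x s‖ = deriv (fun s => ‖x s‖) s := by
    rw [norm_smul, norm_div, norm_norm, Real.norm_of_nonneg hpos.le,
      div_mul_cancel₀ _ (norm_ne_zero_iff.2 hs)]
  have := norm_le_norm_sub_add (deriv x s) ((deriv (fun s => ‖x s‖) s / ‖x s‖) • x s)
  linarith

theorem eventually_le_norm_deriv_sub_starProjection (hY : IsCpSubmanifold 1 d Y)
    (hη : 0 < η) (hcη : c ^ 2 + η ^ 2 = 1) (hγdef : ∀ i, DefReal L fun s => γ s i)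
    (hγ0 : Tendsto γ (𝓝[>] 0) (𝓝 0)) (hγ : ∀ s > 0, γ s ∈ secantFarSet k Y c)
    (hne : ∀ s > 0, normalPart n k (γ s) ≠ 0) :
    ∀ᶠ s in 𝓝[>] (0 : ℝ), η / 2 * deriv (fun s => ‖normalPart n k (γ s)‖) s ≤
      ‖(flat n k).starProjection (deriv γ s) - (tangentSpaceOf Y (γ s)).starProjection
        ((flat n k).starProjection (deriv γ s))‖ := by
  have hpos : ∀ᶠ s in 𝓝[>] (0 : ℝ), 0 < s := self_mem_nhdsWithin
  have hhdef : ∀ i, DefReal L fun s => normalPart n k (γ s) i :=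
    DefVec.normalPart (f := fun v : Fin 1 → ℝ => γ (v 0)) hγdef
  have hh0 : Tendsto (fun s => normalPart n k (γ s)) (𝓝[>] 0) (𝓝 0) := by
    simpa [Function.comp_def] using ((normalPart n k).continuous.tendsto 0).comp hγ0
  filter_upwards [hpos, DefReal.eventually_differentiableAt_eucl hγdef,
    eventually_deriv_norm_pos hhdef hh0 (hpos.mono hne),
    eventually_norm_deriv_sub_le hhdef hh0 (hpos.mono hne) (half_pos hη)] with s hs hd hρ' hradial
  set ρ := ‖normalPart n k (γ s)‖
  set ρ' := deriv (fun s => ‖normalPart n k (γ s)‖) s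
  set T := tangentSpaceOf Y (γ s)
  have hρ : 0 < ρ := norm_pos_iff.2 (hne s hs)
  have hγT : deriv γ s ∈ T := deriv_mem_tangentSpaceOf hd <| by
    filter_upwards [Ioi_mem_nhds hs] with t ht using (hγ t ht).1
  have hfar : η * ρ ≤ ‖normalPart n k (γ s) - T.starProjection (normalPart n k (γ s))‖ := by
    refine le_of_sq_le_sq ?_ (norm_nonneg _)
    rw [mul_pow, eq_sub_of_add_eq' hcη]
    exact mul_norm_le_norm_sub_of_inner_le fun v hv => inner_le_of_mem_secantFarSet hY (hγ s hs) hv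
  rw [deriv_clm_apply_comp hd] at hradial
  have hsplit := mul_norm_sub_starProjection_le_of_add_mem (T := T)
    (x := (flat n k).starProjection (deriv γ s)) (h' := normalPart n k (deriv γ s))
    (h := normalPart n k (γ s)) (by rwa [starProjection_add_normalPart]) (div_pos hρ' hρ).le
  have hscale : η * ρ' ≤
      ρ' / ρ * ‖normalPart n k (γ s) - T.starProjection (normalPart n k (γ s))‖ := by
    calc η * ρ' = ρ' / ρ * (η * ρ) := by field_simp
      _ ≤ _ := mul_le_mul_of_nonneg_left hfar (div_pos hρ' hρ).le
  linarith

theorem eventually_ne_zero_of_deriv_ne_zero {x : ℝ → Eucl n} (hx : ∀ i, DefReal L fun s => x s i)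
    (hderiv : ∀ᶠ s in 𝓝[>] (0 : ℝ), deriv x s ≠ 0) : ∀ᶠ s in 𝓝[>] (0 : ℝ), x s ≠ 0 := by
  rcases eventually_nhdsGT_or_not (P := fun s => ‖x s‖ = 0)
    (.eq (DefReal.norm hx) (.const 0)) 0 with hzero | hne
  · obtain ⟨b, hb, hb'⟩ := mem_nhdsGT_iff_exists_Ioo_subset.1 (hderiv.and hzero)
    obtain ⟨s, hs⟩ := exists_between (show (0 : ℝ) < b from hb)
    have hx0 : x =ᶠ[𝓝 s] fun _ => 0 := by
      filter_upwards [Ioo_mem_nhds hs.1 hs.2] with t ht using norm_eq_zero.1 (hb' ht).2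
    exact absurd (by rw [hx0.deriv_eq, deriv_const]) (hb' hs).1
  · exact hne.mono fun s hs h0 => hs (by simp [h0])

theorem lintegral_eq_top_of_logDeriv_norm_le {x h : ℝ → Eucl n}
    (hx : ∀ i, DefReal L fun s => x s i) (hx0 : Tendsto x (𝓝[>] 0) (𝓝 0))
    (hh : ∀ i, DefReal L fun s => h s i) (hh0 : Tendsto h (𝓝[>] 0) (𝓝 0))
    (hne : ∀ᶠ s in 𝓝[>] (0 : ℝ), h s ≠ 0) {a : ℝ} (ha : 0 < a) {R : ℝ → ℝ≥0∞}
    (hle : ∀ᶠ s in 𝓝[>] (0 : ℝ), ENNReal.ofReal (a * deriv (fun s => ‖h s‖) s) ≤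
      ENNReal.ofReal ‖deriv x s‖ * (R ‖x s‖ * ENNReal.ofReal ‖h s‖)) {ε : ℝ} (hε : 0 < ε) :
    ∫⁻ t in Icc 0 ε, R t = ∞ := by
  have hρ' := eventually_deriv_norm_pos hh hh0 hne
  have hxne : ∀ᶠ s in 𝓝[>] (0 : ℝ), x s ≠ 0 := by
    refine eventually_ne_zero_of_deriv_ne_zero hx ?_
    filter_upwards [hle, hρ'] with s hs hρ'_pos h0
    have hpos : 0 < ENNReal.ofReal (a * deriv (fun s => ‖h s‖) s) := by simp [ha, hρ'_pos]
    exact absurd (hpos.trans_le hs) (by simp [h0])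
  have hτ0 : Tendsto (fun s => ‖x s‖) (𝓝[>] 0) (𝓝 0) := by simpa using hx0.norm
  obtain ⟨b, hb, hgood⟩ := mem_nhdsGT_iff_exists_Ioo_subset.1
    (hle.and <| hne.and <| hρ'.and <| (eventually_deriv_norm_pos hx hx0 hxne).and <|
      (eventually_norm_deriv_le_two_mul hx hx0 hxne).and <|
      ((DefReal.norm hx).eventually_differentiableAt 0).and <|
      ((DefReal.norm hh).eventually_differentiableAt 0).and <| hτ0.eventually (gt_mem_nhds hε))
  simp only [subset_def, mem_ofPred_eq] at hgood
  choose! hle hne hρ' hτ' hvel hτd hρd hτε using hgood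
  have htop := lintegral_ofReal_logDeriv_eq_top hb (fun s hs => norm_pos_iff.2 (hne s hs)) hρd hρ'
    (by simpa using hh0.norm)
  have hbound : ∫⁻ s in Ioo 0 b, ENNReal.ofReal (deriv (fun s => ‖h s‖) s / ‖h s‖) ≤
      ∫⁻ s in Ioo 0 b, ENNReal.ofReal (2 / a) *
        (ENNReal.ofReal (deriv (fun s => ‖x s‖) s) * R ‖x s‖) :=
    setLIntegral_mono' measurableSet_Ioo fun s hs =>
      ofReal_div_le_of_ofReal_mul_le ha zero_le_two (norm_pos_iff.2 (hne s hs))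
        ((hle s hs).trans (by gcongr; exact hvel s hs))
  by_contra hfin
  have hlt := setLIntegral_deriv_mul_comp_lt_top (lt_top_iff_ne_top.2 hfin) hτd hτ'
    fun s hs => ⟨norm_nonneg _, (hτε s hs).le⟩
  rw [htop, lintegral_const_mul' _ _ ENNReal.ofReal_ne_top, top_le_iff] at hbound
  exact (ENNReal.mul_lt_top ENNReal.ofReal_lt_top hlt).ne hbound

theorem zero_notMem_closure_secantFarSet (hYdef : IsDefinableSet L Y)
    (hY : IsCpSubmanifold 1 d Y) (hYK : ∀ y ∈ Y, y ∉ flat n k)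
    {R : ℝ → ℝ≥0∞} (hR : ∀ y ∈ Y, gapDist (flat n k) (tangentSpaceOf Y y) ≤
      R ‖(flat n k).starProjection y‖ * ENNReal.ofReal ‖normalPart n k y‖)
    {ε : ℝ} (hε : 0 < ε) (hint : ∫⁻ t in Icc 0 ε, R t < ∞) (hη : 0 < η)
    (hcη : c ^ 2 + η ^ 2 = 1) : (0 : Eucl n) ∉ closure (secantFarSet k Y c) := by
  intro hcl
  obtain ⟨γ, hγdef, hγ⟩ := exists_definable_curve (isDefinableSet_secantFarSet hYdef c) hcl
  have hpos : ∀ᶠ s in 𝓝[>] (0 : ℝ), 0 < s := self_mem_nhdsWithin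
  have hγ0 : Tendsto γ (𝓝[>] 0) (𝓝 0) := by
    rw [tendsto_zero_iff_norm_tendsto_zero]
    exact squeeze_zero' (.of_forall fun _ => norm_nonneg _) (hpos.mono fun s hs => (hγ s hs).2.le)
      (tendsto_nhdsWithin_of_tendsto_nhds tendsto_id)
  have hhdef : ∀ i, DefReal L fun s => normalPart n k (γ s) i :=
    DefVec.normalPart (f := fun v : Fin 1 → ℝ => γ (v 0)) hγdef
  have hxdef : ∀ i, DefReal L fun s => (flat n k).starProjection (γ s) i := fun i => by
    simpa [normalPart_apply] using (hγdef i).sub (hhdef i)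
  have hh0 : Tendsto (fun s => normalPart n k (γ s)) (𝓝[>] 0) (𝓝 0) := by
    simpa [Function.comp_def] using ((normalPart n k).continuous.tendsto 0).comp hγ0
  have hx0 : Tendsto (fun s => (flat n k).starProjection (γ s)) (𝓝[>] 0) (𝓝 0) := by
    simpa [Function.comp_def] using ((flat n k).starProjection.continuous.tendsto 0).comp hγ0
  have hhne : ∀ s > 0, normalPart n k (γ s) ≠ 0 := fun s hs h0 =>
    hYK _ (hγ s hs).1.1 (normalPart_eq_zero_iff.1 h0)
  refine hint.ne (lintegral_eq_top_of_logDeriv_norm_le hxdef hx0 hhdef hh0 (hpos.mono hhne)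
    (half_pos hη) ?_ hε)
  filter_upwards [hpos, DefReal.eventually_differentiableAt_eucl hγdef,
    eventually_le_norm_deriv_sub_starProjection hY hη hcη hγdef hγ0
      (fun s hs => (hγ s hs).1) hhne] with s hs hd hlower
  rw [deriv_clm_apply_comp hd]
  calc _ ≤ _ := ENNReal.ofReal_le_ofReal hlower
    _ ≤ _ := ofReal_norm_sub_starProjection_le (Submodule.starProjection_apply_mem _ _)
    _ ≤ _ := by gcongr; exact hR _ (hγ s hs).1.1

theorem eventually_exists_tangent_near_normalPart
    (hYdef : IsDefinableSet L Y) (hY : IsCpSubmanifold 1 d Y) (hYK : ∀ y ∈ Y, y ∉ flat n k)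
    {R : ℝ → ℝ≥0∞} (hR : ∀ y ∈ Y, gapDist (flat n k) (tangentSpaceOf Y y) ≤
      R ‖(flat n k).starProjection y‖ * ENNReal.ofReal ‖normalPart n k y‖)
    {ε : ℝ} (hε : 0 < ε) (hint : ∫⁻ t in Icc 0 ε, R t < ∞) (hη : 0 < η) :
    ∀ᶠ y in 𝓝[Y] 0, ∃ v ∈ tangentSpaceOf Y y, ‖normalPart n k y - v‖ ≤ η * ‖normalPart n k y‖ := by
  wlog hη1 : η < 1 generalizing η
  · filter_upwards [this (η := 1 / 2) (by norm_num) (by norm_num)] with y ⟨v, hv, hv'⟩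
    exact ⟨v, hv, hv'.trans (mul_le_mul_of_nonneg_right (by linarith) (norm_nonneg _))⟩
  have hcη : √(1 - η ^ 2) ^ 2 + η ^ 2 = 1 := by rw [Real.sq_sqrt (by nlinarith)]; ring
  have hcl := zero_notMem_closure_secantFarSet hYdef hY hYK hR hε hint hη hcη
  filter_upwards [self_mem_nhdsWithin,
    nhdsWithin_le_nhds (isClosed_closure.isOpen_compl.mem_nhds hcl)] with y hy hyc
  obtain ⟨v, hv, hnear⟩ := exists_tangent_near_of_notMem_secantFarSet hY hy (Real.sqrt_nonneg _)
    fun hmem => hyc (subset_closure hmem)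
  rw [← eq_sub_of_add_eq' hcη, ← mul_pow] at hnear
  exact ⟨v, hv, le_of_sq_le_sq hnear (by positivity)⟩

end RadialTangent

/-! ### Proper local homeomorphisms onto simply connected spaces -/

section Covering

variable {V W : Type*} [TopologicalSpace V] [T2Space V] [TopologicalSpace W]
  {q : V → W}

theorem isCoveringMap_of_isLocalHomeomorph_of_isProperMap (hq : IsLocalHomeomorph q)
    (hp : IsProperMap q) : IsCoveringMap q := by
  rw [isCoveringMap_iff_isCoveringMapOn_univ]
  have hdisc : ∀ w, IsDiscrete (q ⁻¹' {w}) := fun w =>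
    IsDiscrete.of_openPartialHomeomorph q subset_rfl fun e _ =>
      (hq e).imp fun _ he => ⟨he.1, he.2.symm⟩
  exact hp.isClosedMap.isCoveringMapOn_of_isLocalHomeomorphOn
    (fun w _ => (hp.isCompact_preimage isCompact_singleton).finite (hdisc w))
    (fun x _ => hq x)

theorem isHomeomorph_of_isProperMap_of_fiber_subset [SimplyConnectedSpace W]
    [LocallyPathConnectedSpace W] [Nonempty V] (hq : IsLocalHomeomorph q) (hp : IsProperMap q)
    {C : Set V} (hC : IsPreconnected C) {w₀ : W} (hfiber : q ⁻¹' {w₀} ⊆ C) :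
    IsHomeomorph q := by
  have hcov := isCoveringMap_of_isLocalHomeomorph_of_isProperMap hq hp
  have exists_section (v : V) : ∃ F : C(W, V), F (q v) = v ∧ q ∘ F = id :=
    (hcov.existsUnique_continuousMap_lifts (.id W) (q v) v rfl).exists
  refine ⟨hq.continuous, hq.isOpenMap, fun v v' hv => ?_, fun w => ?_⟩
  · obtain ⟨F, hFv, hF⟩ := exists_section v
    obtain ⟨G, hGv, hG⟩ := exists_section v'
    have hmem : ∀ H : C(W, V), q ∘ H = id → H w₀ ∈ C := fun H hH => hfiber (congrFun hH w₀)
    have hid : EqOn (F ∘ q) id C :=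
      hcov.eqOn_of_comp_eqOn hC (F.continuous.comp hq.continuous).continuousOn continuousOn_id
        (fun z _ => congrFun hF (q z)) (hmem F hF) (congrArg F (congrFun hF w₀))
    have hFG : (F : W → V) = G := hcov.eq_of_comp_eq F.continuous G.continuous (hF.trans hG.symm) w₀
      ((congrArg F (congrFun hG w₀)).symm.trans (hid (hmem G hG)))
    rw [← hFv, ← hGv, hv, hFG]
  · obtain ⟨F, -, hF⟩ := exists_section (Classical.arbitrary V)
    exact ⟨F w, congrFun hF w⟩

end Covering

/-! ### Local sections over a submanifold -/

section LocalSections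

variable {X Z : Type*} [TopologicalSpace X] [TopologicalSpace Z] {f : X → Z} {Y : Set X} {W : Set Z}

/-- `σ` is a local inverse, near the point `y` of `Y`, of the restriction of `f` to `Y`. Away from
`f y` its values are unconstrained. -/
structure IsLocalSectionAt (f : X → Z) (Y : Set X) (y : X) (σ : Z → X) : Prop where
  continuousAt : ContinuousAt σ (f y)
  eventually_mem : ∀ᶠ p in 𝓝 (f y), σ p ∈ Y
  right_inv : ∀ᶠ p in 𝓝 (f y), f (σ p) = p
  left_inv : ∀ᶠ z in 𝓝[Y] y, σ (f z) = z

/-- The restriction `Y ∩ f ⁻¹' W → W` of `f`. -/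
def restrictOver (f : X → Z) (Y : Set X) (W : Set Z) : ↥(Y ∩ f ⁻¹' W) → W :=
  MapsTo.restrict f (Y ∩ f ⁻¹' W) W inter_subset_right

theorem continuous_restrictOver (hf : Continuous f) : Continuous (restrictOver f Y W) :=
  (hf.comp continuous_subtype_val).subtype_mk _

theorem isOpenMap_restrictOver
    (hsec : ∀ y ∈ Y, f y ∈ W → ∃ σ, IsLocalSectionAt f Y y σ) : IsOpenMap (restrictOver f Y W) := by
  rw [isOpenMap_iff_nhds_le]
  intro v N hN
  obtain ⟨σ, hσ⟩ := hsec v v.2.1 v.2.2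
  obtain ⟨O, hO, hON⟩ := mem_nhds_subtype _ _ _ |>.1 (mem_map.1 hN)
  have hσv : σ (f v) = v := hσ.left_inv.self_of_nhdsWithin v.2.1
  have hσO : ∀ᶠ p in 𝓝 (f v), σ p ∈ O := hσ.continuousAt.eventually_mem (by rwa [hσv])
  filter_upwards [(continuous_subtype_val.tendsto (restrictOver f Y W v)).eventually
    (hσO.and (hσ.eventually_mem.and hσ.right_inv))] with w ⟨hwO, hwY, hw⟩
  have hwV : σ w ∈ Y ∩ f ⁻¹' W := ⟨hwY, by rw [mem_preimage, hw]; exact w.2⟩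
  have hqw : restrictOver f Y W ⟨σ w, hwV⟩ = w := Subtype.ext hw
  exact hqw ▸ hON (a := ⟨σ w, hwV⟩) hwO

theorem isLocalHomeomorph_restrictOver (hf : Continuous f)
    (hsec : ∀ y ∈ Y, f y ∈ W → ∃ σ, IsLocalSectionAt f Y y σ) :
    IsLocalHomeomorph (restrictOver f Y W) := by
  rw [isLocalHomeomorph_iff_isOpenEmbedding_restrict]
  intro v
  obtain ⟨σ, hσ⟩ := hsec v v.2.1 v.2.2
  have hincl : Tendsto (Subtype.val : ↥(Y ∩ f ⁻¹' W) → X) (𝓝 v) (𝓝[Y] (v : X)) :=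
    tendsto_nhdsWithin_iff.2 ⟨continuous_subtype_val.tendsto v, .of_forall fun z => z.2.1⟩
  obtain ⟨U, hU, hUo, hvU⟩ := eventually_nhds_iff.1 (hincl.eventually hσ.left_inv)
  refine ⟨U, hUo.mem_nhds hvU, .of_continuous_injective_isOpenMap
    ((continuous_restrictOver hf).comp continuous_subtype_val) (fun z z' hzz' => ?_)
    ((isOpenMap_restrictOver hsec).domRestrict hUo)⟩
  have hff : f z.1 = f z'.1 := congrArg Subtype.val hzz'
  exact Subtype.ext (Subtype.ext (by rw [← hU z.1 z.2, hff, hU z'.1 z'.2]))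

theorem isProperMap_restrictOver [T2Space Z] [CompactlyCoherentSpace W] (hf : Continuous f)
    {K : Set X} (hK : IsCompact K) (hKY : K ∩ f ⁻¹' W = Y ∩ f ⁻¹' W) :
    IsProperMap (restrictOver f Y W) := by
  rw [isProperMap_iff_isCompact_preimage]
  refine ⟨continuous_restrictOver hf, fun Q hQ => ?_⟩
  have hQc : IsClosed (Subtype.val '' Q) := (hQ.image continuous_subtype_val).isClosed
  suffices Subtype.val '' (restrictOver f Y W ⁻¹' Q) = K ∩ f ⁻¹' (Subtype.val '' Q) by
    rw [Subtype.isCompact_iff, this]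
    exact hK.inter_right (hQc.preimage hf)
  ext y
  constructor
  · rintro ⟨v, hv, rfl⟩
    exact ⟨(hKY.symm.subset v.2).1, restrictOver f Y W v, hv, rfl⟩
  · rintro ⟨hyK, w, hw, hwy⟩
    have hyV : y ∈ Y ∩ f ⁻¹' W := hKY.subset ⟨hyK, by rw [mem_preimage, ← hwy]; exact w.2⟩
    have hqy : restrictOver f Y W ⟨y, hyV⟩ = w := Subtype.ext hwy.symm
    exact ⟨⟨y, hyV⟩, by rwa [mem_preimage, hqy], rfl⟩

end LocalSections

section ContDiffSections

variable {X Z : Type*} [NormedAddCommGroup X] [NormedSpace ℝ X] [NormedAddCommGroup Z]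
  [NormedSpace ℝ Z] {f : X → Z} {Y : Set X} {W : Set Z}

theorem exists_contDiffAt_section_of_isHomeomorph (hW : IsOpen W)
    (hq : IsHomeomorph (restrictOver f Y W))
    (hsec : ∀ y ∈ Y, f y ∈ W → ∃ σ, ContDiffAt ℝ 1 σ (f y) ∧ IsLocalSectionAt f Y y σ) :
    ∃ Ψ : Z → X, (∀ p ∈ W, ContDiffAt ℝ 1 Ψ p ∧ Ψ p ∈ Y ∧ f (Ψ p) = p) ∧
      ∀ y ∈ Y, f y ∈ W → Ψ (f y) = y := by
  classical
  let F := (hq.homeomorph (restrictOver f Y W)).symm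
  let Ψ : Z → X := fun p => if hp : p ∈ W then (F ⟨p, hp⟩ : X) else 0
  have hΨF (p) (hp : p ∈ W) : Ψ p = F ⟨p, hp⟩ := dif_pos hp
  have hΨY (p) (hp : p ∈ W) : Ψ p ∈ Y := hΨF p hp ▸ (F ⟨p, hp⟩).2.1
  have hfΨ (p) (hp : p ∈ W) : f (Ψ p) = p := by
    rw [hΨF p hp]
    exact congrArg Subtype.val ((hq.homeomorph _).apply_symm_apply ⟨p, hp⟩)
  have hΨc : ContinuousOn Ψ W := by
    rw [continuousOn_iff_continuous_domRestrict]
    exact (continuous_subtype_val.comp F.continuous).congr fun w => (hΨF w w.2).symm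
  refine ⟨Ψ, fun p hp => ⟨?_, hΨY p hp, hfΨ p hp⟩, fun y hy hyW => ?_⟩
  · obtain ⟨σ, hσc, hσ⟩ := hsec (Ψ p) (hΨY p hp) (by rwa [hfΨ p hp])
    rw [hfΨ p hp] at hσc
    refine hσc.congr_of_eventuallyEq ?_
    have hmemW : ∀ᶠ p' in 𝓝 p, p' ∈ W := hW.mem_nhds hp
    have hΨlim : Tendsto Ψ (𝓝 p) (𝓝[Y] (Ψ p)) :=
      tendsto_nhdsWithin_iff.2 ⟨hΨc.continuousAt (hW.mem_nhds hp), hmemW.mono hΨY⟩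
    filter_upwards [hΨlim.eventually hσ.left_inv, hmemW] with p' hσΨ hp'
    rw [← hσΨ, hfΨ p' hp']
  · rw [hΨF _ hyW]
    exact congrArg Subtype.val ((hq.homeomorph _).symm_apply_apply ⟨y, hy, hyW⟩)

end ContDiffSections

section InverseFunction

variable {n d : ℕ} {Y : Set (Eucl n)} {y : Eucl n}

theorem IsCpSubmanifold.exists_local_parametrization (hY : IsCpSubmanifold 1 d Y) (hy : y ∈ Y) :
    ∃ (φ : flat n d → Eucl n) (ξ : Eucl n → flat n d) (D : flat n d →L[ℝ] Eucl n),
      φ (ξ y) = y ∧ ContDiffAt ℝ 1 φ (ξ y) ∧ HasFDerivAt φ D (ξ y) ∧ Function.Injective D ∧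
      (∀ z, D z ∈ tangentSpaceOf Y y) ∧ (∀ᶠ z in 𝓝 (ξ y), φ z ∈ Y) ∧
      Tendsto ξ (𝓝[Y] y) (𝓝 (ξ y)) ∧ ∀ᶠ z in 𝓝[Y] y, φ (ξ z) = z := by
  obtain ⟨-, hch⟩ := hY
  obtain ⟨ψ, hyψ, hψ, hYψ⟩ := hch y hy
  obtain ⟨A, hA, hA'⟩ := hψ.exists_hasStrictFDerivAt_equiv hyψ
  have hsource : ∀ᶠ z in 𝓝[Y] y, z ∈ ψ.source :=
    nhdsWithin_le_nhds (ψ.open_source.mem_nhds hyψ)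
  have hξ : ∀ z ∈ ψ.source, z ∈ Y → ((flat n d).orthogonalProjectionOnto (ψ z) : Eucl n) = ψ z :=
    fun z hz hzY => Submodule.starProjection_eq_self_iff.2 ((hYψ hz).2 hzY)
  have hξy := hξ y hyψ hy
  refine ⟨fun z => ψ.symm z, fun z => (flat n d).orthogonalProjectionOnto (ψ z),
    (A.symm : Eucl n →L[ℝ] Eucl n).comp (flat n d).subtypeL, ?_, ?_, ?_,
    A.symm.injective.comp Subtype.val_injective, fun z => ?_, ?_, ?_, ?_⟩
  · simp only [hξy, ψ.left_inv hyψ]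
  · refine ContDiffAt.comp (g := ψ.symm) _ ?_ (flat n d).subtypeL.contDiff.contDiffAt
    exact hψ.symm.contDiffAt (by simpa [hξy] using ψ.map_source hyψ)
  · refine HasFDerivAt.comp (g := ψ.symm) _ ?_ (flat n d).subtypeL.hasFDerivAt
    simpa [hξy] using hA'.hasFDerivAt
  · rw [tangentSpaceOf_isImage hYψ hyψ hA.hasFDerivAt hA'.hasFDerivAt,
      tangentSpaceOf_submodule _ ((hYψ hyψ).2 hy)]
    simp
  · have htarget : ∀ᶠ z : flat n d in 𝓝 ((flat n d).orthogonalProjectionOnto (ψ y)),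
        (z : Eucl n) ∈ ψ.target :=
      continuous_subtype_val.continuousAt.eventually_mem
        (ψ.open_target.mem_nhds (by rw [hξy]; exact ψ.map_source hyψ))
    exact htarget.mono fun z hz => (hYψ.symm hz).2 z.2
  · exact ((flat n d).orthogonalProjectionOnto.continuous.continuousAt.comp
      (ψ.continuousAt hyψ)).tendsto.mono_left nhdsWithin_le_nhds
  · filter_upwards [hsource, self_mem_nhdsWithin] with z hz hzY
    rw [hξ z hz hzY, ψ.left_inv hz]

theorem IsCpSubmanifold.exists_contDiffAt_isLocalSectionAt {F : Type*} [NormedAddCommGroup F]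
    [NormedSpace ℝ F] [FiniteDimensional ℝ F] (hY : IsCpSubmanifold 1 d Y)
    (hdim : Module.finrank ℝ F = d) (hy : y ∈ Y) {f : Eucl n → F} (hf : ContDiffAt ℝ 1 f y)
    {B : Eucl n →L[ℝ] F} (hB : HasFDerivAt f B y)
    (hinj : ∀ v ∈ tangentSpaceOf Y y, B v = 0 → v = 0) :
    ∃ σ : F → Eucl n, ContDiffAt ℝ 1 σ (f y) ∧ IsLocalSectionAt f Y y σ := by
  obtain ⟨φ, ξ, D, hφξ, hφ, hD, hDinj, hDT, hφY, hξ, hφξY⟩ := hY.exists_local_parametrization hy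
  have hBD : Function.Injective (B.comp D : flat n d →ₗ[ℝ] F) :=
    (injective_iff_map_eq_zero _).2 fun z hz =>
      (injective_iff_map_eq_zero D).1 hDinj z (hinj _ (hDT z) hz)
  let E : flat n d ≃L[ℝ] F := (LinearEquiv.ofInjectiveOfFinrankEq _ hBD
    ((finrank_flat hY.1).trans hdim.symm)).toContinuousLinearEquiv
  have hfφ : ContDiffAt ℝ 1 (f ∘ φ) (ξ y) := .comp _ (by rwa [hφξ]) hφ
  have hE : HasFDerivAt (f ∘ φ) (E : flat n d →L[ℝ] F) (ξ y) := .comp _ (by rwa [hφξ]) hD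
  have hstrict := hfφ.hasStrictFDerivAt' hE one_ne_zero
  have hfy : (f ∘ φ) (ξ y) = f y := congrArg f hφξ
  set g := hfφ.localInverse hE one_ne_zero
  have hg : ContDiffAt ℝ 1 g (f y) := hfy ▸ hfφ.to_localInverse hE one_ne_zero
  have hgy : g (f y) = ξ y := hfy ▸ hstrict.eventually_left_inverse.self_of_nhds
  have hσ : ContDiffAt ℝ 1 (φ ∘ g) (f y) := .comp _ (by rwa [hgy]) hg
  refine ⟨φ ∘ g, hσ, hσ.continuousAt, ?_, ?_, ?_⟩
  · exact hg.continuousAt.eventually (by rwa [hgy])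
  · exact hfy ▸ hstrict.eventually_right_inverse
  · filter_upwards [hξ.eventually hstrict.eventually_left_inverse, hφξY] with z hgz hz
    have hgξ : g (f (φ (ξ z))) = ξ z := hgz
    rw [Function.comp_apply, ← hz, hgξ]

end InverseFunction

/-! ### Cylindrical coordinates along `ℝᵏ × 0` -/

section Cylindrical

variable {n k : ℕ} {Y : Set (Eucl n)} {y : Eucl n}

/-- The unit vector in the direction from the orthogonal projection of `y` to `ℝᵏ × 0` to `y`; it
is `0` if `y` lies in `ℝᵏ × 0`. -/
noncomputable def normalDir (n k : ℕ) (y : Eucl n) : Eucl n :=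
  ‖normalPart n k y‖⁻¹ • normalPart n k y

theorem norm_normalDir (hy : normalPart n k y ≠ 0) : ‖normalDir n k y‖ = 1 := by
  rw [normalDir, norm_smul, norm_inv, norm_norm, inv_mul_cancel₀ (norm_ne_zero_iff.2 hy)]

theorem norm_normalDir_le (y : Eucl n) : ‖normalDir n k y‖ ≤ 1 := by
  rw [normalDir, norm_smul, norm_inv, norm_norm]
  exact inv_mul_le_one

theorem normalDir_mem_orthogonal (y : Eucl n) : normalDir n k y ∈ (flat n k)ᗮ :=
  Submodule.smul_mem _ _ (normalPart_mem_orthogonal y)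

/-- Cylindrical coordinates: the projection to `ℝᵏ × 0` and the distance to it. -/
noncomputable def cylCoord (n k : ℕ) (y : Eucl n) : flat n k × ℝ :=
  ((flat n k).orthogonalProjectionOnto y, ‖normalPart n k y‖)

theorem continuous_cylCoord : Continuous (cylCoord n k) :=
  (flat n k).orthogonalProjectionOnto.continuous.prodMk (normalPart n k).continuous.norm

theorem cylCoord_of_mem_flat (hy : y ∈ flat n k) : cylCoord n k y = (⟨y, hy⟩, 0) := by
  rw [cylCoord, normalPart_eq_zero_iff.2 hy, norm_zero]
  exact congrArg (·, 0) (Subtype.ext (Submodule.starProjection_eq_self_iff.2 hy))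

theorem norm_le_cylCoord (y : Eucl n) : ‖y‖ ≤ ‖(cylCoord n k y).1‖ + (cylCoord n k y).2 := by
  conv_lhs => rw [← starProjection_add_normalPart (d := k) y]
  exact norm_add_le _ _

theorem contDiffAt_cylCoord (hy : normalPart n k y ≠ 0) : ContDiffAt ℝ 1 (cylCoord n k) y :=
  (flat n k).orthogonalProjectionOnto.contDiff.contDiffAt.prodMk
    ((normalPart n k).contDiff.contDiffAt.norm ℝ hy)

theorem hasFDerivAt_cylCoord (hy : normalPart n k y ≠ 0) :
    HasFDerivAt (cylCoord n k)
      ((flat n k).orthogonalProjectionOnto.prod (innerSL ℝ (normalDir n k y))) y := by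
  have hne : ‖normalPart n k y‖ ≠ 0 := norm_ne_zero_iff.2 hy
  have hsqrt := (normalPart n k).hasFDerivAt (x := y).norm_sq.sqrt (pow_ne_zero 2 hne)
  simp only [Real.sqrt_sq (norm_nonneg _)] at hsqrt
  refine ((flat n k).orthogonalProjectionOnto.hasFDerivAt.prodMk hsqrt).congr_fderiv ?_
  ext v
  · rfl
  · simp only [ContinuousLinearMap.prod_apply, _root_.smul_apply, smul_eq_mul,
      ContinuousLinearMap.comp_apply, innerSL_apply_apply, normalDir, real_inner_smul_left,
      inner_normalPart_left, nsmul_eq_mul, Nat.cast_ofNat]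
    field_simp

/-- `T` makes a small angle with `ℝᵏ × 0` and with the direction from `ℝᵏ × 0` to `y`. The
constant `1 / 8` is small enough for `CloseTangent.norm_le`. -/
def CloseTangent (k : ℕ) (T : Submodule ℝ (Eucl n)) (y : Eucl n) : Prop :=
  (∀ e ∈ flat n k, ∃ v ∈ T, ‖v - e‖ ≤ 1 / 8 * ‖e‖) ∧
    ∃ v ∈ T, ‖normalPart n k y - v‖ ≤ 1 / 8 * ‖normalPart n k y‖

theorem norm_normalDir_sub_smul_le {v : Eucl n} {η : ℝ} (hy : normalPart n k y ≠ 0)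
    (hv : ‖normalPart n k y - v‖ ≤ η * ‖normalPart n k y‖) :
    ‖normalDir n k y - ‖normalPart n k y‖⁻¹ • v‖ ≤ η := by
  rwa [normalDir, ← smul_sub, norm_smul, norm_inv, norm_norm,
    inv_mul_le_iff₀ (norm_pos_iff.2 hy), mul_comm]

theorem CloseTangent.norm_le {T : Submodule ℝ (Eucl n)} (h : CloseTangent k T y)
    (hy : normalPart n k y ≠ 0) (hk : k ≤ n) (hdim : Module.finrank ℝ T = k + 1) {v : Eucl n}
    (hv : v ∈ T) {m : ℝ} (hproj : ‖(flat n k).starProjection v‖ ≤ m)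
    (hinner : |inner ℝ (normalDir n k y) v| ≤ m) : ‖v‖ ≤ 4 * m := by
  obtain ⟨w, hw, hyw⟩ := h.2
  refine norm_le_four_mul_of_close (norm_normalDir hy) (normalDir_mem_orthogonal y)
    (by rw [hdim, finrank_flat hk]) h.1
    ⟨‖normalPart n k y‖⁻¹ • w, T.smul_mem _ hw, ?_⟩ hv hproj hinner
  rw [norm_sub_rev]
  exact norm_normalDir_sub_smul_le hy hyw

theorem exists_isLocalSectionAt_cylCoord (hY : IsCpSubmanifold 1 (k + 1) Y) (hy : y ∈ Y)
    (hy0 : normalPart n k y ≠ 0) (hclose : CloseTangent k (tangentSpaceOf Y y) y) :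
    ∃ σ, ContDiffAt ℝ 1 σ (cylCoord n k y) ∧ IsLocalSectionAt (cylCoord n k) Y y σ := by
  have hk : k ≤ n := Nat.le_of_succ_le hY.1
  refine hY.exists_contDiffAt_isLocalSectionAt ?_ hy (contDiffAt_cylCoord hy0)
    (hasFDerivAt_cylCoord hy0) fun v hv hv0 => ?_
  · rw [Module.finrank_prod, finrank_flat hk, Module.finrank_self]
  · obtain ⟨hproj, hinner⟩ := Prod.mk_eq_zero.1 hv0
    have hproj : (flat n k).starProjection v = 0 := congrArg Subtype.val hproj
    have hinner : inner ℝ (normalDir n k y) v = (0 : ℝ) := hinner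
    simpa using hclose.norm_le hy0 hk (finrank_tangentSpaceOf hY hy) hv (m := 0)
      (by rw [hproj, norm_zero]) (by rw [hinner, abs_zero])

/-- The image in cylindrical coordinates of the complement of `ℝᵏ × 0` in a neighbourhood of the
origin. -/
def cylBox (n k : ℕ) (a b : ℝ) : Set (flat n k × ℝ) := {p | ‖p.1‖ < a ∧ 0 < p.2 ∧ p.2 < b}

theorem cylBox_eq (a b : ℝ) : cylBox n k a b = Metric.ball 0 a ×ˢ Ioo 0 b := by
  ext p
  simp [cylBox]

theorem isOpen_cylBox (a b : ℝ) : IsOpen (cylBox n k a b) := by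
  rw [cylBox_eq]
  exact Metric.isOpen_ball.prod isOpen_Ioo

theorem convex_cylBox (a b : ℝ) : Convex ℝ (cylBox n k a b) := by
  rw [cylBox_eq]
  exact (convex_ball 0 a).prod (convex_Ioo 0 b)

theorem cylBox_mono {a b a' b' : ℝ} (ha : a' ≤ a) (hb : b' ≤ b) :
    cylBox n k a' b' ⊆ cylBox n k a b := fun _ hp =>
  ⟨hp.1.trans_le ha, hp.2.1, hp.2.2.trans_le hb⟩

theorem zero_mem_cylBox_iff {a b ρ : ℝ} (ha : 0 < a) :
    ((0, ρ) : flat n k × ℝ) ∈ cylBox n k a b ↔ 0 < ρ ∧ ρ < b := by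
  simp [cylBox, ha]

theorem norm_lt_of_cylCoord_mem {a b : ℝ} (hy : cylCoord n k y ∈ cylBox n k a b) : ‖y‖ < a + b :=
  (norm_le_cylCoord y).trans_lt (add_lt_add hy.1 hy.2.2)

theorem cylCoord_mem_cylBox {a : ℝ} (hy : normalPart n k y ≠ 0) (hya : ‖y‖ < a) :
    cylCoord n k y ∈ cylBox n k a a :=
  ⟨(Submodule.norm_starProjection_apply_le _ _).trans_lt hya, norm_pos_iff.2 hy,
    (norm_normalPart_le y).trans_lt hya⟩

/-- The germ of `Y` at `x` is connected: `x` has arbitrarily small neighbourhoods in `Y` which are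
preconnected. The point `x` need not belong to `Y`. -/
def IsPreconnectedNear (Y : Set (Eucl n)) (x : Eucl n) : Prop :=
  ∀ U ∈ 𝓝 x, ∃ C ∈ 𝓝[Y] x, C ⊆ Y ∩ U ∧ IsPreconnected C

/-- `Ψ` parametrizes `Y` near the origin by cylindrical coordinates in the box of width `a` and
height `b`. -/
structure IsCylParam (k : ℕ) (Y : Set (Eucl n)) (a b : ℝ) (Ψ : flat n k × ℝ → Eucl n) : Prop where
  pos_left : 0 < a
  pos_right : 0 < b
  contDiffAt : ∀ p ∈ cylBox n k a b, ContDiffAt ℝ 1 Ψ p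
  mem : ∀ p ∈ cylBox n k a b, Ψ p ∈ Y
  coord : ∀ p ∈ cylBox n k a b, cylCoord n k (Ψ p) = p
  close : ∀ p ∈ cylBox n k a b, CloseTangent k (tangentSpaceOf Y (Ψ p)) (Ψ p)
  eq_of_mem : ∀ y ∈ Y, cylCoord n k y ∈ cylBox n k a b → Ψ (cylCoord n k y) = y

theorem isProperMap_restrictOver_cylBox {a R : ℝ} (haR : a + a ≤ R)
    (hcl : IsClosed ((Y ∪ flat n k) ∩ Metric.closedBall 0 R)) :
    IsProperMap (restrictOver (cylCoord n k) Y (cylBox n k a a)) := by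
  have : LocallyCompactSpace (cylBox n k a a) := (isOpen_cylBox a a).locallyCompactSpace
  refine isProperMap_restrictOver continuous_cylCoord
    ((isCompact_closedBall 0 R).of_isClosed_subset hcl inter_subset_right) ?_
  ext y
  refine ⟨fun ⟨⟨hy, _⟩, hbox⟩ => ⟨hy.resolve_right fun hyK => ?_, hbox⟩, fun ⟨hy, hbox⟩ =>
    ⟨⟨Or.inl hy, mem_closedBall_zero_iff.2 ((norm_lt_of_cylCoord_mem hbox).le.trans haR)⟩, hbox⟩⟩
  rw [mem_preimage, cylCoord_of_mem_flat hyK] at hbox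
  exact lt_irrefl _ hbox.2.1

theorem isHomeomorph_restrictOver_cylBox (hYK : ∀ y ∈ Y, y ∉ flat n k) {a : ℝ} (ha : 0 < a)
    (hconn : IsPreconnectedNear Y 0) (h0 : (0 : Eucl n) ∈ closure Y)
    (hq : IsLocalHomeomorph (restrictOver (cylCoord n k) Y (cylBox n k a a)))
    (hp : IsProperMap (restrictOver (cylCoord n k) Y (cylBox n k a a))) :
    IsHomeomorph (restrictOver (cylCoord n k) Y (cylBox n k a a)) := by
  have hbox : ∀ y ∈ Y, ‖y‖ < a → cylCoord n k y ∈ cylBox n k a a := fun y hy hya =>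
    cylCoord_mem_cylBox (fun h => hYK y hy (normalPart_eq_zero_iff.1 h)) hya
  have : LocallyPathConnectedSpace (cylBox n k a a) :=
    (isOpen_cylBox a a).locallyPathConnectedSpace
  have : ContractibleSpace (cylBox n k a a) := (convex_cylBox a a).contractibleSpace
    ⟨(0, a / 2), (zero_mem_cylBox_iff ha).2 ⟨half_pos ha, half_lt_self ha⟩⟩
  obtain ⟨y₀, hy₀a, hy₀⟩ := mem_closure_iff_nhds.1 h0 _ (Metric.ball_mem_nhds 0 ha)
  have : Nonempty ↥(Y ∩ cylCoord n k ⁻¹' cylBox n k a a) :=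
    ⟨⟨y₀, hy₀, hbox y₀ hy₀ (mem_ball_zero_iff.1 hy₀a)⟩⟩
  obtain ⟨C, hC, hCY, hCconn⟩ := hconn _ (Metric.ball_mem_nhds 0 ha)
  have hCbox : C ⊆ Y ∩ cylCoord n k ⁻¹' cylBox n k a a := fun y hy =>
    ⟨(hCY hy).1, hbox y (hCY hy).1 (mem_ball_zero_iff.1 (hCY hy).2)⟩
  obtain ⟨ε, hε, hεC⟩ := Metric.mem_nhdsWithin_iff.1 hC
  -- All points of `Y` over this base point lie in the ball of radius `ε`, hence in `C`.
  have hρ : 0 < min a ε / 2 := half_pos (lt_min ha hε)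
  have hρlt : min a ε / 2 < min a ε := half_lt_self (lt_min ha hε)
  refine isHomeomorph_of_isProperMap_of_fiber_subset hq hp (C := Subtype.val ⁻¹' C)
    (w₀ := ⟨(0, min a ε / 2), (zero_mem_cylBox_iff ha).2 ⟨hρ, hρlt.trans_le (min_le_left _ _)⟩⟩)
    ?_ fun v hv => hεC ⟨mem_ball_zero_iff.2 ?_, v.2.1⟩
  · rwa [← Topology.IsInducing.subtypeVal.isPreconnected_image, Subtype.image_preimage_coe,
      inter_eq_right.2 hCbox]
  · have hvρ : cylCoord n k v = (0, min a ε / 2) := congrArg Subtype.val hv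
    calc ‖(v : Eucl n)‖ ≤ ‖(cylCoord n k v).1‖ + (cylCoord n k v).2 := norm_le_cylCoord _
      _ = min a ε / 2 := by rw [hvρ, norm_zero, zero_add]
      _ < ε := hρlt.trans_le (min_le_right _ _)

theorem exists_isCylParam (hY : IsCpSubmanifold 1 (k + 1) Y) (hYK : ∀ y ∈ Y, y ∉ flat n k) {R : ℝ}
    (hR : 0 < R) (hcl : IsClosed ((Y ∪ flat n k) ∩ Metric.closedBall 0 R))
    (hclose : ∀ᶠ y in 𝓝[Y] 0, CloseTangent k (tangentSpaceOf Y y) y)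
    (hconn : IsPreconnectedNear Y 0) (h0 : (0 : Eucl n) ∈ closure Y) :
    ∃ a b Ψ, IsCylParam k Y a b Ψ := by
  obtain ⟨S, hS, hScl⟩ := Metric.mem_nhdsWithin_iff.1 hclose
  have ha : 0 < min R S / 2 := half_pos (lt_min hR hS)
  set a := min R S / 2
  have haR : a + a ≤ R := (add_halves _).trans_le (min_le_left R S)
  have haS : a + a ≤ S := (add_halves _).trans_le (min_le_right R S)
  have hbox : ∀ y ∈ Y, cylCoord n k y ∈ cylBox n k a a →
      CloseTangent k (tangentSpaceOf Y y) y := fun y hy hyW =>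
    hScl ⟨mem_ball_zero_iff.2 ((norm_lt_of_cylCoord_mem hyW).trans_le haS), hy⟩
  have hsec : ∀ y ∈ Y, cylCoord n k y ∈ cylBox n k a a →
      ∃ σ, ContDiffAt ℝ 1 σ (cylCoord n k y) ∧ IsLocalSectionAt (cylCoord n k) Y y σ :=
    fun y hy hyW => exists_isLocalSectionAt_cylCoord hY hy
      (fun h => hYK y hy (normalPart_eq_zero_iff.1 h)) (hbox y hy hyW)
  have hq : IsHomeomorph (restrictOver (cylCoord n k) Y (cylBox n k a a)) :=
    isHomeomorph_restrictOver_cylBox hYK ha hconn h0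
      (isLocalHomeomorph_restrictOver continuous_cylCoord fun y hy hyW =>
        (hsec y hy hyW).imp fun _ hσ => hσ.2)
      (isProperMap_restrictOver_cylBox haR hcl)
  obtain ⟨Ψ, hΨ, hΨY⟩ := exists_contDiffAt_section_of_isHomeomorph (isOpen_cylBox a a) hq hsec
  exact ⟨a, a, Ψ, ha, ha, fun p hp => (hΨ p hp).1, fun p hp => (hΨ p hp).2.1,
    fun p hp => (hΨ p hp).2.2,
    fun p hp => hbox _ (hΨ p hp).2.1 ((hΨ p hp).2.2.symm ▸ hp), hΨY⟩

namespace IsCylParam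

variable {a b a' b' : ℝ} {Ψ : flat n k × ℝ → Eucl n} {p : flat n k × ℝ}

theorem mono (h : IsCylParam k Y a b Ψ) (ha : 0 < a') (hb : 0 < b') (haa : a' ≤ a)
    (hbb : b' ≤ b) : IsCylParam k Y a' b' Ψ where
  pos_left := ha
  pos_right := hb
  contDiffAt p hp := h.contDiffAt p (cylBox_mono haa hbb hp)
  mem p hp := h.mem p (cylBox_mono haa hbb hp)
  coord p hp := h.coord p (cylBox_mono haa hbb hp)
  close p hp := h.close p (cylBox_mono haa hbb hp)
  eq_of_mem y hy hp := h.eq_of_mem y hy (cylBox_mono haa hbb hp)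

theorem eq_iff (h : IsCylParam k Y a b Ψ) (hp : p ∈ cylBox n k a b) :
    Ψ p = y ↔ y ∈ Y ∧ cylCoord n k y = p := by
  refine ⟨fun hy => hy ▸ ⟨h.mem p hp, h.coord p hp⟩, fun ⟨hy, hyp⟩ => ?_⟩
  rw [← hyp]
  exact h.eq_of_mem y hy (hyp ▸ hp)

theorem norm_normalPart (h : IsCylParam k Y a b Ψ) (hp : p ∈ cylBox n k a b) :
    ‖normalPart n k (Ψ p)‖ = p.2 := congrArg Prod.snd (h.coord p hp)

theorem starProjection_eq (h : IsCylParam k Y a b Ψ) (hp : p ∈ cylBox n k a b) :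
    (flat n k).starProjection (Ψ p) = p.1 :=
  congrArg (fun q : flat n k × ℝ => (q.1 : Eucl n)) (h.coord p hp)

theorem normalPart_eq (h : IsCylParam k Y a b Ψ) (hp : p ∈ cylBox n k a b) :
    normalPart n k (Ψ p) = Ψ p - p.1 := by rw [normalPart_apply, h.starProjection_eq hp]

theorem normalPart_ne_zero (h : IsCylParam k Y a b Ψ) (hp : p ∈ cylBox n k a b) :
    normalPart n k (Ψ p) ≠ 0 := by
  rw [← norm_pos_iff, h.norm_normalPart hp]
  exact hp.2.1

theorem normalDir_eq (h : IsCylParam k Y a b Ψ) (hp : p ∈ cylBox n k a b) :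
    normalDir n k (Ψ p) = p.2⁻¹ • (Ψ p - p.1) := by
  rw [normalDir, h.norm_normalPart hp, h.normalPart_eq hp]

theorem eventually_mem_cylBox (hp : p ∈ cylBox n k a b) : ∀ᶠ q in 𝓝 p, q ∈ cylBox n k a b :=
  (isOpen_cylBox a b).mem_nhds hp

theorem hasFDerivAt (h : IsCylParam k Y a b Ψ) (hp : p ∈ cylBox n k a b) :
    HasFDerivAt Ψ (fderiv ℝ Ψ p) p :=
  ((h.contDiffAt p hp).differentiableAt one_ne_zero).hasFDerivAt

theorem fderiv_mem_tangentSpaceOf (h : IsCylParam k Y a b Ψ) (hp : p ∈ cylBox n k a b)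
    (u : flat n k × ℝ) : fderiv ℝ Ψ p u ∈ tangentSpaceOf Y (Ψ p) := by
  have hline : HasDerivAt (fun t : ℝ => p + t • u) u 0 := by
    simpa using ((hasDerivAt_id (0 : ℝ)).smul_const u).const_add p
  have hbox : ∀ᶠ t : ℝ in 𝓝 0, p + t • u ∈ cylBox n k a b :=
    hline.continuousAt.eventually_mem (by simpa using eventually_mem_cylBox hp)
  exact Submodule.subset_span ⟨fun t => Ψ (p + t • u), by simp, hbox.mono fun t ht => h.mem _ ht,
    HasFDerivAt.comp_hasDerivAt (0 : ℝ) (by simpa using h.hasFDerivAt hp) hline⟩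

theorem starProjection_fderiv_and_inner_fderiv (h : IsCylParam k Y a b Ψ) (hp : p ∈ cylBox n k a b)
    (u : flat n k × ℝ) :
    (flat n k).starProjection (fderiv ℝ Ψ p u) = u.1 ∧
      inner ℝ (normalDir n k (Ψ p)) (fderiv ℝ Ψ p u) = u.2 := by
  have hcomp := (hasFDerivAt_cylCoord (h.normalPart_ne_zero hp)).comp p (h.hasFDerivAt hp)
  have hid : HasFDerivAt (cylCoord n k ∘ Ψ) (ContinuousLinearMap.id ℝ _) p :=
    (hasFDerivAt_id p).congr_of_eventuallyEq ((eventually_mem_cylBox hp).mono h.coord)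
  have hu := DFunLike.congr_fun (hcomp.unique hid) u
  exact ⟨congrArg (fun q : flat n k × ℝ => (q.1 : Eucl n)) hu, congrArg Prod.snd hu⟩

theorem norm_fderiv_sub_le (h : IsCylParam k Y a b Ψ) (hY : IsCpSubmanifold 1 (k + 1) Y)
    (hp : p ∈ cylBox n k a b) (u : flat n k × ℝ) {v : Eucl n} (hv : v ∈ tangentSpaceOf Y (Ψ p)) :
    ‖fderiv ℝ Ψ p u - (u.1 + u.2 • normalDir n k (Ψ p))‖ ≤
      5 * ‖u.1 + u.2 • normalDir n k (Ψ p) - v‖ := by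
  set θ := normalDir n k (Ψ p)
  set w : Eucl n := u.1 + u.2 • θ
  have hθ : ‖θ‖ = 1 := norm_normalDir (h.normalPart_ne_zero hp)
  have hθK : θ ∈ (flat n k)ᗮ := normalDir_mem_orthogonal _
  obtain ⟨hproj, hinner⟩ := h.starProjection_fderiv_and_inner_fderiv hp u
  have hwproj : (flat n k).starProjection w = u.1 := by
    rw [map_add, map_smul, (Submodule.starProjection_apply_eq_zero_iff _).2 hθK, smul_zero,
      add_zero, Submodule.starProjection_eq_self_iff.2 u.1.2]
  have hwinner : inner ℝ θ w = u.2 := by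
    rw [inner_add_right, real_inner_smul_right, real_inner_self_eq_norm_sq, hθ,
      Submodule.inner_left_of_mem_orthogonal u.1.2 hθK, zero_add, one_pow, mul_one]
  have hclose : ‖fderiv ℝ Ψ p u - v‖ ≤ 4 * ‖w - v‖ := by
    refine (h.close p hp).norm_le (h.normalPart_ne_zero hp) (Nat.le_of_succ_le hY.1)
      (finrank_tangentSpaceOf hY (h.mem p hp))
      (Submodule.sub_mem _ (h.fderiv_mem_tangentSpaceOf hp u) hv) ?_ ?_
    · rw [map_sub, hproj, ← hwproj, ← map_sub]
      exact Submodule.norm_starProjection_apply_le _ _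
    · rw [inner_sub_right, hinner, ← hwinner, ← inner_sub_right, ← one_mul ‖w - v‖, ← hθ]
      exact abs_real_inner_le_norm _ _
  calc ‖fderiv ℝ Ψ p u - w‖ = ‖(fderiv ℝ Ψ p u - v) - (w - v)‖ := by rw [sub_sub_sub_cancel_right]
    _ ≤ ‖fderiv ℝ Ψ p u - v‖ + ‖w - v‖ := norm_sub_le _ _
    _ ≤ 5 * ‖w - v‖ := by linarith

end IsCylParam

end Cylindrical

/-! ### Convergence of the normal direction -/

section Direction

variable {L : FirstOrder.Language} [L.Structure ℝ] [hL : Fact (IsOMinimal L)] {n k : ℕ}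
  {Y : Set (Eucl n)} {y : Eucl n} {a b : ℝ} {Ψ : flat n k × ℝ → Eucl n}

include hL in
theorem exists_tendsto_of_defReal_of_norm_le {g : ℝ → Eucl n} (hg : ∀ i, DefReal L fun t => g t i)
    {c C : ℝ} (hC : ∀ᶠ t in 𝓝[>] c, ‖g t‖ ≤ C) : ∃ θ, Tendsto g (𝓝[>] c) (𝓝 θ) := by
  have hlim : ∀ i, ∃ l, Tendsto (fun t => g t i) (𝓝[>] c) (𝓝 l) := fun i =>
    (hg i).exists_tendsto_of_abs_le (hC.mono fun t ht => (PiLp.norm_apply_le (g t) i).trans ht)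
  choose l hl using hlim
  exact ⟨WithLp.toLp 2 l, ((PiLp.continuous_toLp 2 _).tendsto l).comp (tendsto_pi_nhds.2 hl)⟩

theorem cylCoord_eq_zero_prod_iff {ρ : ℝ} :
    cylCoord n k y = (0, ρ) ↔ ‖y - normalPart n k y‖ = 0 ∧ ‖normalPart n k y‖ = ρ := by
  have hfst : y - normalPart n k y = (cylCoord n k y).1 :=
    (eq_sub_of_add_eq (starProjection_add_normalPart (d := k) y)).symm
  rw [Prod.ext_iff, hfst, norm_eq_zero, ZeroMemClass.coe_eq_zero]
  rfl

theorem IsCylParam.defReal_normalDir (h : IsCylParam k Y a b Ψ) (hYdef : IsDefinableSet L Y)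
    (i : Fin n) :
    DefReal L fun ρ => (if 0 < ρ ∧ ρ < b then normalDir n k (Ψ (0, ρ)) else 0 : Eucl n) i := by
  have hgraph : DefPred L fun w : Fin 1 ⊕ Fin 1 → ℝ =>
      ((0 < w (.inl 0) ∧ w (.inl 0) < b) ∧ ∃ y : Eucl n, y ∈ Y ∧
        (‖y - normalPart n k y‖ = 0 ∧ ‖normalPart n k y‖ = w (.inl 0)) ∧
        ‖normalPart n k y‖⁻¹ * normalPart n k y i = w (.inr 0)) ∨
      ¬ (0 < w (.inl 0) ∧ w (.inl 0) < b) ∧ 0 = w (.inr 0) := by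
    have hρ : DefPred L fun w : Fin 1 ⊕ Fin 1 → ℝ => 0 < w (.inl 0) ∧ w (.inl 0) < b :=
      .and (.lt (.const _) (.proj _)) (.lt (.proj _) (.const _))
    refine .or (.and hρ (.exists_vec (.and (.mem hYdef (.toLp _)) (.and (.and ?_ ?_) ?_))))
      (.and hρ.not (.eq (.const _) (.proj _)))
    · exact .eq (DefVec.norm (.sub (.toLp _) (.normalPart (.toLp _)))) (.const _)
    · exact .eq (DefVec.norm (.normalPart (.toLp _))) (.proj _)
    · exact .eq (.mul (.inv (DefVec.norm (.normalPart (.toLp _))))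
        (DefVec.normalPart (.toLp _) i)) (.proj _)
  refine DefFn.of_graph (?_ : DefPred L _)
  convert! hgraph using 3 with w
  by_cases hρ : 0 < w (.inl 0) ∧ w (.inl 0) < b
  · have hp := (zero_mem_cylBox_iff (n := n) (k := k) h.pos_left).2 hρ
    simp only [hρ, and_self, if_true, true_and, not_true_eq_false, false_and, or_false,
      ← cylCoord_eq_zero_prod_iff, ← and_assoc, ← h.eq_iff hp, exists_eq_left']
    rfl
  · simp only [hρ, if_false, false_and, false_or, not_false_eq_true, true_and, PiLp.zero_apply]

theorem IsCylParam.exists_tendsto_fiber (h : IsCylParam k Y a b Ψ) (hYdef : IsDefinableSet L Y) :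
    ∃ θ : Eucl n, Tendsto (fun ρ : ℝ => normalDir n k (Ψ (0, ρ))) (𝓝[>] 0) (𝓝 θ) := by
  have heq : (fun ρ => if 0 < ρ ∧ ρ < b then normalDir n k (Ψ (0, ρ)) else 0) =ᶠ[𝓝[>] 0]
      fun ρ => normalDir n k (Ψ (0, ρ)) := by
    filter_upwards [Ioo_mem_nhdsGT h.pos_right] with ρ hρ using if_pos hρ
  obtain ⟨θ, hθ⟩ := exists_tendsto_of_defReal_of_norm_le (h.defReal_normalDir hYdef)
    (c := 0) (heq.mono fun ρ hρ => (congrArg norm hρ).trans_le (norm_normalDir_le _))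
  exact ⟨θ, hθ.congr' heq⟩

theorem contDiffAt_normalDir (hy : normalPart n k y ≠ 0) : ContDiffAt ℝ 1 (normalDir n k) y :=
  (((normalPart n k).contDiff.contDiffAt.norm ℝ hy).inv (norm_ne_zero_iff.2 hy)).smul
    (normalPart n k).contDiff.contDiffAt

theorem IsCylParam.hasDerivAt_normalDir (h : IsCylParam k Y a b Ψ) {u : flat n k} {t ρ : ℝ}
    (hp : (t • u, ρ) ∈ cylBox n k a b) :
    HasDerivAt (fun s : ℝ => normalDir n k (Ψ (s • u, ρ)))
      (ρ⁻¹ • (fderiv ℝ Ψ (t • u, ρ) (u, 0) - u)) t := by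
  have hline : HasDerivAt (fun s : ℝ => (s • u, ρ)) (u, 0) t := by
    simpa using ((hasDerivAt_id t).smul_const u).prodMk (hasDerivAt_const t ρ)
  have hbase : HasDerivAt (fun s : ℝ => s • (u : Eucl n)) u t := by
    simpa using (hasDerivAt_id t).smul_const (u : Eucl n)
  refine ((((h.hasFDerivAt hp).comp_hasDerivAt t hline).sub hbase).const_smul
    ρ⁻¹).congr_of_eventuallyEq ?_
  exact (hline.continuousAt.eventually (eventually_mem_cylBox hp)).mono fun s hs =>
    h.normalDir_eq hs

/-- The norm of the derivative is `ρ⁻¹` times the distance of `fderiv ℝ Ψ p (u, 0)` to `u`, which is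
controlled by the gap between `ℝᵏ × 0` and the tangent space, that is by `ρ * R t`. -/
theorem IsCylParam.enorm_deriv_normalDir_le (h : IsCylParam k Y a b Ψ)
    (hY : IsCpSubmanifold 1 (k + 1) Y) {R : ℝ → ℝ≥0∞}
    (hR : ∀ y ∈ Y, gapDist (flat n k) (tangentSpaceOf Y y) ≤
      R ‖(flat n k).starProjection y‖ * ENNReal.ofReal ‖normalPart n k y‖)
    {u : flat n k} (hu : ‖u‖ = 1) {t ρ : ℝ} (ht : 0 ≤ t) (hp : (t • u, ρ) ∈ cylBox n k a b) :
    ‖deriv (fun s : ℝ => normalDir n k (Ψ (s • u, ρ))) t‖ₑ ≤ 5 * R t := by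
  have hρ : 0 < ρ := hp.2.1
  set T := tangentSpaceOf Y (Ψ (t • u, ρ))
  have hder : ‖fderiv ℝ Ψ (t • u, ρ) (u, 0) - u‖ ≤ 5 * ‖(u : Eucl n) - T.starProjection u‖ := by
    simpa only [zero_smul, add_zero] using
      h.norm_fderiv_sub_le hY hp (u, 0) (T.starProjection_apply_mem (u : Eucl n))
  have hnorm : ‖((t • u : flat n k) : Eucl n)‖ = t := by
    rw [← Submodule.coe_norm, norm_smul, hu, mul_one, Real.norm_of_nonneg ht]
  have hgap : ENNReal.ofReal ‖(u : Eucl n) - T.starProjection u‖ ≤ R t * ENNReal.ofReal ρ := by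
    have hRt := hR _ (h.mem _ hp)
    rw [h.starProjection_eq hp, h.norm_normalPart hp, hnorm] at hRt
    refine (ofReal_norm_sub_starProjection_le u.2).trans ?_
    rwa [← Submodule.coe_norm, hu, ENNReal.ofReal_one, one_mul]
  rw [(h.hasDerivAt_normalDir hp).deriv, ← ofReal_norm, norm_smul, norm_inv,
    Real.norm_of_nonneg hρ.le]
  calc ENNReal.ofReal (ρ⁻¹ * ‖fderiv ℝ Ψ (t • u, ρ) (u, 0) - u‖)
      ≤ ENNReal.ofReal (ρ⁻¹ * (5 * ‖(u : Eucl n) - T.starProjection u‖)) := by gcongr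
    _ = ENNReal.ofReal (5 * ρ⁻¹) * ENNReal.ofReal ‖(u : Eucl n) - T.starProjection u‖ := by
        rw [← ENNReal.ofReal_mul (by positivity), mul_left_comm, mul_assoc]
    _ ≤ ENNReal.ofReal (5 * ρ⁻¹) * (R t * ENNReal.ofReal ρ) := by gcongr
    _ = ENNReal.ofReal (5 * ρ⁻¹ * ρ) * R t := by
        rw [ENNReal.ofReal_mul (p := 5 * ρ⁻¹) (by positivity)]
        ring
    _ = 5 * R t := by rw [inv_mul_cancel_right₀ hρ.ne', ENNReal.ofReal_ofNat]

theorem IsCylParam.enorm_normalDir_sub_le (h : IsCylParam k Y a b Ψ)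
    (hY : IsCpSubmanifold 1 (k + 1) Y) {R : ℝ → ℝ≥0∞}
    (hR : ∀ y ∈ Y, gapDist (flat n k) (tangentSpaceOf Y y) ≤
      R ‖(flat n k).starProjection y‖ * ENNReal.ofReal ‖normalPart n k y‖)
    {p : flat n k × ℝ} (hp : p ∈ cylBox n k a b) :
    ‖normalDir n k (Ψ p) - normalDir n k (Ψ (0, p.2))‖ₑ ≤ 5 * ∫⁻ t in Icc 0 ‖p.1‖, R t := by
  obtain ⟨x, ρ⟩ := p
  rcases eq_or_ne x 0 with rfl | h0
  · simp
  have hx : 0 < ‖x‖ := norm_pos_iff.2 h0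
  set u : flat n k := ‖x‖⁻¹ • x
  have hu : ‖u‖ = 1 := by rw [norm_smul, norm_inv, norm_norm, inv_mul_cancel₀ hx.ne']
  have hxu : ‖x‖ • u = x := smul_inv_smul₀ hx.ne' x
  have hbox : ∀ t ∈ Icc 0 ‖x‖, (t • u, ρ) ∈ cylBox n k a b := fun t ht => by
    refine ⟨?_, hp.2⟩
    rw [norm_smul, hu, mul_one, Real.norm_of_nonneg ht.1]
    exact ht.2.trans_lt hp.1
  have hsmooth : ContDiffOn ℝ 1 (fun t : ℝ => normalDir n k (Ψ (t • u, ρ))) (Icc 0 ‖x‖) :=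
    fun t ht => ((contDiffAt_normalDir (h.normalPart_ne_zero (hbox t ht))).comp t
      ((h.contDiffAt _ (hbox t ht)).comp t
        (contDiff_id.smul contDiff_const |>.prodMk contDiff_const).contDiffAt)).contDiffWithinAt
  have hle := enorm_sub_le_lintegral_deriv_of_contDiffOn_Icc hsmooth hx.le
  rw [hxu, zero_smul] at hle
  refine hle.trans ?_
  rw [← lintegral_const_mul' _ _ (by simp)]
  exact setLIntegral_mono' measurableSet_Icc fun t ht =>
    h.enorm_deriv_normalDir_le hY hR hu ht.1 (hbox t ht)

theorem tendsto_setLIntegral_Icc_zero {R : ℝ → ℝ≥0∞} {ε : ℝ} (hε : 0 < ε)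
    (hint : ∫⁻ t in Icc 0 ε, R t < ∞) :
    Tendsto (fun t : ℝ => ∫⁻ s in Icc 0 t, R s) (𝓝 0) (𝓝 0) := by
  have hvol : Tendsto (fun t : ℝ => volume.restrict (Icc 0 ε) (Icc 0 t)) (𝓝 0) (𝓝 0) := by
    refine tendsto_of_tendsto_of_tendsto_of_le_of_le tendsto_const_nhds
      (h := fun t => ENNReal.ofReal t) ?_ (fun _ => zero_le) fun t => ?_
    · simpa using ENNReal.continuous_ofReal.tendsto (0 : ℝ)
    · refine (Measure.restrict_apply_le _ _).trans ?_
      rw [Real.volume_Icc, sub_zero]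
  refine (tendsto_setLIntegral_zero hint.ne hvol).congr' ?_
  filter_upwards [gt_mem_nhds hε] with t ht
  rw [Measure.restrict_restrict measurableSet_Icc, inter_eq_left.2 (Icc_subset_Icc_right ht.le)]

theorem IsCylParam.exists_tendsto_normalDir (h : IsCylParam k Y a b Ψ)
    (hYdef : IsDefinableSet L Y) (hY : IsCpSubmanifold 1 (k + 1) Y)
    (hYK : ∀ y ∈ Y, y ∉ flat n k) {R : ℝ → ℝ≥0∞}
    (hR : ∀ y ∈ Y, gapDist (flat n k) (tangentSpaceOf Y y) ≤
      R ‖(flat n k).starProjection y‖ * ENNReal.ofReal ‖normalPart n k y‖)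
    {ε : ℝ} (hε : 0 < ε) (hint : ∫⁻ t in Icc 0 ε, R t < ∞) :
    ∃ θ : Eucl n, Tendsto (normalDir n k) (𝓝[Y] 0) (𝓝 θ) := by
  obtain ⟨θ, hθ⟩ := h.exists_tendsto_fiber hYdef
  have hbase : Tendsto (fun y : Eucl n => ‖(flat n k).starProjection y‖) (𝓝[Y] 0) (𝓝 0) :=
    (Continuous.tendsto' (by fun_prop) _ _ (by simp)).mono_left nhdsWithin_le_nhds
  have hheight : Tendsto (fun y : Eucl n => ‖normalPart n k y‖) (𝓝[Y] 0) (𝓝[>] 0) := by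
    refine tendsto_nhdsWithin_iff.2
      ⟨(Continuous.tendsto' (by fun_prop) _ _ (by simp)).mono_left nhdsWithin_le_nhds, ?_⟩
    filter_upwards [self_mem_nhdsWithin] with y hy
    exact norm_pos_iff.2 fun h => hYK y hy (normalPart_eq_zero_iff.1 h)
  have hfib := hθ.comp hheight
  refine ⟨θ, ?_⟩
  rw [tendsto_iff_edist_tendsto_0] at hfib ⊢
  have hsum : Tendsto (fun y : Eucl n => 5 * (∫⁻ s in Icc 0 ‖(flat n k).starProjection y‖, R s) +
      edist (normalDir n k (Ψ (0, ‖normalPart n k y‖))) θ) (𝓝[Y] 0) (𝓝 0) := by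
    simpa only [mul_zero, add_zero, Function.comp_def] using (ENNReal.Tendsto.const_mul (a := 5)
      ((tendsto_setLIntegral_Icc_zero hε hint).comp hbase) (Or.inr (by simp))).add hfib
  refine tendsto_of_tendsto_of_tendsto_of_le_of_le' tendsto_const_nhds hsum
    (.of_forall fun _ => zero_le) ?_
  filter_upwards [self_mem_nhdsWithin, hbase.eventually (gt_mem_nhds h.pos_left),
    (hheight.mono_right nhdsWithin_le_nhds).eventually (gt_mem_nhds h.pos_right),
    hheight.eventually self_mem_nhdsWithin] with y hy hya hyb hy0
  have hp : cylCoord n k y ∈ cylBox n k a b := ⟨hya, hy0, hyb⟩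
  have hle := h.enorm_normalDir_sub_le hY hR hp
  rw [h.eq_of_mem y hy hp] at hle
  refine (edist_triangle _ (normalDir n k (Ψ (0, ‖normalPart n k y‖))) _).trans
    (add_le_add_left ?_ _)
  rwa [edist_eq_enorm_sub]

end Direction

/-! ### Behaviour of tangent spaces and normal directions under coordinate changes -/

section Transfer

variable {n k : ℕ}

theorem gapDist_mono {E E' : Submodule ℝ (Eucl n)} (h : E ≤ E') (T : Submodule ℝ (Eucl n)) :
    gapDist E T ≤ gapDist E' T :=
  iSup_mono fun _ => iSup_mono' fun hu => ⟨h hu, le_rfl⟩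

theorem tendsto_gapDist_iff {ι : Type*} {l : Filter ι} {W : Submodule ℝ (Eucl n)}
    {T : ι → Submodule ℝ (Eucl n)} :
    Tendsto (fun i => gapDist W (T i)) l (𝓝 0) ↔
      ∀ η > 0, ∀ᶠ i in l, ∀ w ∈ W, ∃ v ∈ T i, ‖w - v‖ ≤ η * ‖w‖ := by
  rw [ENNReal.tendsto_nhds_zero]
  constructor
  · intro h η hη
    filter_upwards [h (ENNReal.ofReal η) (by simpa using hη)] with i hi w hw
    refine ⟨_, (T i).starProjection_apply_mem w, ?_⟩
    rw [← ENNReal.ofReal_le_ofReal_iff (by positivity), mul_comm,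
      ENNReal.ofReal_mul (norm_nonneg w)]
    exact (ofReal_norm_sub_starProjection_le hw).trans (by gcongr)
  · intro h ε hε
    have hm : min ε 1 ≠ ∞ := (min_le_right ε 1).trans_lt ENNReal.one_lt_top |>.ne
    have hη : 0 < (min ε 1).toReal := ENNReal.toReal_pos (lt_min hε one_pos).ne' hm
    filter_upwards [h _ hη] with i hi
    refine iSup_le fun u => iSup_le fun hu => iSup_le fun hu1 => ?_
    obtain ⟨v, hv, hv'⟩ := hi u hu
    refine (Metric.infEDist_le_edist_of_mem hv).trans ?_
    rw [edist_dist, dist_eq_norm]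
    rw [hu1, mul_one] at hv'
    refine (ENNReal.ofReal_le_ofReal hv').trans ?_
    rw [ENNReal.ofReal_toReal hm]
    exact min_le_left _ _

theorem exists_forall_norm_sub_le_of_norm_sub_lt {E F : Type*} [NormedAddCommGroup E]
    [NormedSpace ℝ E] [NormedAddCommGroup F] [NormedSpace ℝ F] (A : E ≃L[ℝ] F) {η : ℝ}
    (hη : 0 < η) :
    ∃ ε > 0, ∀ D : E →L[ℝ] F, ‖D - A‖ < ε → ∀ v w, ‖w - v‖ ≤ ε * ‖w‖ →
      ‖A w - D v‖ ≤ η * ‖A w‖ := by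
  set B := (A : E →L[ℝ] F)
  set B' := (A.symm : F →L[ℝ] E)
  set ε := min 1 (η / ((‖B‖ + 2) * (‖B'‖ + 1)))
  have hε : 0 < ε := lt_min one_pos (by positivity)
  have hεη : ε * ((‖B‖ + 2) * (‖B'‖ + 1)) ≤ η :=
    (le_div_iff₀ (by positivity)).1 (min_le_right _ _)
  refine ⟨ε, hε, fun D hD v w hvw => ?_⟩
  have hDB : ‖D‖ ≤ ‖B‖ + 1 := calc
    ‖D‖ ≤ ‖B‖ + ‖D - B‖ := norm_le_norm_add_norm_sub' _ _
    _ ≤ ‖B‖ + 1 := by gcongr; exact hD.le.trans (min_le_left _ _)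
  have hAD : ‖A w - D w‖ ≤ ε * ‖w‖ := by
    rw [norm_sub_rev]
    exact (D - B).le_of_opNorm_le hD.le w
  have hw : ‖w‖ ≤ ‖B'‖ * ‖A w‖ := by
    simpa [B'] using B'.le_opNorm (A w)
  calc ‖A w - D v‖ = ‖(A w - D w) + D (w - v)‖ := by rw [map_sub, sub_add_sub_cancel]
    _ ≤ ε * ‖w‖ + (‖B‖ + 1) * (ε * ‖w‖) :=
        (norm_add_le _ _).trans (add_le_add hAD ((D.le_of_opNorm_le hDB _).trans (by gcongr)))
    _ = ε * (‖B‖ + 2) * ‖w‖ := by ring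
    _ ≤ ε * (‖B‖ + 2) * (‖B'‖ * ‖A w‖) := by gcongr
    _ ≤ ε * (‖B‖ + 2) * ((‖B'‖ + 1) * ‖A w‖) := by gcongr; exact (lt_add_one _).le
    _ = ε * ((‖B‖ + 2) * (‖B'‖ + 1)) * ‖A w‖ := by ring
    _ ≤ η * ‖A w‖ := by gcongr

theorem tendsto_gapDist_map {φ : OpenPartialHomeomorph (Eucl n) (Eucl n)} (hφ : IsCpChart 1 φ)
    {M M' : Set (Eucl n)} (hM : φ.IsImage M M') {x : Eucl n} (hx : x ∈ φ.source)
    {A : Eucl n ≃L[ℝ] Eucl n} (hA : HasFDerivAt φ (A : Eucl n →L[ℝ] Eucl n) x)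
    {W : Submodule ℝ (Eucl n)}
    (h : Tendsto (fun y => gapDist W (tangentSpaceOf M y)) (𝓝[M] x) (𝓝 0)) :
    Tendsto (fun y => gapDist (W.map (A : Eucl n →ₗ[ℝ] Eucl n)) (tangentSpaceOf M' y))
      (𝓝[M'] (φ x)) (𝓝 0) := by
  rw [← hM.map_nhdsWithin_eq hx, tendsto_map'_iff]
  rw [tendsto_gapDist_iff] at h
  refine tendsto_gapDist_iff.2 fun η hη => ?_
  obtain ⟨ε, hε, hεη⟩ := exists_forall_norm_sub_le_of_norm_sub_lt A hη
  have hcont : Tendsto (fderiv ℝ φ) (𝓝 x) (𝓝 (A : Eucl n →L[ℝ] Eucl n)) :=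
    hA.fderiv ▸ (hφ.contDiffAt hx).continuousAt_fderiv one_ne_zero
  filter_upwards [h ε hε, nhdsWithin_le_nhds (hcont.eventually (Metric.ball_mem_nhds _ hε)),
    nhdsWithin_le_nhds (φ.open_source.mem_nhds hx)] with y hy hD hyφ
  rintro _ ⟨w, hw, rfl⟩
  obtain ⟨v, hv, hvw⟩ := hy w hw
  have hDy : HasFDerivAt φ (fderiv ℝ φ y) y :=
    ((hφ.contDiffAt hyφ).differentiableAt one_ne_zero).hasFDerivAt
  have hMM' : ∀ᶠ z in 𝓝[M] y, φ z ∈ M' := by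
    filter_upwards [self_mem_nhdsWithin, nhdsWithin_le_nhds (φ.open_source.mem_nhds hyφ)]
      with z hz hzφ using (hM hzφ).2 hz
  exact ⟨fderiv ℝ φ y v, map_tangentSpaceOf_le hDy hMM' ⟨v, hv, rfl⟩,
    hεη _ (mem_ball_iff_norm.1 hD) v w hvw⟩

theorem normalDir_eq_of_smul {y z : Eucl n} {c : ℝ} (hc : 0 < c)
    (h : normalPart n k y = c • normalPart n k z) : normalDir n k y = normalDir n k z := by
  rw [normalDir, h, norm_smul, Real.norm_of_nonneg hc.le, smul_smul, normalDir, mul_inv, mul_assoc,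
    mul_comm ‖normalPart n k z‖⁻¹ c, inv_mul_cancel_left₀ hc.ne']

theorem tendsto_normalDir_map {φ : OpenPartialHomeomorph (Eucl n) (Eucl n)}
    (hK : φ.IsImage (flat n k) (flat n k))
    {M M' : Set (Eucl n)} (hM : φ.IsImage M M') (hMK : ∀ y ∈ M, y ∉ flat n k) {x : Eucl n}
    (hx : x ∈ φ.source) (hxK : x ∈ flat n k) {A : Eucl n →L[ℝ] Eucl n}
    (hA : HasStrictFDerivAt φ A x) {θ : Eucl n} (hAθ : normalPart n k (A θ) ≠ 0)
    (hθ : Tendsto (normalDir n k) (𝓝[M] x) (𝓝 θ)) :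
    Tendsto (normalDir n k) (𝓝[M'] (φ x)) (𝓝 (normalDir n k (A θ))) := by
  rw [← hM.map_nhdsWithin_eq hx, tendsto_map'_iff]
  set π := (flat n k).starProjection
  have hπx : π x = x := Submodule.starProjection_eq_self_iff.2 hxK
  have hπ : Tendsto π (𝓝[M] x) (𝓝 x) :=
    (π.continuous.tendsto' x x hπx).mono_left nhdsWithin_le_nhds
  have hpair : Tendsto (fun y => (y, π y)) (𝓝[M] x) (𝓝 (x, x)) :=
    (tendsto_id.mono_left nhdsWithin_le_nhds).prodMk_nhds hπ
  -- Strict differentiability along the pairs `(y, π y)`, divided by `‖y - π y‖`.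
  have hstrict := (hA.isLittleO.comp_tendsto hpair).norm_right.tendsto_inv_smul_nhds_zero
  have hsum := ((A.continuous.tendsto θ).comp hθ).add hstrict
  rw [add_zero] at hsum
  have hlim := (contDiffAt_normalDir hAθ).continuousAt.tendsto.comp hsum
  refine hlim.congr' ?_
  filter_upwards [self_mem_nhdsWithin, hπ.eventually_mem (φ.open_source.mem_nhds hx)] with y hy hπy
  have hpos : 0 < ‖normalPart n k y‖ :=
    norm_pos_iff.2 fun h => hMK y hy (normalPart_eq_zero_iff.1 h)
  refine normalDir_eq_of_smul (inv_pos.2 hpos) ?_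
  have hφπ : normalPart n k (φ (π y)) = 0 :=
    normalPart_eq_zero_iff.2 ((hK hπy).2 (Submodule.starProjection_apply_mem _ _))
  simp only [Function.comp_apply, π, ← normalPart_apply, normalDir, map_smul]
  rw [← smul_add, add_sub_cancel, map_smul, map_sub, hφπ, sub_zero]

/-- Near `x ∈ ℝᵏ × 0` the set `Y` approaches the half-space spanned by `ℝᵏ × 0` and `θ`, together
with its tangent spaces. -/
structure HasTangentHalfSpace (k : ℕ) (Y : Set (Eucl n)) (x θ : Eucl n) : Prop where
  norm_eq : ‖θ‖ = 1
  orth : θ ∈ (flat n k)ᗮ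
  dir : Tendsto (normalDir n k) (𝓝[Y] x) (𝓝 θ)
  tangent : Tendsto (fun y => gapDist (flat n k ⊔ Submodule.span ℝ {θ}) (tangentSpaceOf Y y))
    (𝓝[Y] x) (𝓝 0)

theorem HasTangentHalfSpace.notMem {Y : Set (Eucl n)} {x θ : Eucl n}
    (h : HasTangentHalfSpace k Y x θ) : θ ∉ flat n k := fun hθ => by
  have hinner := Submodule.inner_left_of_mem_orthogonal hθ h.orth
  rw [real_inner_self_eq_norm_sq, h.norm_eq, one_pow] at hinner
  exact one_ne_zero hinner

theorem HasTangentHalfSpace.map {φ : OpenPartialHomeomorph (Eucl n) (Eucl n)} (hφ : IsCpChart 1 φ)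
    (hK : φ.IsImage (flat n k) (flat n k)) {M M' : Set (Eucl n)} (hM : φ.IsImage M M')
    (hMK : ∀ y ∈ M, y ∉ flat n k) {x θ : Eucl n} (hx : x ∈ φ.source) (hxK : x ∈ flat n k)
    (h : HasTangentHalfSpace k M x θ) : ∃ θ', HasTangentHalfSpace k M' (φ x) θ' := by
  obtain ⟨A, hA, hA'⟩ := hφ.exists_hasStrictFDerivAt_equiv hx
  have hAK : ∀ v, v ∈ flat n k ↔ A v ∈ flat n k := fun v => by
    simpa only [tangentSpaceOf_submodule _ hxK, tangentSpaceOf_submodule _ ((hK hx).2 hxK)] using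
      tangentSpaceOf_isImage hK hx hA.hasFDerivAt hA'.hasFDerivAt (v := v)
  have hAθ : normalPart n k (A θ) ≠ 0 := fun h0 =>
    h.notMem ((hAK θ).2 (normalPart_eq_zero_iff.1 h0))
  refine ⟨normalDir n k (A θ), norm_normalDir hAθ, normalDir_mem_orthogonal _,
    tendsto_normalDir_map hK hM hMK hx hxK hA hAθ h.dir, ?_⟩
  refine tendsto_of_tendsto_of_tendsto_of_le_of_le tendsto_const_nhds
    (tendsto_gapDist_map hφ hM hx hA.hasFDerivAt h.tangent) (fun _ => zero_le)
    fun y => gapDist_mono ?_ _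
  have hle : flat n k ≤ (flat n k ⊔ Submodule.span ℝ {θ}).map (A : Eucl n →ₗ[ℝ] Eucl n) :=
    fun e he => ⟨A.symm e, Submodule.mem_sup_left ((hAK _).2 (by simpa using he)), by simp⟩
  refine sup_le hle ((Submodule.span_singleton_le_iff_mem _ _).2 ?_)
  rw [normalDir, normalPart_apply]
  exact Submodule.smul_mem _ _ (Submodule.sub_mem _
    ⟨θ, Submodule.mem_sup_right (Submodule.mem_span_singleton_self θ), rfl⟩
    (hle (Submodule.starProjection_apply_mem _ _)))

end Transfer

/-! ### The pair of strata in adapted coordinates -/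

section IsImage

variable {α β γ : Type*} [TopologicalSpace α] [TopologicalSpace β] [TopologicalSpace γ]

theorem isImage_trans {φ : OpenPartialHomeomorph α β} {ψ : OpenPartialHomeomorph β γ} {s : Set α}
    {t : Set β} {u : Set γ} (h : φ.IsImage s t) (h' : ψ.IsImage t u) :
    (φ.trans ψ).IsImage s u := fun x hx => by
  rw [φ.trans_source] at hx
  exact (h' hx.2).trans (h hx.1)

theorem isImage_image_source_inter (φ : OpenPartialHomeomorph α β) (s : Set α) :
    φ.IsImage s (φ '' (φ.source ∩ s)) := fun x hx =>
  ⟨fun ⟨_, hy, hyx⟩ => φ.injOn hy.1 hx hyx ▸ hy.2, fun h => ⟨x, ⟨hx, h⟩, rfl⟩⟩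

theorem exists_isClosed_inter_closedBall_of_isImage {β : Type*} [PseudoMetricSpace β]
    {φ : OpenPartialHomeomorph α β} {s : Set α} {t : Set β} (h : φ.IsImage s t)
    (hs : IsLocallyClosed s) {x : α} (hxs : x ∈ s) (hx : x ∈ φ.source) :
    ∃ R > 0, IsClosed (t ∩ Metric.closedBall (φ x) R) := by
  obtain ⟨U, Z, hU, hZ, rfl⟩ := hs
  have hO : φ.target ∩ φ.symm ⁻¹' U ∈ 𝓝 (φ x) :=
    (φ.symm.isOpen_inter_preimage hU).mem_nhds ⟨φ.map_source hx, by simpa [hx] using hxs.1⟩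
  obtain ⟨R, hR, hRO⟩ := Metric.nhds_basis_closedBall.mem_iff.1 hO
  refine ⟨R, hR, ?_⟩
  have hinter : t ∩ Metric.closedBall (φ x) R = Metric.closedBall (φ x) R ∩ φ.symm ⁻¹' Z := by
    ext w
    rw [inter_comm, mem_inter_iff, mem_inter_iff]
    refine and_congr_right fun hw => ?_
    rw [← h.symm_apply_mem_iff (hRO hw).1]
    exact and_iff_right (hRO hw).2
  rw [hinter]
  exact (φ.continuousOn_symm.mono fun w hw => (hRO hw).1).preimage_isClosed_of_isClosed
    Metric.isClosed_closedBall hZ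

end IsImage

section AdaptedCoordinates

variable {L : FirstOrder.Language} [L.Structure ℝ] {n k : ℕ} {X Y Y' : Set (Eucl n)}
  {φ : OpenPartialHomeomorph (Eucl n) (Eucl n)} {x θ : Eucl n}

theorem IsCpSubmanifold.image {p d : ℕ} (hY : IsCpSubmanifold p d Y) (hφ : IsCpChart p φ) :
    IsCpSubmanifold p d (φ '' (φ.source ∩ Y)) := by
  refine ⟨hY.1, ?_⟩
  rintro _ ⟨y, ⟨hyφ, hyY⟩, rfl⟩
  obtain ⟨ψ, hyψ, hψ, hYψ⟩ := hY.2 y hyY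
  exact ⟨φ.symm.trans ψ, by simpa [hyφ] using hyψ, hφ.symm.trans hψ,
    isImage_trans (isImage_image_source_inter φ Y).symm hYψ⟩

theorem IsDefinableSet.image (hY : IsDefinableSet L Y) (hφ : IsDefinableChart L φ) :
    IsDefinableSet L (φ '' (φ.source ∩ Y)) := by
  have hgraph : DefPred L fun v : Fin n ⊕ Fin n → ℝ =>
      WithLp.toLp 2 (fun i => v (.inr i)) ∈ φ.source ∧
        φ (WithLp.toLp 2 fun i => v (.inr i)) = WithLp.toLp 2 fun i => v (.inl i) :=
    DefPred.reindex hφ Sum.swap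
  have hmem : DefPred L fun v : Fin n ⊕ Fin n → ℝ => WithLp.toLp 2 (fun i => v (.inr i)) ∈ Y :=
    DefPred.reindex (P := fun v : Fin n → ℝ => WithLp.toLp 2 v ∈ Y) hY Sum.inr
  have himage := DefPred.exists_vec (P := fun (v : Fin n → ℝ) u =>
    (u ∈ φ.source ∧ φ u = WithLp.toLp 2 v) ∧ u ∈ Y) (hgraph.and hmem)
  rw [DefPred] at himage
  rw [IsDefinableSet]
  convert! himage using 3 with v
  exact exists_congr fun u => and_right_comm

theorem gapDist_le_ratioFun_mul (hYK : ∀ y ∈ Y, y ∉ flat n k) {y : Eucl n} (hy : y ∈ Y) :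
    gapDist (flat n k) (tangentSpaceOf Y y) ≤
      ratioFun k Y ‖(flat n k).starProjection y‖ * ENNReal.ofReal ‖normalPart n k y‖ := by
  have hpos : 0 < ‖normalPart n k y‖ :=
    norm_pos_iff.2 fun h => hYK y hy (normalPart_eq_zero_iff.1 h)
  refine (ENNReal.div_le_iff (by simpa using hpos.ne') ENNReal.ofReal_ne_top).1 ?_
  rw [normalPart_apply, ← dist_eq_norm, ← edist_dist]
  exact le_iSup_of_le y (le_iSup_of_le hy (le_iSup_of_le rfl le_rfl))

theorem norm_eq_one_of_tendsto_normalDir (hx : x ∈ closure Y) (hYK : ∀ y ∈ Y, y ∉ flat n k)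
    (hdir : Tendsto (normalDir n k) (𝓝[Y] x) (𝓝 θ)) : ‖θ‖ = 1 := by
  have : (𝓝[Y] x).NeBot := mem_closure_iff_nhdsWithin_neBot.1 hx
  refine tendsto_nhds_unique hdir.norm (tendsto_const_nhds.congr' ?_)
  filter_upwards [self_mem_nhdsWithin] with y hy
  exact (norm_normalDir fun h => hYK y hy (normalPart_eq_zero_iff.1 h)).symm

theorem mem_orthogonal_of_tendsto_normalDir (hx : x ∈ closure Y)
    (hdir : Tendsto (normalDir n k) (𝓝[Y] x) (𝓝 θ)) : θ ∈ (flat n k)ᗮ := by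
  have : (𝓝[Y] x).NeBot := mem_closure_iff_nhdsWithin_neBot.1 hx
  exact (flat n k)ᗮ.closed_of_finiteDimensional.mem_of_tendsto hdir
    (.of_forall fun y => normalDir_mem_orthogonal y)

theorem HasTangentHalfSpace.of_tendsto (hx : x ∈ closure Y) (hYK : ∀ y ∈ Y, y ∉ flat n k)
    (hdir : Tendsto (normalDir n k) (𝓝[Y] x) (𝓝 θ))
    (hradial : ∀ η > 0, ∀ᶠ y in 𝓝[Y] x, ∃ v ∈ tangentSpaceOf Y y,
      ‖normalPart n k y - v‖ ≤ η * ‖normalPart n k y‖)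
    (hflat : Tendsto (fun y => gapDist (flat n k) (tangentSpaceOf Y y)) (𝓝[Y] x) (𝓝 0)) :
    HasTangentHalfSpace k Y x θ := by
  have hθ := norm_eq_one_of_tendsto_normalDir hx hYK hdir
  have hθK := mem_orthogonal_of_tendsto_normalDir hx hdir
  refine ⟨hθ, hθK, hdir, tendsto_gapDist_iff.2 fun η hη => ?_⟩
  filter_upwards [self_mem_nhdsWithin, hradial (η / 4) (by positivity),
    tendsto_gapDist_iff.1 hflat (η / 2) (by positivity),
    hdir.eventually (Metric.closedBall_mem_nhds θ (by positivity : 0 < η / 4))]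
    with y hy ⟨v, hv, hyv⟩ hflat_y hdir_y w hw
  have hy0 : normalPart n k y ≠ 0 := fun h => hYK y hy (normalPart_eq_zero_iff.1 h)
  have hθT : ∃ u ∈ tangentSpaceOf Y y, ‖u - θ‖ ≤ η / 2 := by
    refine ⟨_, Submodule.smul_mem _ ‖normalPart n k y‖⁻¹ hv, ?_⟩
    rw [norm_sub_rev]
    calc ‖θ - ‖normalPart n k y‖⁻¹ • v‖
        ≤ ‖θ - normalDir n k y‖ + ‖normalDir n k y - ‖normalPart n k y‖⁻¹ • v‖ :=
          norm_sub_le_norm_sub_add_norm_sub _ _ _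
      _ ≤ η / 4 + η / 4 := add_le_add (by rwa [norm_sub_rev, ← dist_eq_norm])
          (norm_normalDir_sub_smul_le hy0 hyv)
      _ = η / 2 := by ring
  refine ⟨_, (tangentSpaceOf Y y).starProjection_apply_mem w, ?_⟩
  rw [norm_sub_rev]
  refine (norm_starProjection_sub_le_of_mem_sup_span (by positivity) hθ hθK (fun e he => ?_) hθT
    hw).trans_eq (by ring)
  simpa only [norm_sub_rev] using hflat_y e he

theorem eventually_closeTangent
    (hradial : ∀ η > 0, ∀ᶠ y in 𝓝[Y] x, ∃ v ∈ tangentSpaceOf Y y,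
      ‖normalPart n k y - v‖ ≤ η * ‖normalPart n k y‖)
    (hflat : Tendsto (fun y => gapDist (flat n k) (tangentSpaceOf Y y)) (𝓝[Y] x) (𝓝 0)) :
    ∀ᶠ y in 𝓝[Y] x, CloseTangent k (tangentSpaceOf Y y) y := by
  filter_upwards [hradial (1 / 8) (by norm_num),
    tendsto_gapDist_iff.1 hflat (1 / 8) (by norm_num)] with y hradial_y hflat_y
  exact ⟨fun e he => by simpa only [norm_sub_rev] using hflat_y e he, hradial_y⟩

theorem exists_isCylParam_and_hasTangentHalfSpace [Fact (IsOMinimal L)] (hYdef : IsDefinableSet L Y)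
    (hY : IsCpSubmanifold 1 (k + 1) Y) (hYK : ∀ y ∈ Y, y ∉ flat n k) {R : ℝ} (hR : 0 < R)
    (hcl : IsClosed ((Y ∪ flat n k) ∩ Metric.closedBall 0 R)) (h0 : (0 : Eucl n) ∈ closure Y)
    (hconn : IsPreconnectedNear Y 0)
    (hflat : Tendsto (fun y => gapDist (flat n k) (tangentSpaceOf Y y)) (𝓝[Y] 0) (𝓝 0)) {ε : ℝ}
    (hε : 0 < ε) (hint : ∫⁻ t in Icc 0 ε, ratioFun k Y t < ∞) :
    (∃ a b Ψ, IsCylParam k Y a b Ψ) ∧ ∃ θ, HasTangentHalfSpace k Y 0 θ := by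
  have hgap : ∀ y ∈ Y, _ := fun y hy => gapDist_le_ratioFun_mul hYK hy
  have hradial : ∀ η > 0, ∀ᶠ y in 𝓝[Y] 0, ∃ v ∈ tangentSpaceOf Y y,
      ‖normalPart n k y - v‖ ≤ η * ‖normalPart n k y‖ := fun η hη =>
    eventually_exists_tangent_near_normalPart hYdef hY hYK hgap hε hint hη
  obtain ⟨a, b, Ψ, hΨ⟩ :=
    exists_isCylParam hY hYK hR hcl (eventually_closeTangent hradial hflat) hconn h0
  obtain ⟨θ, hθ⟩ := hΨ.exists_tendsto_normalDir hYdef hY hYK hgap hε hint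
  exact ⟨⟨a, b, Ψ, hΨ⟩, θ, .of_tendsto h0 hYK hθ hradial hflat⟩

theorem isPreconnectedNear_of_isConnected_inter_ball
    (h : ∀ᶠ ε in 𝓝[>] (0 : ℝ), IsConnected (Y ∩ Metric.ball x ε)) : IsPreconnectedNear Y x := by
  intro U hU
  obtain ⟨δ, hδ, hδU⟩ := Metric.mem_nhds_iff.1 hU
  obtain ⟨r, hr, hr0, hrδ⟩ := (h.and (Ioo_mem_nhdsGT hδ)).exists
  exact ⟨Y ∩ Metric.ball x r, inter_mem self_mem_nhdsWithin
    (mem_nhdsWithin_of_mem_nhds (Metric.ball_mem_nhds x hr0)),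
    inter_subset_inter_right Y ((Metric.ball_subset_ball hrδ.le).trans hδU), hr.isPreconnected⟩

theorem IsPreconnectedNear.map (h : IsPreconnectedNear Y x) (hYφ : φ.IsImage Y Y')
    (hx : x ∈ φ.source) : IsPreconnectedNear Y' (φ x) := by
  intro U hU
  obtain ⟨C, hC, hCsub, hCconn⟩ := h (φ ⁻¹' U ∩ φ.source)
    (inter_mem ((φ.continuousAt hx).preimage_mem_nhds hU) (φ.open_source.mem_nhds hx))
  refine ⟨φ '' C, hYφ.map_nhdsWithin_eq hx ▸ image_mem_map hC, ?_,
    hCconn.image _ (φ.continuousOn.mono fun y hy => (hCsub hy).2.2)⟩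
  rintro _ ⟨y, hy, rfl⟩
  obtain ⟨hyY, hyU, hyφ⟩ := hCsub hy
  exact ⟨(hYφ hyφ).2 hyY, hyU⟩

theorem ConditionA.tendsto_gapDist_flat (h : ConditionA Y X x) (hφ : IsCpChart 1 φ)
    (hXφ : φ.IsImage X (flat n k)) (hYφ : φ.IsImage Y Y') (hx : x ∈ φ.source) (hxX : x ∈ X) :
    Tendsto (fun y => gapDist (flat n k) (tangentSpaceOf Y' y)) (𝓝[Y'] (φ x)) (𝓝 0) := by
  obtain ⟨A, hA, hA'⟩ := hφ.exists_hasStrictFDerivAt_equiv hx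
  refine tendsto_of_tendsto_of_tendsto_of_le_of_le tendsto_const_nhds
    (tendsto_gapDist_map hφ hYφ hx hA.hasFDerivAt h) (fun _ => zero_le) fun y => gapDist_mono ?_ _
  refine fun e he => ⟨A.symm e, ?_, by simp⟩
  refine (tangentSpaceOf_isImage hXφ hx hA.hasFDerivAt hA'.hasFDerivAt).2 ?_
  rw [tangentSpaceOf_submodule _ ((hXφ hx).2 hxX)]
  simpa using he

/-- In the coordinates `φ`, the stratum `X` is `ℝᵏ × 0` and the stratum `Y`, read as `Y'`, has a
cylindrical parametrization near the origin, over a ball of `ℝᵏ × 0` on which `φ⁻¹` is defined. -/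
structure IsAdaptedChart (k : ℕ) (X Y : Set (Eucl n)) (φ : OpenPartialHomeomorph (Eucl n) (Eucl n))
    (Y' : Set (Eucl n)) : Prop where
  isCpChart : IsCpChart 1 φ
  isImage_left : φ.IsImage X (flat n k)
  isImage_right : φ.IsImage Y Y'
  isCpSubmanifold : IsCpSubmanifold 1 (k + 1) Y'
  notMem_flat : ∀ y ∈ Y', y ∉ flat n k
  exists_isCylParam : ∃ a b Ψ, IsCylParam k Y' a b Ψ ∧ Metric.ball 0 a ⊆ φ.target

theorem exists_isAdaptedChart [Fact (IsOMinimal L)] (hYdef : IsDefinableSet L Y)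
    (hY : IsCpSubmanifold 1 (k + 1) Y) (hdisj : Disjoint X Y) (hclosed : IsLocallyClosed (X ∪ Y))
    (hxX : x ∈ X) (hxY : x ∈ closure Y)
    (hloc : ∀ᶠ ε in 𝓝[>] (0 : ℝ), IsConnected (Y ∩ Metric.ball x ε)) (ha : ConditionA Y X x)
    (hr : ConditionRInt L k Y X x) :
    ∃ φ Y', x ∈ φ.source ∧ φ x = 0 ∧ IsAdaptedChart k X Y φ Y' ∧
      ∃ θ, HasTangentHalfSpace k Y' 0 θ := by
  obtain ⟨φ, hxφ, hφx, hφC2, hφdef, hXφ, ε, hε, hint⟩ := hr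
  have hφ : IsCpChart 1 φ := hφC2.mono (by norm_num)
  have hYφ := isImage_image_source_inter φ Y
  have hY' := hY.image hφ
  have hY'K : ∀ y ∈ φ '' (φ.source ∩ Y), y ∉ flat n k := by
    rintro _ ⟨y, ⟨hyφ, hyY⟩, rfl⟩ hyK
    exact disjoint_left.1 hdisj ((hXφ hyφ).1 hyK) hyY
  obtain ⟨R, hR, hcl⟩ := exists_isClosed_inter_closedBall_of_isImage (hYφ.union hXφ)
    (by rwa [union_comm]) (.inr hxX) hxφ
  have h0 := (hYφ.closure hxφ).2 hxY
  have hconn := (isPreconnectedNear_of_isConnected_inter_ball hloc).map hYφ hxφ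
  have hflat := ha.tendsto_gapDist_flat hφ hXφ hYφ hxφ hxX
  have htarget := φ.open_target.mem_nhds (φ.map_source hxφ)
  rw [hφx] at hcl h0 hconn hflat htarget
  obtain ⟨⟨a, b, Ψ, hΨ⟩, θ, hθ⟩ := exists_isCylParam_and_hasTangentHalfSpace
    (hYdef.image hφdef) hY' hY'K hR hcl h0 hconn hflat hε hint
  obtain ⟨δ, hδ, hδφ⟩ := Metric.mem_nhds_iff.1 htarget
  exact ⟨φ, _, hxφ, hφx, ⟨hφ, hXφ, hYφ, hY', hY'K, min a δ, b, Ψ,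
    hΨ.mono (lt_min hΨ.pos_left hδ) hΨ.pos_right (min_le_left _ _) le_rfl,
    (Metric.ball_subset_ball (min_le_right _ _)).trans hδφ⟩, θ, hθ⟩

end AdaptedCoordinates

/-! ### Extension of the parametrization across the boundary -/

section Extension

variable {n k : ℕ} {a b : ℝ}

/-- The product of the ball of radius `a` in `ℝᵏ × 0` and the interval `(-b, b)`: the box of the
cylindrical coordinates, together with its reflection and the wall between the two. -/
def cylSlab (n k : ℕ) (a b : ℝ) : Set (flat n k × ℝ) := {p | ‖p.1‖ < a ∧ |p.2| < b}

theorem isOpen_cylSlab : IsOpen (cylSlab n k a b) :=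
  (isOpen_lt continuous_fst.norm continuous_const).inter
    (isOpen_lt continuous_snd.abs continuous_const)

theorem mem_cylBox_of_mem_cylSlab {p : flat n k × ℝ} (hp : p ∈ cylSlab n k a b) (h : 0 < p.2) :
    p ∈ cylBox n k a b :=
  ⟨hp.1, h, (le_abs_self _).trans_lt hp.2⟩

/-- The reflection of the last variable. -/
noncomputable def cylRefl (n k : ℕ) : (flat n k × ℝ) ≃L[ℝ] (flat n k × ℝ) :=
  (ContinuousLinearEquiv.refl ℝ _).prodCongr (ContinuousLinearEquiv.neg ℝ)

theorem cylRefl_apply (p : flat n k × ℝ) : cylRefl n k p = (p.1, -p.2) := rfl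

theorem cylSlab_inter_snd_ne_zero : cylSlab n k a b ∩ {p | p.2 ≠ 0} =
    cylBox n k a b ∪ cylRefl n k ⁻¹' cylBox n k a b := by
  ext p
  constructor
  · rintro ⟨hp, hp0⟩
    rcases hp0.lt_or_gt with hneg | hpos
    · exact .inr (mem_cylBox_of_mem_cylSlab ⟨hp.1, by simpa [cylRefl_apply] using hp.2⟩
        (neg_pos.2 hneg))
    · exact .inl (mem_cylBox_of_mem_cylSlab hp hpos)
  · rintro (⟨hbase, hpos, hlt⟩ | ⟨hbase, hpos, hlt⟩)
    · exact ⟨⟨hbase, by rwa [abs_of_pos hpos]⟩, hpos.ne'⟩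
    · rw [cylRefl_apply, neg_pos] at hpos
      exact ⟨⟨hbase, by rwa [abs_of_neg hpos]⟩, hpos.ne⟩

theorem cylSlab_subset_closure :
    cylSlab n k a b ⊆ closure (cylSlab n k a b ∩ {p | p.2 ≠ 0}) :=
  ((dense_compl_singleton (0 : ℝ)).preimage isOpenMap_snd).open_subset_closure_inter isOpen_cylSlab

/-- The normal component of the parametrization `Ψ`, extended to an odd function of the last
variable. -/
noncomputable def cylExt (Ψ : flat n k × ℝ → Eucl n) (p : flat n k × ℝ) : Eucl n :=
  p.2 • normalDir n k (Ψ (p.1, |p.2|))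

theorem cylExt_eq_neg (Ψ : flat n k × ℝ → Eucl n) : cylExt Ψ = -(cylExt Ψ ∘ cylRefl n k) := by
  ext1 p
  simp [cylExt, cylRefl_apply]

theorem fderiv_cylExt (Ψ : flat n k × ℝ → Eucl n) (p : flat n k × ℝ) :
    fderiv ℝ (cylExt Ψ) p =
      -(fderiv ℝ (cylExt Ψ) (cylRefl n k p)).comp (cylRefl n k : (flat n k × ℝ) →L[ℝ] _) := by
  conv_lhs => rw [cylExt_eq_neg]
  rw [fderiv_neg, ContinuousLinearEquiv.comp_right_fderiv]

theorem cylExt_of_snd_eq_zero (Ψ : flat n k × ℝ → Eucl n) {p : flat n k × ℝ} (hp : p.2 = 0) :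
    cylExt Ψ p = 0 := by
  rw [cylExt, hp, zero_smul]

namespace IsCylParam

variable {Y : Set (Eucl n)} {Ψ : flat n k × ℝ → Eucl n} {x : flat n k} {p : flat n k × ℝ}
  {θ : Eucl n}

theorem cylExt_eq (h : IsCylParam k Y a b Ψ) (hp : p ∈ cylBox n k a b) :
    cylExt Ψ p = Ψ p - p.1 := by
  rw [cylExt, abs_of_pos hp.2.1, Prod.mk.eta, normalDir, h.norm_normalPart hp, h.normalPart_eq hp,
    smul_smul, mul_inv_cancel₀ hp.2.1.ne', one_smul]

theorem tendsto_nhdsWithin (h : IsCylParam k Y a b Ψ) (x : flat n k) :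
    Tendsto Ψ (𝓝[cylBox n k a b] (x, 0)) (𝓝[Y] (x : Eucl n)) := by
  have hbox : ∀ᶠ p in 𝓝[cylBox n k a b] ((x, 0) : flat n k × ℝ), p ∈ cylBox n k a b :=
    self_mem_nhdsWithin
  refine tendsto_nhdsWithin_iff.2 ⟨?_, hbox.mono h.mem⟩
  have hfst : Tendsto (fun p : flat n k × ℝ => (p.1 : Eucl n)) (𝓝[cylBox n k a b] (x, 0)) (𝓝 x) :=
    ((continuous_subtype_val.comp continuous_fst).tendsto (x, (0 : ℝ))).mono_left nhdsWithin_le_nhds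
  have hsnd : Tendsto (fun p : flat n k × ℝ => p.2) (𝓝[cylBox n k a b] (x, 0)) (𝓝 0) :=
    (continuous_snd.tendsto (x, (0 : ℝ))).mono_left nhdsWithin_le_nhds
  have hnormal : Tendsto (fun p => Ψ p - p.1) (𝓝[cylBox n k a b] (x, 0)) (𝓝 0) := by
    refine tendsto_zero_iff_norm_tendsto_zero.2 (hsnd.congr' ?_)
    filter_upwards [hbox] with p hp
    rw [← h.normalPart_eq hp, h.norm_normalPart hp]
  simpa using hnormal.add hfst

theorem hasFDerivAt_cylExt (h : IsCylParam k Y a b Ψ) (hx : ‖x‖ < a)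
    (hθ : Tendsto (normalDir n k) (𝓝[Y] (x : Eucl n)) (𝓝 θ)) :
    HasFDerivAt (cylExt Ψ) ((ContinuousLinearMap.snd ℝ (flat n k) ℝ).smulRight θ) (x, 0) := by
  refine .of_isLittleO (Asymptotics.isLittleO_iff.2 fun c hc => ?_)
  have hdir := (hθ.comp (h.tendsto_nhdsWithin x)).eventually (Metric.closedBall_mem_nhds θ hc)
  have habs : Tendsto (fun p : flat n k × ℝ => (p.1, |p.2|)) (𝓝 (x, 0)) (𝓝 (x, 0)) :=
    Continuous.tendsto' (by fun_prop) _ _ (by simp)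
  have hslab : ∀ᶠ p in 𝓝 (x, 0), p ∈ cylSlab n k a b :=
    isOpen_cylSlab.mem_nhds ⟨hx, by simpa using h.pos_right⟩
  filter_upwards [habs.eventually (eventually_nhdsWithin_iff.1 hdir), hslab] with p hdir_p hp
  have hdiff : cylExt Ψ p - cylExt Ψ (x, 0) -
      (ContinuousLinearMap.snd ℝ (flat n k) ℝ).smulRight θ (p - (x, 0)) =
      p.2 • (normalDir n k (Ψ (p.1, |p.2|)) - θ) := by
    simp [cylExt, smul_sub]
  have hle : ‖p.2‖ ≤ ‖p - (x, 0)‖ := by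
    simpa using norm_snd_le (p - (x, (0 : ℝ)))
  rw [hdiff, norm_smul, mul_comm]
  rcases eq_or_ne p.2 0 with h0 | h0
  · rw [h0, norm_zero, mul_zero]
    positivity
  · have hdist := hdir_p ⟨hp.1, abs_pos.2 h0, hp.2⟩
    rw [Function.comp_apply, dist_eq_norm] at hdist
    gcongr

theorem hasFDerivAt_cylExt_of_mem (h : IsCylParam k Y a b Ψ) (hp : p ∈ cylBox n k a b) :
    HasFDerivAt (cylExt Ψ)
      (fderiv ℝ Ψ p - (flat n k).subtypeL.comp (ContinuousLinearMap.fst ℝ (flat n k) ℝ)) p := by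
  refine (((h.contDiffAt p hp).differentiableAt one_ne_zero).hasFDerivAt.sub
    ((flat n k).subtypeL.comp (ContinuousLinearMap.fst ℝ _ ℝ)).hasFDerivAt).congr_of_eventuallyEq ?_
  filter_upwards [(isOpen_cylBox a b).mem_nhds hp] with q hq using h.cylExt_eq hq

theorem contDiffAt_cylExt_of_mem (h : IsCylParam k Y a b Ψ) (hp : p ∈ cylBox n k a b) :
    ContDiffAt ℝ 1 (cylExt Ψ) p := by
  refine ((h.contDiffAt p hp).sub ((flat n k).subtypeL.comp
    (ContinuousLinearMap.fst ℝ _ ℝ)).contDiff.contDiffAt).congr_of_eventuallyEq ?_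
  filter_upwards [(isOpen_cylBox a b).mem_nhds hp] with q hq using h.cylExt_eq hq

theorem contDiffAt_cylExt (h : IsCylParam k Y a b Ψ) (hp : p ∈ cylSlab n k a b) (hp0 : p.2 ≠ 0) :
    ContDiffAt ℝ 1 (cylExt Ψ) p := by
  rcases cylSlab_inter_snd_ne_zero.subset ⟨hp, hp0⟩ with hbox | hrefl
  · exact h.contDiffAt_cylExt_of_mem hbox
  · rw [cylExt_eq_neg]
    exact ((h.contDiffAt_cylExt_of_mem hrefl).comp p (cylRefl n k).contDiff.contDiffAt).neg

theorem norm_fderiv_cylExt_sub_le (h : IsCylParam k Y a b Ψ) (hY : IsCpSubmanifold 1 (k + 1) Y)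
    (hp : p ∈ cylBox n k a b) (hθ : ‖θ‖ = 1) {η : ℝ} (hη : 0 ≤ η)
    (hdir : ‖normalDir n k (Ψ p) - θ‖ ≤ η)
    (hT : ∀ w ∈ flat n k ⊔ Submodule.span ℝ {θ}, ∃ v ∈ tangentSpaceOf Y (Ψ p),
      ‖w - v‖ ≤ η * ‖w‖) :
    ‖fderiv ℝ (cylExt Ψ) p - (ContinuousLinearMap.snd ℝ (flat n k) ℝ).smulRight θ‖ ≤ 16 * η := by
  rw [(h.hasFDerivAt_cylExt_of_mem hp).fderiv]
  refine ContinuousLinearMap.opNorm_le_bound _ (by positivity) fun u => ?_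
  set N := normalDir n k (Ψ p)
  have hfst : ‖(u.1 : Eucl n)‖ ≤ ‖u‖ := norm_fst_le u
  have hsnd : |u.2| ≤ ‖u‖ := norm_snd_le u
  obtain ⟨v, hv, hwv⟩ := hT (u.1 + u.2 • θ) (Submodule.add_mem_sup u.1.2
    (Submodule.smul_mem _ _ (Submodule.mem_span_singleton_self θ)))
  have hw : ‖(u.1 : Eucl n) + u.2 • θ‖ ≤ 2 * ‖u‖ := by
    refine (norm_add_le _ _).trans ?_
    rw [norm_smul, hθ, mul_one, Real.norm_eq_abs]
    linarith
  have hNθ : ‖u.2 • (N - θ)‖ ≤ η * ‖u‖ := by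
    rw [norm_smul, Real.norm_eq_abs, mul_comm]
    gcongr
  have hNv : ‖(u.1 : Eucl n) + u.2 • N - v‖ ≤ η * (2 * ‖u‖) + η * ‖u‖ := calc
    _ = ‖(u.1 + u.2 • θ - v) + u.2 • (N - θ)‖ := by congr 1; module
    _ ≤ _ := (norm_add_le _ _).trans (add_le_add (hwv.trans (by gcongr)) hNθ)
  calc ‖(fderiv ℝ Ψ p - (flat n k).subtypeL.comp (ContinuousLinearMap.fst ℝ (flat n k) ℝ) -
        (ContinuousLinearMap.snd ℝ (flat n k) ℝ).smulRight θ) u‖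
      = ‖fderiv ℝ Ψ p u - u.1 - u.2 • θ‖ := rfl
    _ = ‖(fderiv ℝ Ψ p u - (u.1 + u.2 • N)) + u.2 • (N - θ)‖ := by congr 1; module
    _ ≤ 5 * (η * (2 * ‖u‖) + η * ‖u‖) + η * ‖u‖ := (norm_add_le _ _).trans
        (add_le_add ((h.norm_fderiv_sub_le hY hp u hv).trans (by gcongr)) hNθ)
    _ = 16 * η * ‖u‖ := by ring

theorem tendsto_fderiv_cylExt (h : IsCylParam k Y a b Ψ) (hY : IsCpSubmanifold 1 (k + 1) Y)
    (hθ : HasTangentHalfSpace k Y x θ) :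
    Tendsto (fderiv ℝ (cylExt Ψ)) (𝓝[cylBox n k a b] (x, 0))
      (𝓝 ((ContinuousLinearMap.snd ℝ (flat n k) ℝ).smulRight θ)) := by
  have hΨ := h.tendsto_nhdsWithin x
  refine (Metric.nhds_basis_closedBall (α := (flat n k × ℝ) →L[ℝ] Eucl n)).tendsto_right_iff.2
    fun ε hε => ?_
  have hη : 0 < ε / 16 := by positivity
  filter_upwards [self_mem_nhdsWithin,
    (hθ.dir.comp hΨ).eventually (Metric.closedBall_mem_nhds θ hη),
    hΨ.eventually (tendsto_gapDist_iff.1 hθ.tangent _ hη)] with p hp hdir hT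
  exact (dist_eq_norm (E := (flat n k × ℝ) →L[ℝ] Eucl n) _ _).trans_le
    ((h.norm_fderiv_cylExt_sub_le hY hp hθ.norm_eq hη.le (mem_closedBall_iff_norm.1 hdir)
      hT).trans_eq (by ring))

theorem tendsto_fderiv_cylExt_refl (h : IsCylParam k Y a b Ψ) (hY : IsCpSubmanifold 1 (k + 1) Y)
    (hθ : HasTangentHalfSpace k Y x θ) :
    Tendsto (fderiv ℝ (cylExt Ψ)) (𝓝[cylRefl n k ⁻¹' cylBox n k a b] (x, 0))
      (𝓝 ((ContinuousLinearMap.snd ℝ (flat n k) ℝ).smulRight θ)) := by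
  have hrefl : Tendsto (cylRefl n k) (𝓝[cylRefl n k ⁻¹' cylBox n k a b] (x, 0))
      (𝓝[cylBox n k a b] (x, 0)) :=
    tendsto_nhdsWithin_iff.2 ⟨((cylRefl n k).continuous.tendsto' _ _
      (by rw [cylRefl_apply, neg_zero])).mono_left nhdsWithin_le_nhds, self_mem_nhdsWithin⟩
  have hcomp : Continuous fun D : (flat n k × ℝ) →L[ℝ] Eucl n =>
      -(D.comp (cylRefl n k : (flat n k × ℝ) →L[ℝ] (flat n k × ℝ))) := by fun_prop
  have hlim : -(((ContinuousLinearMap.snd ℝ (flat n k) ℝ).smulRight θ).comp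
      (cylRefl n k : (flat n k × ℝ) →L[ℝ] (flat n k × ℝ))) =
      (ContinuousLinearMap.snd ℝ (flat n k) ℝ).smulRight θ := by
    refine ContinuousLinearMap.ext fun u => ?_
    simp [cylRefl_apply]
  exact ((hcomp.tendsto' _ _ hlim).comp ((h.tendsto_fderiv_cylExt hY hθ).comp hrefl)).congr
    fun p => (fderiv_cylExt Ψ p).symm

theorem tendsto_fderiv_cylExt_nhdsWithin_snd_ne_zero (h : IsCylParam k Y a b Ψ)
    (hY : IsCpSubmanifold 1 (k + 1) Y)
    (hT : ∀ x : flat n k, ‖x‖ < a → ∃ θ, HasTangentHalfSpace k Y x θ)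
    (hp : p ∈ cylSlab n k a b) : DifferentiableAt ℝ (cylExt Ψ) p ∧
      Tendsto (fderiv ℝ (cylExt Ψ)) (𝓝[cylSlab n k a b ∩ {p | p.2 ≠ 0}] p)
        (𝓝 (fderiv ℝ (cylExt Ψ) p)) := by
  obtain ⟨x, s⟩ := p
  rcases eq_or_ne s 0 with rfl | hs
  · obtain ⟨θ, hθ⟩ := hT x hp.1
    have hderiv := h.hasFDerivAt_cylExt hp.1 hθ.dir
    refine ⟨hderiv.differentiableAt, ?_⟩
    rw [hderiv.fderiv, cylSlab_inter_snd_ne_zero, nhdsWithin_union]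
    exact (h.tendsto_fderiv_cylExt hY hθ).sup (h.tendsto_fderiv_cylExt_refl hY hθ)
  · have hsmooth := h.contDiffAt_cylExt hp hs
    exact ⟨hsmooth.differentiableAt one_ne_zero,
      (hsmooth.continuousAt_fderiv one_ne_zero).tendsto.mono_left nhdsWithin_le_nhds⟩

theorem contDiffOn_cylExt (h : IsCylParam k Y a b Ψ) (hY : IsCpSubmanifold 1 (k + 1) Y)
    (hT : ∀ x : flat n k, ‖x‖ < a → ∃ θ, HasTangentHalfSpace k Y x θ) :
    ContDiffOn ℝ 1 (cylExt Ψ) (cylSlab n k a b) := by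
  have hlim := fun p (hp : p ∈ cylSlab n k a b) =>
    h.tendsto_fderiv_cylExt_nhdsWithin_snd_ne_zero hY hT hp
  have hcont : ContinuousOn (fderiv ℝ (cylExt Ψ)) (cylSlab n k a b) :=
    (continuousOn_extendFrom cylSlab_subset_closure fun p hp => ⟨_, (hlim p hp).2⟩).congr
      fun p hp => (extendFrom_eq (cylSlab_subset_closure hp) (hlim p hp).2).symm
  rw [← zero_add (1 : WithTop ℕ∞), contDiffOn_succ_iff_fderiv_of_isOpen isOpen_cylSlab]
  exact ⟨fun p hp => (hlim p hp).1.differentiableWithinAt, by simp, contDiffOn_zero.2 hcont⟩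

end IsCylParam

end Extension

/-! ### Boundary charts -/

section BoundaryChart

variable {n k : ℕ}

theorem IsCpChart.restrOpen {p : ℕ} {φ : OpenPartialHomeomorph (Eucl n) (Eucl n)}
    (hφ : IsCpChart p φ) {s : Set (Eucl n)} (hs : IsOpen s) : IsCpChart p (φ.restrOpen s hs) :=
  ⟨hφ.1.mono inter_subset_left, hφ.2.mono inter_subset_left⟩

theorem exists_isCpChart_of_contDiffOn {p : ℕ} (hp : 1 ≤ p) {F : Eucl n → Eucl n}
    {V : Set (Eucl n)} (hV : IsOpen V) (hF : ContDiffOn ℝ p F V) {x : Eucl n} (hx : x ∈ V)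
    {A : Eucl n ≃L[ℝ] Eucl n} (hA : HasFDerivAt F (A : Eucl n →L[ℝ] Eucl n) x) :
    ∃ φ : OpenPartialHomeomorph (Eucl n) (Eucl n),
      IsCpChart p φ ∧ x ∈ φ.source ∧ φ.source ⊆ V ∧ ⇑φ = F := by
  have hp0 : (p : WithTop ℕ∞) ≠ 0 := by exact_mod_cast Nat.one_le_iff_ne_zero.1 hp
  have hp1 : (1 : WithTop ℕ∞) ≤ p := by exact_mod_cast hp
  have hFx : ContDiffAt ℝ p F x := hF.contDiffAt (hV.mem_nhds hx)
  have hopen : IsOpen (V ∩ fderiv ℝ F ⁻¹' range ((↑) : (Eucl n ≃L[ℝ] Eucl n) → _)) :=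
    (hF.continuousOn_fderiv_of_isOpen hV hp1).isOpen_inter_preimage hV ContinuousLinearEquiv.isOpen
  set φ := (hFx.toOpenPartialHomeomorph F hA hp0).restrOpen _ hopen
  refine ⟨φ, ⟨hF.mono fun z hz => hz.2.1, fun w hw => ?_⟩,
    ⟨hFx.mem_toOpenPartialHomeomorph_source hA hp0, hx, A, hA.fderiv.symm⟩,
    fun z hz => hz.2.1, rfl⟩
  obtain ⟨-, hzV, D, hD⟩ := φ.map_target hw
  have hsmooth : ContDiffAt ℝ p F (φ.symm w) := hF.contDiffAt (hV.mem_nhds hzV)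
  refine (φ.contDiffAt_symm (f₀' := D) hw ?_ hsmooth).contDiffWithinAt
  exact hD ▸ (hsmooth.differentiableAt hp0).hasFDerivAt

theorem single_mem_orthogonal_flat (hk : k < n) :
    EuclideanSpace.single ⟨k, hk⟩ (1 : ℝ) ∈ (flat n k)ᗮ := by
  refine (Submodule.mem_orthogonal' _ _).2 fun u hu => ?_
  rw [EuclideanSpace.inner_single_left, mem_flat.1 hu ⟨k, hk⟩ le_rfl, mul_zero]

theorem normalPart_succ (hk : k < n) (z : Eucl n) :
    normalPart n (k + 1) z =
      normalPart n k z - z ⟨k, hk⟩ • EuclideanSpace.single ⟨k, hk⟩ (1 : ℝ) := by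
  ext i
  simp only [normalPart_apply, PiLp.sub_apply, PiLp.smul_apply, flat_starProjection_apply]
  rcases lt_trichotomy i.val k with hi | hi | hi
  · have hne : i ≠ ⟨k, hk⟩ := fun h => by simp [h] at hi
    simp [hi, hne, hi.trans (Nat.lt_succ_self k)]
  · obtain rfl : i = ⟨k, hk⟩ := Fin.ext hi
    simp
  · have hne : i ≠ ⟨k, hk⟩ := fun h => by simp [h] at hi
    simp [hne, hi.not_gt, hi.not_ge]

theorem exists_isometry_single_eq (hk : k < n) {θ : Eucl n} (hθ : ‖θ‖ = 1)
    (hθK : θ ∈ (flat n k)ᗮ) :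
    ∃ Λ : Eucl n ≃ₗᵢ[ℝ] Eucl n, (∀ e ∈ flat n k, Λ e = e) ∧
      Λ (EuclideanSpace.single ⟨k, hk⟩ (1 : ℝ)) = θ := by
  set ek : Eucl n := EuclideanSpace.single ⟨k, hk⟩ (1 : ℝ) with hek
  refine ⟨(Submodule.span ℝ {ek - θ})ᗮ.reflection, fun e he => ?_,
    Submodule.reflection_sub (by rw [hθ, hek]; simp)⟩
  refine Submodule.reflection_mem_subspace_eq_self ?_
  rw [Submodule.mem_orthogonal_singleton_iff_inner_right]
  exact Submodule.inner_left_of_mem_orthogonal he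
    (Submodule.sub_mem _ (single_mem_orthogonal_flat hk) hθK)

theorem mem_halfFlat (hk : k < n) {z : Eucl n} :
    z ∈ halfFlat n k ↔ z ∈ flat n (k + 1) ∧ 0 ≤ z ⟨k, hk⟩ :=
  and_congr_right fun _ => ⟨fun h => h _ rfl, fun h _ hi => (Fin.ext hi : _ = ⟨k, hk⟩) ▸ h⟩

/-- The first `k + 1` coordinates of a vector, as a point of `(ℝᵏ × 0) × ℝ`. -/
noncomputable def halfCoord (hk : k < n) : Eucl n →L[ℝ] flat n k × ℝ :=
  (flat n k).orthogonalProjectionOnto.prod (EuclideanSpace.proj ⟨k, hk⟩)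

theorem halfCoord_of_mem_flat (hk : k < n) {z : Eucl n} (hz : z ∈ flat n k) :
    halfCoord hk z = (⟨z, hz⟩, 0) :=
  Prod.ext (Subtype.ext (Submodule.starProjection_eq_self_iff.2 hz)) (hz ⟨k, hk⟩ le_rfl)

/-- The point of the half-space `halfFlat n k` which has the cylindrical coordinates of `w`. -/
noncomputable def toHalfFlat (hk : k < n) (w : Eucl n) : Eucl n :=
  (flat n k).starProjection w + ‖normalPart n k w‖ • EuclideanSpace.single ⟨k, hk⟩ (1 : ℝ)

theorem continuous_toHalfFlat (hk : k < n) : Continuous (toHalfFlat hk) := by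
  unfold toHalfFlat
  fun_prop

theorem halfCoord_toHalfFlat (hk : k < n) (w : Eucl n) :
    halfCoord hk (toHalfFlat hk w) = cylCoord n k w := by
  refine Prod.ext (Subtype.ext ?_) ?_
  · change (flat n k).starProjection (_ + _) = (flat n k).starProjection w
    rw [map_add, map_smul, Submodule.starProjection_apply_eq_zero_iff _ |>.2
      (single_mem_orthogonal_flat hk), smul_zero, add_zero]
    exact Submodule.starProjection_eq_self_iff.2 (Submodule.starProjection_apply_mem _ _)
  · change toHalfFlat hk w ⟨k, hk⟩ = ‖normalPart n k w‖
    simp [toHalfFlat, flat_starProjection_apply]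

theorem toHalfFlat_mem_halfFlat (hk : k < n) (w : Eucl n) : toHalfFlat hk w ∈ halfFlat n k := by
  refine (mem_halfFlat hk).2 ⟨Submodule.add_mem _
    (flat_mono (Nat.le_succ k) (Submodule.starProjection_apply_mem _ _))
    (Submodule.smul_mem _ _ (mem_flat.2 fun i hi => ?_)), ?_⟩
  · simp [Fin.ne_of_gt (show (⟨k, hk⟩ : Fin n) < i from hi)]
  · exact (norm_nonneg (normalPart n k w)).trans_eq
      (congrArg Prod.snd (halfCoord_toHalfFlat hk w)).symm

theorem toHalfFlat_of_mem_flat (hk : k < n) {w : Eucl n} (hw : w ∈ flat n k) :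
    toHalfFlat hk w = w := by
  rw [toHalfFlat, normalPart_eq_zero_iff.2 hw, norm_zero, zero_smul, add_zero]
  exact Submodule.starProjection_eq_self_iff.2 hw

/-- The map which straightens out `(ℝᵏ × 0) ∪ Y`: on the half-space `halfFlat n k` it is the
cylindrical parametrization `Ψ` of `Y`, and `Λ` serves to make its derivative at the origin
invertible. -/
noncomputable def boundaryMap (hk : k < n) (Ψ : flat n k × ℝ → Eucl n)
    (Λ : Eucl n ≃ₗᵢ[ℝ] Eucl n) (z : Eucl n) : Eucl n :=
  (flat n k).starProjection z + cylExt Ψ (halfCoord hk z) + Λ (normalPart n (k + 1) z)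

section

variable {hk : k < n} {Ψ : flat n k × ℝ → Eucl n} {Λ : Eucl n ≃ₗᵢ[ℝ] Eucl n} {a b : ℝ}
  {Y : Set (Eucl n)} {z w : Eucl n}

theorem boundaryMap_of_mem_flat_succ (hz : z ∈ flat n (k + 1)) :
    boundaryMap hk Ψ Λ z = (halfCoord hk z).1 + cylExt Ψ (halfCoord hk z) := by
  rw [boundaryMap, normalPart_eq_zero_iff.2 hz, map_zero, add_zero]
  rfl

theorem boundaryMap_of_mem_flat (hz : z ∈ flat n k) : boundaryMap hk Ψ Λ z = z := by
  rw [boundaryMap_of_mem_flat_succ (flat_mono (Nat.le_succ k) hz), halfCoord_of_mem_flat hk hz,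
    cylExt_of_snd_eq_zero Ψ rfl, add_zero]

namespace IsCylParam

theorem boundaryMap_mem (h : IsCylParam k Y a b Ψ) (hz : z ∈ halfFlat n k)
    (hslab : halfCoord hk z ∈ cylSlab n k a b) :
    boundaryMap hk Ψ Λ z ∈ (flat n k : Set (Eucl n)) ∪ Y := by
  rw [boundaryMap_of_mem_flat_succ hz.1]
  rcases ((mem_halfFlat hk).1 hz).2.eq_or_lt with h0 | hpos
  · rw [cylExt_of_snd_eq_zero Ψ h0.symm, add_zero]
    exact .inl (halfCoord hk z).1.2
  · have hbox := mem_cylBox_of_mem_cylSlab hslab hpos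
    rw [h.cylExt_eq hbox, add_sub_cancel]
    exact .inr (h.mem _ hbox)

theorem boundaryMap_toHalfFlat (h : IsCylParam k Y a b Ψ) (hYK : ∀ y ∈ Y, y ∉ flat n k)
    (hw : w ∈ (flat n k : Set (Eucl n)) ∪ Y) (hslab : cylCoord n k w ∈ cylSlab n k a b) :
    boundaryMap hk Ψ Λ (toHalfFlat hk w) = w := by
  rcases hw with hw | hw
  · rw [toHalfFlat_of_mem_flat hk hw, boundaryMap_of_mem_flat hw]
  · have hbox := mem_cylBox_of_mem_cylSlab hslab
      (norm_pos_iff.2 fun h0 => hYK w hw (normalPart_eq_zero_iff.1 h0))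
    rw [boundaryMap_of_mem_flat_succ (toHalfFlat_mem_halfFlat hk w).1, halfCoord_toHalfFlat,
      h.cylExt_eq hbox, h.eq_of_mem w hw hbox, add_sub_cancel]

theorem zero_mem_cylSlab (h : IsCylParam k Y a b Ψ) : (0 : flat n k × ℝ) ∈ cylSlab n k a b :=
  ⟨by simpa using h.pos_left, by simpa using h.pos_right⟩

theorem contDiffOn_boundaryMap (h : IsCylParam k Y a b Ψ) (hY : IsCpSubmanifold 1 (k + 1) Y)
    (hT : ∀ x : flat n k, ‖x‖ < a → ∃ θ, HasTangentHalfSpace k Y x θ) :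
    ContDiffOn ℝ 1 (boundaryMap hk Ψ Λ) (halfCoord hk ⁻¹' cylSlab n k a b) :=
  ((flat n k).starProjection.contDiff.contDiffOn.add ((h.contDiffOn_cylExt hY hT).comp
    (halfCoord hk).contDiff.contDiffOn fun _ hz => hz)).add
      (Λ.contDiff.comp (normalPart n (k + 1)).contDiff).contDiffOn

theorem hasFDerivAt_boundaryMap (h : IsCylParam k Y a b Ψ) {θ : Eucl n}
    (hθ : HasTangentHalfSpace k Y 0 θ) (hΛK : ∀ e ∈ flat n k, Λ e = e)
    (hΛ : Λ (EuclideanSpace.single ⟨k, hk⟩ (1 : ℝ)) = θ) :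
    HasFDerivAt (boundaryMap hk Ψ Λ) (Λ.toContinuousLinearEquiv : Eucl n →L[ℝ] Eucl n) 0 := by
  have hext : HasFDerivAt (cylExt Ψ) ((ContinuousLinearMap.snd ℝ (flat n k) ℝ).smulRight θ)
      (halfCoord hk 0) := by
    rw [map_zero]
    exact h.hasFDerivAt_cylExt (x := 0) (by simpa using h.pos_left) hθ.dir
  have hsum := (((flat n k).starProjection.hasFDerivAt (x := (0 : Eucl n))).add
    (hext.comp 0 (halfCoord hk).hasFDerivAt)).add
      ((Λ.toContinuousLinearEquiv : Eucl n →L[ℝ] Eucl n).hasFDerivAt.comp 0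
        (normalPart n (k + 1)).hasFDerivAt)
  refine hsum.congr_fderiv (ContinuousLinearMap.ext fun v => ?_)
  change (flat n k).starProjection v + v ⟨k, hk⟩ • θ + Λ (normalPart n (k + 1) v) = Λ v
  rw [normalPart_succ hk, map_sub, map_smul, hΛ]
  conv_rhs => rw [← starProjection_add_normalPart (d := k) v, map_add,
    hΛK _ (Submodule.starProjection_apply_mem _ _)]
  abel

theorem exists_isCpChart_boundaryMap (hk : k < n) (h : IsCylParam k Y a b Ψ)
    (hY : IsCpSubmanifold 1 (k + 1) Y)
    (hT : ∀ x : flat n k, ‖x‖ < a → ∃ θ, HasTangentHalfSpace k Y x θ) :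
    ∃ (Λ : Eucl n ≃ₗᵢ[ℝ] Eucl n) (φ : OpenPartialHomeomorph (Eucl n) (Eucl n)), IsCpChart 1 φ ∧
      0 ∈ φ.source ∧ φ.source ⊆ halfCoord hk ⁻¹' cylSlab n k a b ∧ ⇑φ = boundaryMap hk Ψ Λ := by
  obtain ⟨θ, hθ⟩ := hT 0 (by simpa using h.pos_left)
  obtain ⟨Λ, hΛK, hΛ⟩ := exists_isometry_single_eq hk hθ.norm_eq hθ.orth
  have hzero : (0 : Eucl n) ∈ halfCoord hk ⁻¹' cylSlab n k a b := by
    rw [mem_preimage, map_zero]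
    exact h.zero_mem_cylSlab
  exact ⟨Λ, exists_isCpChart_of_contDiffOn le_rfl
    (isOpen_cylSlab.preimage (halfCoord hk).continuous) (h.contDiffOn_boundaryMap hY hT) hzero
    (h.hasFDerivAt_boundaryMap hθ hΛK hΛ)⟩

theorem exists_boundary_chart (h : IsCylParam k Y a b Ψ) (hY : IsCpSubmanifold 1 (k + 1) Y)
    (hYK : ∀ y ∈ Y, y ∉ flat n k)
    (hT : ∀ x : flat n k, ‖x‖ < a → ∃ θ, HasTangentHalfSpace k Y x θ) :
    ∃ G : OpenPartialHomeomorph (Eucl n) (Eucl n), 0 ∈ G.source ∧ IsCpChart 1 G ∧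
      G.IsImage (flat n k ∪ Y) (halfFlat n k) ∧ G.IsImage (flat n k) (flat n k) := by
  have hk : k < n := hY.1
  obtain ⟨Λ, φ, hφ, h0φ, hφV, hφF⟩ := h.exists_isCpChart_boundaryMap hk hY hT
  have hφflat : ∀ z ∈ flat n k, φ z = z := fun z hz => hφF ▸ boundaryMap_of_mem_flat hz
  -- On `(ℝᵏ × 0) ∪ Y` the inverse of `φ` is `toHalfFlat hk`, as long as the values of the latter
  -- stay in the source of `φ`.
  set Q : Set (Eucl n) := toHalfFlat hk ⁻¹' φ.source ∩ cylCoord n k ⁻¹' cylSlab n k a b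
  have hQ : IsOpen Q := (φ.open_source.preimage (continuous_toHalfFlat hk)).inter
    (isOpen_cylSlab.preimage continuous_cylCoord)
  have h0Q : 0 ∈ Q := ⟨by rwa [mem_preimage, toHalfFlat_of_mem_flat hk (zero_mem _)],
    by rw [mem_preimage, cylCoord_of_mem_flat (zero_mem _)]; exact h.zero_mem_cylSlab⟩
  set ψ := φ.symm.restrOpen Q hQ
  have hright : ∀ w ∈ ψ.source, φ (ψ w) = w := fun w hw => φ.right_inv hw.1
  have hinv : ∀ w ∈ ψ.source, w ∈ (flat n k : Set (Eucl n)) ∪ Y → ψ w = toHalfFlat hk w :=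
    fun w hw hwY => (φ.eq_symm_apply hw.2.1 hw.1).2
      (hφF ▸ h.boundaryMap_toHalfFlat hYK hwY hw.2.2) |>.symm
  refine ⟨ψ, ⟨hφflat 0 (zero_mem _) ▸ φ.map_source h0φ, h0Q⟩, hφ.symm.restrOpen hQ,
    fun w hw => ⟨fun hψw => ?_, fun hwY => ?_⟩, fun w hw => ⟨fun hψw => ?_, fun hwK => ?_⟩⟩
  · have hmem := h.boundaryMap_mem (Λ := Λ) hψw (hφV (φ.map_target hw.1))
    rwa [← hφF, hright w hw] at hmem
  · rw [hinv w hw hwY]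
    exact toHalfFlat_mem_halfFlat hk w
  · rwa [← hright w hw, hφflat _ hψw]
  · rwa [hinv w hw (.inl hwK), toHalfFlat_of_mem_flat hk hwK]

end IsCylParam

end

end BoundaryChart

/-! ### The union of the two strata -/

section Union

variable {n k : ℕ} {X Y : Set (Eucl n)}

theorem IsCpSubmanifold.mono {p q d : ℕ} (h : q ≤ p) (hY : IsCpSubmanifold p d Y) :
    IsCpSubmanifold q d Y :=
  ⟨hY.1, fun y hy =>
    let ⟨φ, hyφ, hφ, hYφ⟩ := hY.2 y hy
    ⟨φ, hyφ, hφ.mono h, hYφ⟩⟩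

theorem isImage_union_of_subset_closure {d : ℕ} {φ : OpenPartialHomeomorph (Eucl n) (Eucl n)}
    (hY : φ.IsImage Y (flat n d)) (hdisj : Disjoint X Y) (hfront : X ⊆ closure Y) :
    φ.IsImage (X ∪ Y) (flat n d) := fun z hz => by
  refine (hY hz).trans ⟨.inr, fun hzXY => hzXY.resolve_left fun hzX => ?_⟩
  have hzflat := (hY.closure hz).2 (hfront hzX)
  rw [(flat n d).closed_of_finiteDimensional.closure_eq] at hzflat
  exact disjoint_left.1 hdisj hzX ((hY hz).1 hzflat)

theorem HasTangentHalfSpace.of_isAdaptedChart {φ ψ : OpenPartialHomeomorph (Eucl n) (Eucl n)}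
    {Y' Y'' : Set (Eucl n)} (hφ : IsAdaptedChart k X Y φ Y') (hψ : IsAdaptedChart k X Y ψ Y'')
    {x θ : Eucl n} (hxφ : x ∈ φ.source) (hxψ : x ∈ ψ.source) (hψx : ψ x = 0)
    (hθ : HasTangentHalfSpace k Y'' 0 θ) : ∃ θ', HasTangentHalfSpace k Y' (φ x) θ' := by
  have h0 : ψ.symm 0 = x := by rw [← hψx, ψ.left_inv hxψ]
  have hsource : (0 : Eucl n) ∈ (ψ.symm.trans φ).source := by
    rw [ψ.symm.trans_source]
    exact ⟨hψx ▸ ψ.map_source hxψ, by rwa [mem_preimage, h0]⟩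
  have hvalue : (ψ.symm.trans φ) 0 = φ x := congrArg φ h0
  exact hvalue ▸ hθ.map (hψ.isCpChart.symm.trans hφ.isCpChart)
    (isImage_trans hψ.isImage_left.symm hφ.isImage_left)
    (isImage_trans hψ.isImage_right.symm hφ.isImage_right) hψ.notMem_flat hsource (zero_mem _)

theorem IsAdaptedChart.exists_boundary_chart {φ : OpenPartialHomeomorph (Eucl n) (Eucl n)}
    {Y' : Set (Eucl n)} (hφ : IsAdaptedChart k X Y φ Y')
    (hX : ∀ u ∈ X, ∃ ψ Y'', u ∈ ψ.source ∧ ψ u = 0 ∧ IsAdaptedChart k X Y ψ Y'' ∧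
      ∃ θ, HasTangentHalfSpace k Y'' 0 θ)
    {x : Eucl n} (hxφ : x ∈ φ.source) (hφx : φ x = 0) :
    ∃ G : OpenPartialHomeomorph (Eucl n) (Eucl n), x ∈ G.source ∧ IsCpChart 1 G ∧
      G.IsImage (X ∪ Y) (halfFlat n k) ∧ G.IsImage X (flat n k) := by
  obtain ⟨a, b, Ψ, hΨ, haφ⟩ := hφ.exists_isCylParam
  have hT : ∀ v : flat n k, ‖v‖ < a → ∃ θ, HasTangentHalfSpace k Y' v θ := by
    intro v hv
    have hvφ : (v : Eucl n) ∈ φ.target := haφ (mem_ball_zero_iff.2 hv)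
    obtain ⟨ψ, Y'', huψ, hψu, hψ, θ, hθ⟩ :=
      hX (φ.symm v) ((hφ.isImage_left.symm_apply_mem_iff hvφ).2 v.2)
    have hhalf := hθ.of_isAdaptedChart hφ hψ (φ.map_target hvφ) huψ hψu
    rwa [φ.right_inv hvφ] at hhalf
  obtain ⟨G, h0G, hG, hGY, hGX⟩ :=
    hΨ.exists_boundary_chart hφ.isCpSubmanifold hφ.notMem_flat hT
  refine ⟨φ.trans G, ?_, hφ.isCpChart.trans hG,
    isImage_trans (hφ.isImage_left.union hφ.isImage_right) hGY, isImage_trans hφ.isImage_left hGX⟩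
  rw [φ.trans_source]
  exact ⟨hxφ, by rwa [mem_preimage, hφx]⟩

end Union

theorem corollary3p10_general (L : FirstOrder.Language) [L.Structure ℝ] (hL : IsOMinimal L)
    (n k : ℕ) (X Y : Set (Eucl n)) (hYdef : IsDefinableSet L Y)
    (hY : IsCpSubmanifold 1 (k + 1) Y) (hdisj : Disjoint X Y) (hfront : X ⊆ closure Y)
    (hclosed : IsLocallyClosed (X ∪ Y))
    (hloc : ∀ x ∈ X, ∀ᶠ ε in 𝓝[>] (0 : ℝ), IsConnected (Y ∩ Metric.ball x ε))
    (ha : ∀ x ∈ X, ConditionA Y X x)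
    (hr : ∀ x ∈ X, ConditionRInt L k Y X x) :
    IsCpSubmanifoldWithBoundary 1 k (X ∪ Y) X := by
  have : Fact (IsOMinimal L) := ⟨hL⟩
  have hchart := fun x (hx : x ∈ X) =>
    exists_isAdaptedChart hYdef hY hdisj hclosed hx (hfront hx) (hloc x hx) (ha x hx) (hr x hx)
  refine ⟨hY.1, subset_union_left, fun x hx => ?_, fun y hy => ?_⟩
  · obtain ⟨φ, Y', hxφ, hφx, hφ, -⟩ := hchart x hx
    exact hφ.exists_boundary_chart hchart hxφ hφx
  · obtain ⟨φ, hyφ, hφ, hYφ⟩ := hY.2 y (hy.1.resolve_left hy.2)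
    exact ⟨φ, hyφ, hφ, isImage_union_of_subset_closure hYφ hdisj hfront⟩

theorem corollary3p10 (L : FirstOrder.Language) [L.Structure ℝ] (hL : IsOMinimal L)
    (n k : ℕ) (X Y : Set (Eucl n))
    (hXdef : IsDefinableSet L X) (hYdef : IsDefinableSet L Y)
    (hX : IsCpSubmanifold 2 k X) (hY : IsCpSubmanifold 2 (k + 1) Y)
    (hXconn : IsConnected X) (hYconn : IsConnected Y)
    (hdisj : Disjoint X Y) (hfront : X ⊆ closure Y) (hclosed : IsLocallyClosed (X ∪ Y))
    (hloc : ∀ x ∈ X, ∀ᶠ ε in 𝓝[>] (0 : ℝ), IsConnected (Y ∩ Metric.ball x ε))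
    (ha : ∀ x ∈ X, ConditionA Y X x)
    (hr : ∀ x ∈ X, ConditionRInt L k Y X x) :
    IsCpSubmanifoldWithBoundary 1 k (X ∪ Y) X :=
  corollary3p10_general L hL n k X Y hYdef (hY.mono one_le_two) hdisj hfront hclosed hloc ha hr
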